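/- **Setting.** Let $n\ge 2$ and let $U\subset\mathbb R^n$ be open and bounded with $C^1$ boundary $\Gamma=\partial U$; $\sigma$ is the surface measure on $\Gamma$ and $\vec\nu$ the outward unit normal. Let $g(s)=a_0s^{\alpha_0}+a_1s^{\alpha_1}+\dots+a_Ns^{\alpha_N}$ for $s\ge 0$, where $N\ge 1$, $a_i>0$ and $0=\alpha_0<\alpha_1<\dots<\alpha_N$ are real; put $K(\xi)=1/g(s(\xi))$ for $\xi\ge 0$, where $s=s(\xi)$ is the unique non-negative solution of $s\,g(s)=\xi$, and $a=\frac{\alpha_N}{\alpha_N+1}\in(0,1)$. Let $\lambda\in(0,1]$, $\delta=1-\lambda$, and assume $a>\delta$. For $\alpha$ as below put $$\mu_0=\frac{a-\delta}{1-a},\quad \alpha_*=\frac{n(a-\delta)}{2-a},\quad \theta=\frac{1}{(1-a)(\alpha/\alpha_*-1)},\quad \mu_1=\frac{\mu_0(1+\theta(1-a))}{1-\theta},\quad \mu_3=\frac{(2-a)\alpha}{(1-a)(\alpha-(\lambda+1+\mu_0))}.$$ For $T>0$ consider non-negative solutions $u$ on $[0,T]$ of $$(u^\lambda)_t=\nabla\cdot(K(|\nabla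 u|)\nabla u)\ \text{in } U\times(0,T),\qquad u(\cdot,0)=u_0\ \text{in } U,\qquad K(|\nabla u|)\frac{\partial u}{\partial\vec\nu}+\varphi u^\lambda=0\ \text{on }\Gamma\times(0,T).$$ Here $\varphi$ is continuous on $\Gamma\times[0,T]$ and, for $\sigma$-a.e. $x\in\Gamma$, $\varphi(x,\cdot)$ is locally absolutely continuous on $(0,T]$ with derivative $\varphi_t(x,\cdot)$, $\varphi_t$ being measurable on $\Gamma\times(0,T)$. A solution is a function $u\ge 0$ such that $u\in C(\bar U\times[0,T])\cap C([0,T];W^{1,2-a}(U))$; $u(\cdot,0)=u_0$ on $\bar U$; for every $\varepsilon\in(0,T)$, $u$ is Lipschitz in $t$ on $[\varepsilon,T]$ uniformly in $x\in\bar U$; $u^\lambda$ is locally absolutely continuous on $(0,T]$ with values in $L^1(U)$, with derivative $(u^\lambda)_t\in L^1(U\times(\varepsilon,T))$ for every $\varepsilon\in(0,T)$; and, for a.e. $t\in(0,T)$, $$\int_U (u^\lambda)_t\,v\,dx+\int_U K(|\nabla u|)\nabla u\cdot\nabla v\,dx+\int_\Gamma\varphi u^\lambda v\,d\sigma=0\qquad\text{for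 all } v\in C(\bar U)\cap W^{1,2-a}(U).$$ **Theorem 3.2.** Assume $\alpha>\max\{n\mu_0,\lambda+1+\mu_0\}$. There are constants $C_3>0$ and $C>0$, depending only on $\alpha,\lambda,g,n,U$, such that the following holds. Let $T>0$, let $u$ be a non-negative solution on $[0,T]$ with data $u_0,\varphi$ as above, and suppose $$\int_0^T\Big(1+\|\varphi^-(t)\|_{L^\infty(\Gamma)}^{\frac{2-a}{(1-a)(1-\theta)}}\Big)dt\le\frac{1-2^{-\mu_1/\alpha}}{C_3}\Big(1+\int_U u_0^\alpha\,dx\Big)^{-\mu_1/\alpha}.$$ Then for all $t\in(0,T]$ $$\int_0^t\int_U u^{1-\lambda}|(u^\lambda)_t|^2\,dx\,d\tau+\int_U|\nabla u(x,t)|^{2-a}\,dx\le C\mathcal E_0+C\mathcal K(t),$$ where $$\mathcal E_0=\int_U u_0^\alpha\,dx+\int_U|\nabla u_0|^{2-a}\,dx+\int_\Gamma u_0^{\lambda+1}(x)\,\varphi^+(x,0)\,d\sigma,$$ $$\mathcal K(t)=1+\|\varphi^-(t)\|_{L^\infty(\Gamma)}^{\mu_3}+\int_0^t\int_\Gamma|\varphi_t(x,\tau)|^{\frac{\alpha}{\alpha-\lambda-1}}\,d\sigma\,d\tau,$$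 with $f^\pm=\max\{\pm f,0\}$; if the last integral is infinite, the estimate is understood as trivially true. -/

import Mathlib

open MeasureTheory Set Filter Topology
open scoped ENNReal ContDiff InnerProductSpace

noncomputable section

namespace Forchheimer

/-- A generalized polynomial `g(s) = a₀ s^α₀ + ⋯ + a_N s^α_N` with `N ≥ 1`, positive coefficients
and real exponents `α₀ = 0 < α₁ < ⋯ < α_N`. -/
structure GenPoly where
  N : ℕ
  one_le_N : 1 ≤ N
  coeff : Fin (N + 1) → ℝ
  expo : Fin (N + 1) → ℝ
  coeff_pos : ∀ i, 0 < coeff i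
  expo_zero : expo 0 = 0
  expo_strictMono : StrictMono expo

namespace GenPoly

variable (P : GenPoly)

/-- The function `g`. -/
def g (s : ℝ) : ℝ := ∑ i, P.coeff i * s ^ P.expo i

/-- The degeneracy exponent `a = α_N / (α_N + 1)`. -/
def a : ℝ := P.expo (Fin.last P.N) / (P.expo (Fin.last P.N) + 1)

/-- `s(ξ)`: the unique non-negative solution of `s g(s) = ξ` (for `ξ ≥ 0`, see
`existsUnique_root` and `root_spec`). -/
def root (ξ : ℝ) : ℝ := Classical.epsilon fun s : ℝ => 0 ≤ s ∧ s * P.g s = ξ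

/-- `K(ξ) = 1 / g(s(ξ))`. -/
def K (ξ : ℝ) : ℝ := 1 / P.g (P.root ξ)

lemma expo_nonneg (i : Fin (P.N + 1)) : 0 ≤ P.expo i := by
  rw [← P.expo_zero]
  exact P.expo_strictMono.monotone (Fin.zero_le i)

lemma coeff_zero_le_g {s : ℝ} (hs : 0 ≤ s) : P.coeff 0 ≤ P.g s := by
  have h := Finset.single_le_sum (s := Finset.univ)
    (f := fun i => P.coeff i * s ^ P.expo i)
    (fun i _ => mul_nonneg (P.coeff_pos i).le (Real.rpow_nonneg hs _)) (Finset.mem_univ 0)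
  simpa [g, P.expo_zero] using h

lemma g_mono {s t : ℝ} (hs : 0 ≤ s) (hst : s ≤ t) : P.g s ≤ P.g t :=
  Finset.sum_le_sum fun i _ =>
    mul_le_mul_of_nonneg_left (Real.rpow_le_rpow hs hst (P.expo_nonneg i)) (P.coeff_pos i).le

lemma continuous_g : Continuous P.g :=
  continuous_finsetSum _ fun i _ =>
    continuous_const.mul (Real.continuous_rpow_const (P.expo_nonneg i))

lemma existsUnique_root {ξ : ℝ} (hξ : 0 ≤ ξ) : ∃! s : ℝ, 0 ≤ s ∧ s * P.g s = ξ := by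
  have ha := P.coeff_pos 0
  have hc : Continuous fun s : ℝ => s * P.g s := continuous_id.mul P.continuous_g
  have hM : 0 ≤ ξ / P.coeff 0 := div_nonneg hξ ha.le
  have hle : ξ ≤ (ξ / P.coeff 0) * P.g (ξ / P.coeff 0) := by
    calc ξ = (ξ / P.coeff 0) * P.coeff 0 := by field_simp
      _ ≤ _ := mul_le_mul_of_nonneg_left (P.coeff_zero_le_g hM) hM
  obtain ⟨s, hs, hsx⟩ := intermediate_value_Icc hM hc.continuousOn
    (show ξ ∈ Icc ((0 : ℝ) * P.g 0) _ from ⟨by simpa using hξ, hle⟩)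
  have key : ∀ x y : ℝ, 0 ≤ x → x < y → x * P.g x < y * P.g y := fun x y hx hxy =>
    calc x * P.g x ≤ x * P.g y := mul_le_mul_of_nonneg_left (P.g_mono hx hxy.le) hx
      _ < y * P.g y :=
        mul_lt_mul_of_pos_right hxy (ha.trans_le (P.coeff_zero_le_g (hx.trans hxy.le)))
  refine ⟨s, ⟨hs.1, hsx⟩, ?_⟩
  rintro t ⟨ht, htx⟩
  have hsx' : s * P.g s = ξ := hsx
  rcases lt_trichotomy t s with h | h | h
  · have := key t s ht h
    linarith
  · exact h
  · have := key s t hs.1 h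
    linarith

lemma root_spec {ξ : ℝ} (hξ : 0 ≤ ξ) : 0 ≤ P.root ξ ∧ P.root ξ * P.g (P.root ξ) = ξ :=
  Classical.epsilon_spec (P.existsUnique_root hξ).exists

end GenPoly

/-! ### Exponents

Throughout, `a` is the exponent of `g`, `lam ∈ (0,1]`, `n` is the space dimension. -/

/-- `μ₀ = (a - δ) / (1 - a)` with `δ = 1 - lam`. -/
def mu0 (a lam : ℝ) : ℝ := (a - (1 - lam)) / (1 - a)

/-- `α_* = n (a - δ) / (2 - a)` with `δ = 1 - lam`. -/
def alphaStar (n : ℕ) (a lam : ℝ) : ℝ := n * (a - (1 - lam)) / (2 - a)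

/-- `θ = 1 / ((1 - a) (α / α_* - 1))`. -/
def theta (n : ℕ) (a lam α : ℝ) : ℝ := 1 / ((1 - a) * (α / alphaStar n a lam - 1))

/-- `μ₁ = μ₀ (1 + θ (1 - a)) / (1 - θ)`. -/
def mu1 (n : ℕ) (a lam α : ℝ) : ℝ :=
  mu0 a lam * (1 + theta n a lam α * (1 - a)) / (1 - theta n a lam α)

/-- `μ₃ = (2 - a) α / ((1 - a) (α - (lam + 1 + μ₀)))`. -/
def mu3 (a lam α : ℝ) : ℝ := (2 - a) * α / ((1 - a) * (α - (lam + 1 + mu0 a lam)))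

/-- The exponent `(2 - a) / ((1 - a) (1 - θ))`. -/
def phiExp (n : ℕ) (a lam α : ℝ) : ℝ := (2 - a) / ((1 - a) * (1 - theta n a lam α))

/-! ### Domains, surface measure, weak gradients -/

/-- The boundary of `U` is `C¹`: near each boundary point, after choosing a unit direction `e`,
`U` is the region strictly above the graph of a `C¹` function over the hyperplane `e^⊥`.
(`x - ⟪e, x⟫ • e` is the orthogonal projection of `x` onto `e^⊥`.) -/
def HasC1Boundary {n : ℕ} (U : Set (EuclideanSpace ℝ (Fin n))) : Prop :=
  ∀ x₀ ∈ frontier U, ∃ (e : EuclideanSpace ℝ (Fin n)) (γ : EuclideanSpace ℝ (Fin n) → ℝ) (r : ℝ),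
    ‖e‖ = 1 ∧ ContDiff ℝ 1 γ ∧ 0 < r ∧
      ∀ x ∈ Metric.ball x₀ r, x ∈ U ↔ γ (x - ⟪e, x⟫_ℝ • e) < ⟪e, x⟫_ℝ

/-- The surface measure `σ` on `Γ = ∂U`: the `(n-1)`-dimensional Hausdorff measure, normalized to
agree with Lebesgue measure on hyperplanes, restricted to `∂U`. -/
def surf {n : ℕ} (U : Set (EuclideanSpace ℝ (Fin n))) : Measure (EuclideanSpace ℝ (Fin n)) :=
  (Measure.euclideanHausdorffMeasure (n - 1)).restrict (frontier U)

/-- `F` is the weak (distributional) gradient of `f` in the open set `U`. -/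
def IsWeakGrad {n : ℕ} (U : Set (EuclideanSpace ℝ (Fin n))) (f : EuclideanSpace ℝ (Fin n) → ℝ)
    (F : EuclideanSpace ℝ (Fin n) → EuclideanSpace ℝ (Fin n)) : Prop :=
  ∀ ψ : EuclideanSpace ℝ (Fin n) → ℝ, ContDiff ℝ ∞ ψ → HasCompactSupport ψ → tsupport ψ ⊆ U →
    ∀ e : EuclideanSpace ℝ (Fin n),
      ∫ x in U, f x * fderiv ℝ ψ x e = - ∫ x in U, ⟪F x, e⟫_ℝ * ψ x

/-! ### The initial boundary value problem -/

/-- Boundary data on `Γ × [0,T]`: `φ` is continuous, and for almost every `x ∈ Γ` the function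
`φ(x,·)` is locally absolutely continuous on `(0,T]` with derivative `φt(x,·)`. -/
structure IsBoundaryData {n : ℕ} (U : Set (EuclideanSpace ℝ (Fin n))) (T : ℝ)
    (φ φt : ℝ → EuclideanSpace ℝ (Fin n) → ℝ) : Prop where
  continuousOn : ContinuousOn (fun p : ℝ × EuclideanSpace ℝ (Fin n) => φ p.1 p.2)
    (Icc 0 T ×ˢ frontier U)
  aestronglyMeasurable : AEStronglyMeasurable
    (fun p : ℝ × EuclideanSpace ℝ (Fin n) => φt p.1 p.2)
    ((volume.restrict (Ioc 0 T)).prod (surf U))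
  deriv : ∀ᵐ x ∂(surf U), ∀ s t : ℝ, 0 < s → s ≤ t → t ≤ T →
    IntervalIntegrable (fun τ => φt τ x) volume s t ∧ φ t x - φ s x = ∫ τ in s..t, φt τ x

/-- `u` is a non-negative (strong) solution on the time interval `[0,T]` of
`(u^lam)_t = ∇ · (K(|∇u|) ∇u)` in `U`, `u(·,0) = u₀`, `K(|∇u|) ∂u/∂ν + φ u^lam = 0` on `Γ`,
where `Du t` is the gradient of `u(·,t)` and `w = (u^lam)_t`.

The traces on `Γ` and at `t = 0` are those of the continuous function `u`. The equation together
with the flux boundary condition is imposed in the weak form, for almost every time, with all test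
functions `v ∈ C(Ū) ∩ W^{1,2-a}(U)`. -/
structure IsSolution {n : ℕ} (U : Set (EuclideanSpace ℝ (Fin n))) (P : GenPoly) (lam T : ℝ)
    (φ : ℝ → EuclideanSpace ℝ (Fin n) → ℝ) (u₀ : EuclideanSpace ℝ (Fin n) → ℝ)
    (u : ℝ → EuclideanSpace ℝ (Fin n) → ℝ)
    (Du : ℝ → EuclideanSpace ℝ (Fin n) → EuclideanSpace ℝ (Fin n))
    (w : ℝ → EuclideanSpace ℝ (Fin n) → ℝ) : Prop where
  nonneg : ∀ t ∈ Icc 0 T, ∀ x ∈ closure U, 0 ≤ u t x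
  /-- `u ∈ C(Ū × [0,T])` -/
  continuousOn : ContinuousOn (fun p : ℝ × EuclideanSpace ℝ (Fin n) => u p.1 p.2)
    (Icc 0 T ×ˢ closure U)
  initial : ∀ x ∈ closure U, u 0 x = u₀ x
  /-- `u ∈ C([0,T]; W^{1,2-a}(U))` -/
  weakGrad : ∀ t ∈ Icc 0 T, IsWeakGrad U (u t) (Du t)
  memLp : ∀ t ∈ Icc 0 T, MemLp (Du t) (ENNReal.ofReal (2 - P.a)) (volume.restrict U)
  continuous_grad : ∀ t ∈ Icc 0 T,
    Tendsto (fun s => eLpNorm (Du s - Du t) (ENNReal.ofReal (2 - P.a)) (volume.restrict U))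
      (𝓝[Icc 0 T] t) (𝓝 0)
  /-- `u` is locally Lipschitz in time on `(0,T]`, uniformly in `x` (that is, `u_t` is bounded on
  `Ū × [ε,T]`) -/
  lipschitz_time : ∀ ε : ℝ, 0 < ε → ∃ L : ℝ, ∀ x ∈ closure U, ∀ s ∈ Icc ε T, ∀ t ∈ Icc ε T,
    |u t x - u s x| ≤ L * |t - s|
  /-- `u^lam` is locally absolutely continuous on `(0,T]` with values in `L¹(U)`, and
  `w = (u^lam)_t` -/
  integrable_timeDeriv : ∀ ε : ℝ, 0 < ε →
    IntegrableOn (fun p : ℝ × EuclideanSpace ℝ (Fin n) => w p.1 p.2) (Ioc ε T ×ˢ U)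
  timeDeriv : ∀ s t : ℝ, 0 < s → s ≤ t → t ≤ T →
    ∀ᵐ x ∂(volume.restrict U), u t x ^ lam - u s x ^ lam = ∫ τ in s..t, w τ x
  /-- the PDE and the flux boundary condition -/
  equation : ∀ᵐ t ∂(volume.restrict (Ioc 0 T)),
    ∀ (v : EuclideanSpace ℝ (Fin n) → ℝ) (Dv : EuclideanSpace ℝ (Fin n) → EuclideanSpace ℝ (Fin n)),
      ContinuousOn v (closure U) → IsWeakGrad U v Dv →
      MemLp Dv (ENNReal.ofReal (2 - P.a)) (volume.restrict U) →
        (∫ x in U, w t x * v x) + (∫ x in U, P.K ‖Du t x‖ * ⟪Du t x, Dv x⟫_ℝ)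
          + (∫ x, φ t x * u t x ^ lam * v x ∂(surf U)) = 0

/-! ### The quantities in the estimate (with values in `[0,∞]`) -/

/-- `‖φ⁻(t)‖_{L^∞(Γ)}`, where `φ⁻ = max {-φ, 0}`. -/
def negNorm {n : ℕ} (U : Set (EuclideanSpace ℝ (Fin n)))
    (φ : ℝ → EuclideanSpace ℝ (Fin n) → ℝ) (t : ℝ) : ℝ≥0∞ :=
  eLpNorm (fun x => max (-φ t x) 0) ∞ (surf U)

/-- `∫_U u₀^α dx`. -/
def initMass {n : ℕ} (U : Set (EuclideanSpace ℝ (Fin n))) (α : ℝ)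
    (u₀ : EuclideanSpace ℝ (Fin n) → ℝ) : ℝ≥0∞ :=
  ∫⁻ x in U, ENNReal.ofReal (u₀ x ^ α)

/-- The smallness condition on `T`:
`∫₀ᵀ (1 + ‖φ⁻(t)‖^{(2-a)/((1-a)(1-θ))}) dt ≤ (1 - 2^{-μ₁/α}) / C₃ · (1 + ∫_U u₀^α)^{-μ₁/α}`. -/
def TimeCondition {n : ℕ} (U : Set (EuclideanSpace ℝ (Fin n))) (a lam α C₃ T : ℝ)
    (φ : ℝ → EuclideanSpace ℝ (Fin n) → ℝ) (u₀ : EuclideanSpace ℝ (Fin n) → ℝ) : Prop :=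
  ∫⁻ t in Ioc 0 T, (1 + negNorm U φ t ^ phiExp n a lam α) ≤
    ENNReal.ofReal ((1 - (2 : ℝ) ^ (-(mu1 n a lam α / α))) / C₃)
      * (1 + initMass U α u₀) ^ (-(mu1 n a lam α / α))

/-- `𝓔₀ = ∫_U u₀^α dx + ∫_U |∇u₀|^{2-a} dx + ∫_Γ u₀^{lam+1} φ⁺(x,0) dσ`. -/
def E0 {n : ℕ} (U : Set (EuclideanSpace ℝ (Fin n))) (a lam α : ℝ)
    (φ : ℝ → EuclideanSpace ℝ (Fin n) → ℝ) (u₀ : EuclideanSpace ℝ (Fin n) → ℝ)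
    (Du₀ : EuclideanSpace ℝ (Fin n) → EuclideanSpace ℝ (Fin n)) : ℝ≥0∞ :=
  initMass U α u₀ + (∫⁻ x in U, ‖Du₀ x‖ₑ ^ (2 - a))
    + ∫⁻ x, ENNReal.ofReal (u₀ x ^ (lam + 1) * max (φ 0 x) 0) ∂(surf U)

/-- `𝒦(t) = 1 + ‖φ⁻(t)‖^{μ₃} + ∫₀ᵗ ∫_Γ |φ_t|^{α/(α-lam-1)} dσ dτ`. -/
def calK {n : ℕ} (U : Set (EuclideanSpace ℝ (Fin n))) (a lam α : ℝ)
    (φ φt : ℝ → EuclideanSpace ℝ (Fin n) → ℝ) (t : ℝ) : ℝ≥0∞ :=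
  1 + negNorm U φ t ^ mu3 a lam α
    + ∫⁻ τ in Ioc 0 t, ∫⁻ x, ‖φt τ x‖ₑ ^ (α / (α - lam - 1)) ∂(surf U)

end Forchheimer

end

/-!
The estimate combines a bound for the moment `∫ u^α`, obtained from the test function `u^(α-λ)`,
with an energy inequality, obtained formally from the test function `u_t`. Throughout,
`p = 2 - a` is the growth exponent of the diffusion, `d = a - (1 - λ)`, and `d + p = λ + 1`.

**Inequalities on the domain.** A `C¹` boundary gives a uniform interior cone near each point of
the closure (`exists_coneAt`). All `W^{1,1}` inequalities come from the remark that, for a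
direction `v` in the cone, a function of small support is bounded at `x` by the integral of its
gradient along the ray `x + t v`, which stays in `U` as long as it matters
(`ConeAt.enorm_le_lintegral_line`). Taking a basis of `ℝⁿ` inside the cone, the grid-lines lemma
turns this into the Sobolev inequality up to the boundary. Taking one direction, and using that
the projection of the boundary along it is bi-Lipschitz, one gets the trace inequality. Both pass
from smooth functions to functions with a weak gradient by mollifying with kernels shifted in the
cone direction, for which the mollified function only sees values inside `U`; cut-off functions
and compactness of the closure make them global (`exists_trace_const`, `exists_sobolev_const`).
With the chain rule `IsWeakGrad.comp_contDiff` they apply to powers of `u` (`exists_trace_rpow`,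
`exists_sobolev_rpow`).

**The moment bound.** Testing with `u^(α-λ)` leaves the boundary integral of `φ⁻ u^α`. Trace
inequality and Young's inequality reduce it to a small part of the dissipation
`∫ u^(α-λ-1) |∇u|^p` and `∫ u^(α + μ₀)`, and the latter is interpolated between the dissipation
and `∫ u^α` (`exists_interpolation`). Here `α > n μ₀` is what makes the interpolation exponent `θ`
smaller than one. For `y = 1 + ∫ u^α` this yields
`y' ≤ C (1 + ‖φ⁻‖^E) y^(1 + μ₁/α)`, with the exponent `E = phiExp` of the condition on `T`
(`exists_moment_inequality`), and this condition is exactly the one under which a solution of such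
a differential inequality at most doubles (`le_two_mul_of_sub_le_integral`, `exists_moment_bound`).
The same computation bounds the integral of `u^α` over the lateral boundary.

**The energy inequality.** The flux `K(|ξ|) ξ` is the gradient of the convex function
`energy |ξ|`, which is comparable to `|ξ|^p` up to
additive constants. Since `u_t` is not an admissible test function, the
equation at time `τ` is tested with `u(τ - h) - u(τ)`; convexity bounds the diffusion term by a
difference of energies (`IsSolution.ae_diff_energy_le`), and `h → 0` is harmless because `u` is
Lipschitz in time away from `t = 0` (`tendsto_integral_diffQuot`). In the boundary term,
`φ u^λ u_t = φ (u^(λ+1))_t / (λ+1)` is integrated by parts in time, which produces `φ_t u^(λ+1)` and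
the boundary energies at the two end points (`IsSolution.boundary_energy_le`,
`IsSolution.energy_inequality`).

Finally `φ_t u^(λ+1)` is split by Young's inequality into the power of `φ_t` in `𝒦(t)` and `u^α` on
the boundary, which the moment bound controls, while the boundary energy at the final time is
absorbed, by the trace inequality, into the gradient term and the moment
(`exists_boundary_energy_bound`).
-/

open scoped NNReal

namespace Forchheimer

/-! ### Cones at points of the closure of a `C¹` domain -/

/-- Uniform interior cone condition at `x₀`: from every point of `closure U` close to `x₀`, moving
a short way in a direction close to the unit vector `e` leads into `U`. -/
def ConeAt {E : Type*} [NormedAddCommGroup E] [NormedSpace ℝ E] (U : Set E) (x₀ e : E)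
    (c r : ℝ) : Prop :=
  ‖e‖ = 1 ∧ 0 < c ∧ c ≤ 1 ∧ 0 < r ∧ ∀ x ∈ closure U ∩ Metric.ball x₀ r, ∀ v ∈ Metric.ball e c,
    ∀ t ∈ Ioo (0 : ℝ) r, x + t • v ∈ U

lemma exists_coneAt_of_mem {n : ℕ} (hn : 1 ≤ n) {U : Set (EuclideanSpace ℝ (Fin n))}
    (hU : IsOpen U) {x₀ : EuclideanSpace ℝ (Fin n)} (hx₀ : x₀ ∈ U) :
    ∃ e c r, ConeAt U x₀ e c r := by
  obtain ⟨R, hR, hRU⟩ := Metric.isOpen_iff.1 hU x₀ hx₀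
  refine ⟨EuclideanSpace.single ⟨0, hn⟩ 1, 1, R / 3, by simp, one_pos, le_rfl, by positivity, ?_⟩
  rintro x ⟨-, hx⟩ v hv t ht
  apply hRU
  rw [Metric.mem_ball, dist_eq_norm] at hx hv ⊢
  have h1 : ‖v‖ ≤ 2 := by
    have := norm_add_le (v - EuclideanSpace.single ⟨0, hn⟩ (1 : ℝ))
      (EuclideanSpace.single ⟨0, hn⟩ (1 : ℝ))
    rw [sub_add_cancel] at this
    have h2 : ‖EuclideanSpace.single (⟨0, hn⟩ : Fin n) (1 : ℝ)‖ = 1 := by simp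
    linarith
  have h2 : ‖t • v‖ ≤ R / 3 * 2 := by
    rw [norm_smul, Real.norm_of_nonneg ht.1.le]
    exact mul_le_mul ht.2.le h1 (norm_nonneg _) (by positivity)
  calc ‖x + t • v - x₀‖ = ‖(x - x₀) + t • v‖ := by congr 1; abel
    _ ≤ _ := norm_add_le _ _
    _ < R := by linarith

/-- Near a boundary point, `U` lies above the graph of a function with local Lipschitz constant `K`,
so that directions within `1 / (3 (K + 1))` of the upward direction lead into `U`. -/
lemma exists_coneAt_of_mem_frontier {n : ℕ} {U : Set (EuclideanSpace ℝ (Fin n))}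
    (hC1 : HasC1Boundary U) {x₀ : EuclideanSpace ℝ (Fin n)} (hx₀ : x₀ ∈ frontier U) :
    ∃ e c r, ConeAt U x₀ e c r := by
  obtain ⟨e, γ, R, he, hγ, hR, hU⟩ := hC1 x₀ hx₀
  set p : EuclideanSpace ℝ (Fin n) → EuclideanSpace ℝ (Fin n) := fun x => x - ⟪e, x⟫_ℝ • e with hp
  have hpc : Continuous p := by fun_prop
  obtain ⟨K, t, ht, hK⟩ := (hγ.contDiffAt (x := p x₀)).exists_lipschitzOnWith
  obtain ⟨R', hR', hR'U⟩ := Metric.mem_nhds_iff.1 (hpc.continuousAt.preimage_mem_nhds ht)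
  set r := min R R' / 3 with hr
  have hr0 : 0 < r := by positivity
  have hrR : 3 * r ≤ R := by rw [hr]; linarith [min_le_left R R']
  have hrR' : 3 * r ≤ R' := by rw [hr]; linarith [min_le_right R R']
  set c : ℝ := 1 / (3 * (K + 1)) with hc
  have hK0 : (0 : ℝ) ≤ K := K.2
  have hc0 : 0 < c := by positivity
  have hc1 : 3 * c * (K + 1) = 1 := by rw [hc]; field_simp
  have hc2 : c ≤ 1 := by nlinarith
  refine ⟨e, c, r, he, hc0, hc2, hr0, ?_⟩
  rintro x ⟨hxU, hx⟩ v hv s hs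
  rw [Metric.mem_ball, dist_eq_norm] at hx hv
  have hv1 : ‖v‖ ≤ 2 := by
    have := norm_add_le (v - e) e
    rw [sub_add_cancel] at this
    linarith
  have h2 : ‖s • v‖ ≤ r * 2 := by
    rw [norm_smul, Real.norm_of_nonneg hs.1.le]
    exact mul_le_mul hs.2.le hv1 (norm_nonneg _) (by positivity)
  have h3 : x + s • v ∈ Metric.ball x₀ (3 * r) := by
    rw [Metric.mem_ball, dist_eq_norm]
    calc ‖x + s • v - x₀‖ = ‖(x - x₀) + s • v‖ := by congr 1; abel
      _ ≤ _ := norm_add_le _ _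
      _ < 3 * r := by linarith
  have hxb : x ∈ Metric.ball x₀ (3 * r) := by
    rw [Metric.mem_ball, dist_eq_norm]; linarith
  -- points of the closure lie on or above the graph
  have hxγ : γ (p x) ≤ ⟪e, x⟫_ℝ := by
    have hcl : IsClosed {y | γ (p y) ≤ ⟪e, y⟫_ℝ} :=
      isClosed_le (hγ.continuous.comp hpc) (by fun_prop)
    have hsub : Metric.ball x₀ R ∩ U ⊆ {y | γ (p y) ≤ ⟪e, y⟫_ℝ} := fun y hy =>
      ((hU y hy.1).1 hy.2).le
    exact closure_minimal hsub hcl (Metric.isOpen_ball.inter_closure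
      ⟨Metric.ball_subset_ball hrR hxb, hxU⟩)
  rw [hU _ (Metric.ball_subset_ball hrR h3)]
  have hL := hK.dist_le_mul (p (x + s • v)) (hR'U (Metric.ball_subset_ball hrR' h3)) (p x)
    (hR'U (Metric.ball_subset_ball hrR' hxb))
  rw [Real.dist_eq, dist_eq_norm] at hL
  have hee : ⟪e, e⟫_ℝ = 1 := by rw [real_inner_self_eq_norm_sq, he]; norm_num
  -- the horizontal displacement is only due to the difference between `v` and `e`
  have hpp : p (x + s • v) - p x = s • ((v - e) - ⟪e, v - e⟫_ℝ • e) := by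
    simp only [hp, inner_add_right, inner_smul_right, inner_sub_right, hee]
    module
  have hin : |⟪e, v - e⟫_ℝ| ≤ ‖v - e‖ := by
    have := abs_real_inner_le_norm e (v - e)
    rwa [he, one_mul] at this
  have hpn : ‖p (x + s • v) - p x‖ ≤ s * (2 * ‖v - e‖) := by
    rw [hpp, norm_smul, Real.norm_of_nonneg hs.1.le]
    refine mul_le_mul_of_nonneg_left ?_ hs.1.le
    refine (norm_sub_le _ _).trans ?_
    rw [norm_smul, he, mul_one, Real.norm_eq_abs]
    linarith
  have hL2 : γ (p (x + s • v)) - γ (p x) ≤ K * (s * (2 * ‖v - e‖)) :=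
    (le_abs_self _).trans (hL.trans (mul_le_mul_of_nonneg_left hpn hK0))
  have hin2 : ⟪e, x + s • v⟫_ℝ = ⟪e, x⟫_ℝ + s * (1 + ⟪e, v - e⟫_ℝ) := by
    rw [inner_add_right, inner_smul_right, inner_sub_right, hee]; ring
  change γ (p (x + s • v)) < _
  rw [hin2]
  have h5 : K * (2 * ‖v - e‖) < 1 + ⟪e, v - e⟫_ℝ := by
    have := (abs_le.1 hin).1
    have h6 : (K : ℝ) * (2 * ‖v - e‖) ≤ K * (2 * c) := by gcongr
    nlinarith
  have h7 := mul_lt_mul_of_pos_left h5 hs.1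
  have h8 : (K : ℝ) * (s * (2 * ‖v - e‖)) = s * (K * (2 * ‖v - e‖)) := by ring
  linarith

lemma exists_coneAt {n : ℕ} (hn : 1 ≤ n) {U : Set (EuclideanSpace ℝ (Fin n))}
    (hU : IsOpen U) (hC1 : HasC1Boundary U) {x₀ : EuclideanSpace ℝ (Fin n)}
    (hx₀ : x₀ ∈ closure U) : ∃ e c r, ConeAt U x₀ e c r := by
  by_cases h : x₀ ∈ U
  · exact exists_coneAt_of_mem hn hU h
  · exact exists_coneAt_of_mem_frontier hC1 ⟨hx₀, by rwa [hU.interior_eq]⟩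

lemma ConeAt.norm_le_two {E : Type*} [NormedAddCommGroup E] [NormedSpace ℝ E] {U : Set E}
    {x₀ e : E} {c r : ℝ} (h : ConeAt U x₀ e c r) {v : E} (hv : v ∈ Metric.ball e c) :
    ‖v‖ ≤ 2 := by
  rw [Metric.mem_ball, dist_eq_norm] at hv
  have := norm_add_le (v - e) e
  rw [sub_add_cancel, h.1] at this
  linarith [h.2.2.1]

/-- A linear system of coordinates on `ℝⁿ` all of whose axes point in directions within `c` of a
given unit vector `e`. -/
lemma exists_coords_near {n : ℕ} (e : EuclideanSpace ℝ (Fin n)) {c : ℝ}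
    (hc : 0 < c) :
    ∃ L : (Fin n → ℝ) ≃L[ℝ] EuclideanSpace ℝ (Fin n), ∀ i,
      L (Pi.single i 1) ∈ Metric.ball e c := by
  -- `L z = s z + (∑ zᵢ) e`, where the sign of `s` is chosen to make `L` injective
  obtain ⟨s, hs0, hsc, hse⟩ : ∃ s : ℝ, s ≠ 0 ∧ |s| < c ∧ 0 ≤ (∑ i, e i) / s := by
    rcases le_total 0 (∑ i, e i) with h | h
    · exact ⟨c / 2, by positivity, by rw [abs_of_pos (by positivity)]; linarith,
        div_nonneg h (by positivity)⟩
    · refine ⟨-(c / 2), by simp; positivity, by rw [abs_neg, abs_of_pos (by positivity)]; linarith,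
        div_nonneg_of_nonpos h (by linarith)⟩
  let f : (Fin n → ℝ) →ₗ[ℝ] EuclideanSpace ℝ (Fin n) :=
    { toFun := fun z => s • WithLp.toLp 2 z + (∑ i, z i) • e
      map_add' := fun x y => by
        simp only [Pi.add_apply, Finset.sum_add_distrib, WithLp.toLp_add]; module
      map_smul' := fun a x => by
        simp only [Pi.smul_apply, smul_eq_mul, ← Finset.mul_sum, WithLp.toLp_smul,
          RingHom.id_apply]; module }
  have hf : Function.Injective f := by
    rw [← LinearMap.ker_eq_bot, LinearMap.ker_eq_bot']
    intro z hz
    have h1 : ∀ i, s * z i + (∑ j, z j) * e i = 0 := fun i => by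
      have := congrArg (fun y : EuclideanSpace ℝ (Fin n) => y i) hz
      simpa [f] using this
    have h2 : ∀ i, z i = -(∑ j, z j) * e i / s := fun i => by
      field_simp; linarith [h1 i]
    have h3 : (∑ j, z j) * (1 + (∑ i, e i) / s) = 0 := by
      have : ∑ j, z j = ∑ j, -(∑ j, z j) * e j / s := Finset.sum_congr rfl fun i _ => h2 i
      rw [← Finset.sum_div, ← Finset.mul_sum] at this
      rw [mul_add, mul_one]
      nth_rewrite 1 [this]
      ring
    have h4 : ∑ j, z j = 0 := by
      rcases mul_eq_zero.1 h3 with h | h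
      · exact h
      · linarith
    funext i
    rw [h2 i, h4]; simp
  refine ⟨(LinearMap.linearEquivOfInjective f hf (by simp)).toContinuousLinearEquiv, fun i => ?_⟩
  have : f (Pi.single i 1) = s • EuclideanSpace.single i 1 + e := by
    simp only [f, LinearMap.coe_mk, AddHom.coe_mk]
    congr 1
    rw [Finset.sum_pi_single']
    simp
  change f (Pi.single i 1) ∈ _
  rw [this, Metric.mem_ball, dist_eq_norm, add_sub_cancel_right, norm_smul]
  simpa using hsc

/-- A function vanishing outside of a small ball is controlled at a point by the integral of its
gradient over the part inside `U` of any line through the point in a direction of the cone. -/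
lemma ConeAt.enorm_le_lintegral_line {n : ℕ} {U : Set (EuclideanSpace ℝ (Fin n))}
    {x₀ e : EuclideanSpace ℝ (Fin n)} {c r : ℝ} (h : ConeAt U x₀ e c r) (hc : c ≤ 1 / 2)
    {g : EuclideanSpace ℝ (Fin n) → ℝ} (hg : ContDiff ℝ 1 g)
    (hg0 : ∀ x, x ∉ Metric.ball x₀ (r / 8) → g x = 0)
    {x : EuclideanSpace ℝ (Fin n)} (hx : x ∈ closure U) {v : EuclideanSpace ℝ (Fin n)}
    (hv : v ∈ Metric.ball e c) :
    ‖g x‖ₑ ≤ 2 * ∫⁻ t : ℝ, U.indicator (fun y => ‖fderiv ℝ g y‖ₑ) (x + t • v) := by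
  obtain ⟨he, hc0, -, hr, hcone⟩ := id h
  by_cases hxb : x ∈ Metric.ball x₀ (r / 8)
  swap
  · rw [hg0 x hxb]; simp
  have hv2 := h.norm_le_two hv
  have hv1 : 1 / 2 ≤ ‖v‖ := by
    rw [Metric.mem_ball, dist_eq_norm] at hv
    have := norm_sub_le v (v - e)
    rw [sub_sub_cancel, he] at this
    linarith
  have hder : ∀ t : ℝ, HasDerivAt (fun t : ℝ => g (x + t • v)) (fderiv ℝ g (x + t • v) v) t := by
    intro t
    have h1 : HasDerivAt (fun t : ℝ => x + t • v) v t := by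
      simpa using ((hasDerivAt_id t).smul_const v).const_add x
    exact ((hg.differentiable one_ne_zero) (x + t • v)).hasFDerivAt.comp_hasDerivAt t h1
  have hcont : Continuous fun t : ℝ => fderiv ℝ g (x + t • v) v :=
    ((hg.continuous_fderiv one_ne_zero).comp (by fun_prop)).clm_apply continuous_const
  have hfar : g (x + (r / 2) • v) = 0 := by
    apply hg0
    rw [Metric.mem_ball, dist_eq_norm] at hxb ⊢
    have h1 : ‖(r / 2) • v‖ ≤ ‖x + (r / 2) • v - x₀‖ + ‖x - x₀‖ := by
      calc ‖(r / 2) • v‖ = ‖(x + (r / 2) • v - x₀) - (x - x₀)‖ := by congr 1; abel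
        _ ≤ _ := norm_sub_le _ _
    rw [norm_smul, Real.norm_of_nonneg (by positivity)] at h1
    have : r / 2 * (1 / 2) ≤ r / 2 * ‖v‖ := by gcongr
    linarith
  have hint := intervalIntegral.integral_eq_sub_of_hasDerivAt (a := 0) (b := r / 2)
    (fun t _ => hder t) (hcont.intervalIntegrable _ _)
  rw [hfar, zero_smul, add_zero, zero_sub] at hint
  have hb : ‖g x‖ₑ ≤ ∫⁻ t in Ioc 0 (r / 2), ‖fderiv ℝ g (x + t • v) v‖ₑ := by
    rw [← enorm_neg, ← hint, intervalIntegral.integral_of_le (by positivity)]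
    exact enorm_integral_le_lintegral_enorm _
  refine hb.trans ?_
  rw [← lintegral_const_mul' _ _ (by norm_num), ← lintegral_indicator measurableSet_Ioc]
  refine lintegral_mono fun t => ?_
  by_cases ht : t ∈ Ioc 0 (r / 2)
  swap
  · rw [indicator_of_notMem ht]; exact zero_le
  have hU : x + t • v ∈ U := hcone x ⟨hx, Metric.ball_subset_ball (by linarith) hxb⟩ v hv t
    ⟨ht.1, by linarith [ht.2]⟩
  rw [indicator_of_mem ht, indicator_of_mem hU]
  calc ‖fderiv ℝ g (x + t • v) v‖ₑ ≤ ‖fderiv ℝ g (x + t • v)‖ₑ * ‖v‖ₑ :=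
        ContinuousLinearMap.le_opENorm _ _
    _ ≤ ‖fderiv ℝ g (x + t • v)‖ₑ * 2 := by
        gcongr
        rw [← ofReal_norm]
        exact (ENNReal.ofReal_le_ofReal hv2).trans (by simp)
    _ = _ := mul_comm _ _

/-! ### Sobolev and trace inequalities in a cone -/

lemma exists_lintegral_linear_change {n : ℕ}
    (L : (Fin n → ℝ) ≃L[ℝ] EuclideanSpace ℝ (Fin n)) :
    ∃ k k' : ℝ≥0, ∀ f : EuclideanSpace ℝ (Fin n) → ℝ≥0∞,
      ∫⁻ x, f x = k * ∫⁻ z, f (L z) ∧ ∫⁻ z, f (L z) = k' * ∫⁻ x, f x := by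
  have hmap : ∀ f : EuclideanSpace ℝ (Fin n) → ℝ≥0∞,
      ∫⁻ x, f x ∂(Measure.map L volume) = ∫⁻ z, f (L z) := fun f =>
    lintegral_map_equiv f L.toHomeomorph.toMeasurableEquiv
  have hHaar := L.isAddHaarMeasure_map (volume : Measure (Fin n → ℝ))
  refine ⟨Measure.addHaarScalarFactor volume (Measure.map L volume),
    Measure.addHaarScalarFactor (Measure.map L volume) volume, fun f => ⟨?_, ?_⟩⟩
  · rw [← hmap]
    conv_lhs => rw [Measure.isAddLeftInvariant_eq_smul (volume : Measure (EuclideanSpace ℝ (Fin n)))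
      (Measure.map L volume)]
    rw [lintegral_smul_measure]; rfl
  · rw [← hmap]
    conv_lhs => rw [Measure.isAddLeftInvariant_eq_smul (Measure.map L volume) (volume : Measure (EuclideanSpace ℝ (Fin n)))]
    rw [lintegral_smul_measure]; rfl

lemma coords_update {n : ℕ} (L : (Fin n → ℝ) ≃L[ℝ] EuclideanSpace ℝ (Fin n)) (z : Fin n → ℝ)
    (i : Fin n) (t : ℝ) :
    L (Function.update z i t) = L z + (t - z i) • L (Pi.single i 1) := by
  rw [← map_smul, ← map_add]
  congr 1
  funext j
  by_cases h : j = i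
  · subst h; simp
  · simp [h]

/-- Local Gagliardo–Nirenberg–Sobolev inequality up to the boundary, for functions that need not
vanish on the boundary: the axes of the coordinates are chosen in the cone. -/
lemma ConeAt.exists_sobolev {n : ℕ} (hn : 2 ≤ n) {U : Set (EuclideanSpace ℝ (Fin n))}
    (hU : IsOpen U) {x₀ e : EuclideanSpace ℝ (Fin n)} {c r : ℝ} (h : ConeAt U x₀ e c r)
    (hc : c ≤ 1 / 2) :
    ∃ C : ℝ≥0, ∀ g : EuclideanSpace ℝ (Fin n) → ℝ, ContDiff ℝ 1 g →
      (∀ x, x ∉ Metric.ball x₀ (r / 8) → g x = 0) →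
      ∫⁻ x in U, ‖g x‖ₑ ^ ((n : ℝ) / (n - 1)) ≤
        C * (∫⁻ x in U, ‖fderiv ℝ g x‖ₑ) ^ ((n : ℝ) / (n - 1)) := by
  obtain ⟨L, hL⟩ := exists_coords_near e h.2.1
  obtain ⟨k, k', hk⟩ := exists_lintegral_linear_change L
  have hn1 : (0 : ℝ) < n - 1 := by
    have : (2 : ℝ) ≤ n := by exact_mod_cast hn
    linarith
  have hp0 : (0 : ℝ) ≤ (n : ℝ) / (n - 1) := by positivity
  have hconj : Real.HolderConjugate (Fintype.card (Fin n) : ℝ) ((n : ℝ) / (n - 1)) := by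
    rw [Fintype.card_fin]
    exact Real.HolderConjugate.conjExponent (by linarith)
  refine ⟨k * (2 * k') ^ ((n : ℝ) / (n - 1)), fun g hg hg0 => ?_⟩
  set F : EuclideanSpace ℝ (Fin n) → ℝ≥0∞ := U.indicator fun y => ‖fderiv ℝ g y‖ₑ with hF
  have hFm : Measurable F :=
    ((hg.continuous_fderiv one_ne_zero).measurable.enorm).indicator hU.measurableSet
  have hFint : ∫⁻ x, F x = ∫⁻ x in U, ‖fderiv ℝ g x‖ₑ := lintegral_indicator hU.measurableSet _
  set f : (Fin n → ℝ) → ℝ≥0∞ := fun z => 2 * F (L z) with hf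
  have hfm : Measurable f := (hFm.comp L.continuous.measurable).const_mul 2
  rw [← lintegral_indicator hU.measurableSet, (hk _).1]
  -- each value is bounded by the integral along every coordinate line through the point
  have hline : ∀ z, L z ∈ U → ∀ i, ‖g (L z)‖ₑ ≤ ∫⁻ t, f (Function.update z i t) := by
    intro z hz i
    refine (h.enorm_le_lintegral_line hc hg hg0 (subset_closure hz) (hL i)).trans_eq ?_
    simp only [hf, coords_update]
    rw [lintegral_const_mul']
    · congr 1
      exact (lintegral_sub_right_eq_self (fun t : ℝ => F (L z + t • L (Pi.single i 1))) (z i)).symm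
    · norm_num
  have hpt : ∀ z, U.indicator (fun x => ‖g x‖ₑ ^ ((n : ℝ) / (n - 1))) (L z) ≤
      ∏ i : Fin n, (∫⁻ t, f (Function.update z i t)) ^
        ((1 : ℝ) / ((Fintype.card (Fin n) : ℝ) - 1)) := by
    intro z
    by_cases hz : L z ∈ U
    swap
    · rw [indicator_of_notMem hz]; exact zero_le
    rw [indicator_of_mem hz]
    calc ‖g (L z)‖ₑ ^ ((n : ℝ) / (n - 1))
        = ∏ i : Fin n, ‖g (L z)‖ₑ ^ ((1 : ℝ) / ((Fintype.card (Fin n) : ℝ) - 1)) := by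
          rw [Finset.prod_const, Finset.card_univ, Fintype.card_fin, ← ENNReal.rpow_natCast,
            ← ENNReal.rpow_mul]
          congr 1; ring
      _ ≤ _ := by
          refine Finset.prod_le_prod' fun i _ => ?_
          refine ENNReal.rpow_le_rpow (hline z hz i) ?_
          rw [Fintype.card_fin]; positivity
  -- the grid-lines lemma behind the Gagliardo–Nirenberg–Sobolev inequality
  have hgrid := lintegral_prod_lintegral_pow_le (fun _ : Fin n => (volume : Measure ℝ)) hconj hfm
  have hfint : ∫⁻ z, f z = 2 * k' * ∫⁻ x in U, ‖fderiv ℝ g x‖ₑ := by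
    simp only [hf]
    rw [lintegral_const_mul' _ _ (by norm_num), (hk F).2, hFint, mul_assoc]
  calc (k : ℝ≥0∞) * ∫⁻ z, U.indicator (fun x => ‖g x‖ₑ ^ ((n : ℝ) / (n - 1))) (L z)
      ≤ k * (∫⁻ z, f z) ^ ((n : ℝ) / (n - 1)) := by
        gcongr
        exact (lintegral_mono hpt).trans hgrid
    _ = _ := by
        rw [hfint, ENNReal.mul_rpow_of_nonneg _ _ hp0, ENNReal.coe_mul,
          ENNReal.coe_rpow_of_nonneg _ hp0, mul_assoc]
        push_cast
        rfl

/-- Near a point with the cone condition, the coordinates transversal to a cone direction are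
bi-Lipschitz on the boundary. -/
lemma ConeAt.exists_dist_le {m : ℕ} {U : Set (EuclideanSpace ℝ (Fin (m + 1)))}
    (hU : IsOpen U) {x₀ e : EuclideanSpace ℝ (Fin (m + 1))} {c r : ℝ} (h : ConeAt U x₀ e c r)
    (L : (Fin (m + 1) → ℝ) ≃L[ℝ] EuclideanSpace ℝ (Fin (m + 1)))
    (hL : L (Pi.single 0 1) ∈ Metric.ball e c) :
    ∃ K : ℝ≥0, ∃ ρ : ℝ, 0 < ρ ∧ ρ ≤ r ∧ ∀ x ∈ frontier U ∩ Metric.ball x₀ ρ,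
      ∀ y ∈ frontier U ∩ Metric.ball x₀ ρ,
        dist x y ≤ K * dist (fun j : Fin m => L.symm x j.succ) (fun j => L.symm y j.succ) := by
  obtain ⟨he, hc0, -, hr, hcone⟩ := id h
  set v := L (Pi.single 0 1) with hv
  rw [Metric.mem_ball, dist_eq_norm] at hL
  set c' := c - ‖v - e‖ with hc'
  have hc'0 : 0 < c' := by rw [hc']; linarith
  obtain ⟨A, hA0, hA⟩ := (L : (Fin (m + 1) → ℝ) →L[ℝ] EuclideanSpace ℝ (Fin (m + 1))).bound
  obtain ⟨B, hB0, hB⟩ :=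
    (L.symm : EuclideanSpace ℝ (Fin (m + 1)) →L[ℝ] (Fin (m + 1) → ℝ)).bound
  set ρ := min r (r / (4 * B)) with hρ
  have hρ0 : 0 < ρ := by positivity
  have hρB : B * (2 * ρ) < r := by
    have : ρ ≤ r / (4 * B) := min_le_right _ _
    calc B * (2 * ρ) ≤ B * (2 * (r / (4 * B))) := by gcongr
      _ = r / 2 := by field_simp; ring
      _ < r := by linarith
  set K : ℝ := A * (2 + A / c') with hK
  have hK0 : 0 ≤ K := by positivity
  refine ⟨⟨K, hK0⟩, ρ, hρ0, min_le_left _ _, ?_⟩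
  -- it suffices to treat the case in which `y` lies further up than `x`
  suffices H : ∀ x ∈ frontier U ∩ Metric.ball x₀ ρ, ∀ y ∈ frontier U ∩ Metric.ball x₀ ρ,
      L.symm x 0 ≤ L.symm y 0 → dist x y ≤
        K * dist (fun j : Fin m => L.symm x j.succ) (fun j => L.symm y j.succ) by
    intro x hx y hy
    rcases le_total (L.symm x 0) (L.symm y 0) with hxy | hxy
    · exact H x hx y hy hxy
    · rw [dist_comm x, dist_comm (fun j : Fin m => L.symm x j.succ)]
      exact H y hy x hx hxy
  intro x hx y hy hxy
  set z := L.symm y - L.symm x with hz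
  have hLz : L z = y - x := by rw [hz, map_sub]; simp
  set D := dist (fun j : Fin m => L.symm x j.succ) (fun j => L.symm y j.succ) with hD
  have hD0 : 0 ≤ D := dist_nonneg
  have hzj : ∀ j : Fin m, |z j.succ| ≤ D := fun j => by
    have := dist_le_pi_dist (fun j : Fin m => L.symm x j.succ) (fun j => L.symm y j.succ) j
    rw [Real.dist_eq, abs_sub_comm] at this
    exact this
  set z' : Fin (m + 1) → ℝ := Function.update z 0 0 with hz'
  have hz'n : ‖z'‖ ≤ D := by
    rw [pi_norm_le_iff_of_nonneg hD0]
    intro j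
    refine Fin.cases ?_ (fun j => ?_) j
    · simpa [hz'] using hD0
    · rw [hz', Function.update_of_ne (Fin.succ_ne_zero j)]; exact hzj j
  have hsplit : y - x = z 0 • v + L z' := by
    rw [hz', coords_update, hLz, ← hv]; module
  have hz0 : 0 ≤ z 0 := sub_nonneg.2 hxy
  have hAz' : ‖L z'‖ ≤ A * D := (hA z').trans (mul_le_mul_of_nonneg_left hz'n hA0.le)
  -- otherwise `y - x` points into the cone, which would put `y` into the open set `U`
  have hkey : z 0 * c' ≤ A * D := by
    by_contra hcon
    push Not at hcon
    have hz0' : 0 < z 0 := by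
      rcases hz0.eq_or_lt with h0 | h0
      · rw [← h0, zero_mul] at hcon
        have : 0 ≤ A * D := by positivity
        linarith
      · exact h0
    have hz0r : z 0 < r := by
      have h1 : ‖z‖ ≤ B * ‖y - x‖ := by
        have := hB (y - x)
        simpa [hz, map_sub] using this
      have h2 : ‖y - x‖ ≤ 2 * ρ := by
        have h3 := hx.2
        have h4 := hy.2
        rw [Metric.mem_ball] at h3 h4
        rw [← dist_eq_norm]
        linarith [dist_triangle_right y x x₀]
      have h5 : |z 0| ≤ ‖z‖ := norm_le_pi_norm z 0
      have h6 : B * ‖y - x‖ ≤ B * (2 * ρ) := by gcongr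
      linarith [le_abs_self (z 0)]
    have hball : v + (z 0)⁻¹ • L z' ∈ Metric.ball e c := by
      rw [Metric.mem_ball, dist_eq_norm]
      have h1 : ‖(z 0)⁻¹ • L z'‖ < c' := by
        rw [norm_smul, norm_inv, Real.norm_of_nonneg hz0, inv_mul_lt_iff₀ hz0']
        linarith
      calc ‖v + (z 0)⁻¹ • L z' - e‖ = ‖(v - e) + (z 0)⁻¹ • L z'‖ := by congr 1; abel
        _ ≤ _ := norm_add_le _ _
        _ < c := by rw [hc'] at h1; linarith
    have hyU : y ∈ U := by
      have := hcone x ⟨frontier_subset_closure hx.1,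
        Metric.ball_subset_ball (min_le_left _ _) hx.2⟩ _ hball (z 0) ⟨hz0', hz0r⟩
      rwa [smul_add, smul_smul, mul_inv_cancel₀ hz0'.ne', one_smul, ← hsplit,
        add_sub_cancel] at this
    have := hy.1.2
    rw [hU.interior_eq] at this
    exact this hyU
  have hzn : ‖z‖ ≤ (2 + A / c') * D := by
    have hz00 : z 0 ≤ A / c' * D := by
      rw [div_mul_eq_mul_div, le_div_iff₀ hc'0]; exact hkey
    rw [pi_norm_le_iff_of_nonneg (by positivity)]
    intro j
    refine Fin.cases ?_ (fun j => ?_) j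
    · rw [Real.norm_of_nonneg hz0]; nlinarith
    · refine (hzj j).trans ?_
      have : 0 ≤ A / c' := by positivity
      nlinarith
  calc dist x y = ‖L z‖ := by rw [hLz, dist_comm, dist_eq_norm]
    _ ≤ A * ‖z‖ := hA z
    _ ≤ A * ((2 + A / c') * D) := by gcongr
    _ = K * D := by rw [hK]; ring

/-- Local trace inequality: integrate the bound along the lines in a cone direction over the
boundary, which projects injectively along this direction. -/
lemma ConeAt.exists_trace {n : ℕ} (hn : 1 ≤ n) {U : Set (EuclideanSpace ℝ (Fin n))}
    (hU : IsOpen U) {x₀ e : EuclideanSpace ℝ (Fin n)} {c r : ℝ} (h : ConeAt U x₀ e c r)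
    (hc : c ≤ 1 / 2) :
    ∃ C : ℝ≥0, ∃ ρ : ℝ, 0 < ρ ∧ ρ ≤ r / 8 ∧ ∀ g : EuclideanSpace ℝ (Fin n) → ℝ, ContDiff ℝ 1 g →
      (∀ x, x ∉ Metric.ball x₀ ρ → g x = 0) →
      ∫⁻ x, ‖g x‖ₑ ∂(surf U) ≤ C * ∫⁻ x in U, ‖fderiv ℝ g x‖ₑ := by
  obtain ⟨m, rfl⟩ : ∃ m, n = m + 1 := ⟨n - 1, by omega⟩
  obtain ⟨L, hL⟩ := exists_coords_near e h.2.1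
  obtain ⟨k, k', hk⟩ := exists_lintegral_linear_change L
  obtain ⟨K, ρ, hρ0, hρr, hK⟩ := h.exists_dist_le hU L (hL 0)
  set ρ' := min ρ (r / 8) with hρ'
  have hr := h.2.2.2.1
  set q : EuclideanSpace ℝ (Fin (m + 1)) → (Fin m → ℝ) := fun x j => L.symm x j.succ with hq
  have hqc : Continuous q := by
    refine continuous_pi fun j => ?_
    exact (continuous_apply _).comp L.symm.continuous
  set S := frontier U ∩ Metric.ball x₀ ρ' with hS
  have hSm : MeasurableSet S := isClosed_frontier.measurableSet.inter Metric.isOpen_ball.measurableSet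
  -- the projection of surface measure along the cone direction is dominated by Lebesgue measure
  obtain ⟨M, hM⟩ : ∃ M : ℝ≥0, ∀ A : Set (Fin m → ℝ), MeasurableSet A →
      (Measure.map q ((surf U).restrict S)) A ≤ M * volume A := by
    refine ⟨(Measure.addHaarScalarFactor (volume : Measure (EuclideanSpace ℝ (Fin m)))
      (Measure.hausdorffMeasure m)) * K ^ m, fun A hA => ?_⟩
    rw [Measure.map_apply hqc.measurable hA, Measure.restrict_apply (hqc.measurable hA)]
    refine (Measure.restrict_apply_le _ _).trans ?_
    rw [Measure.euclideanHausdorffMeasure_def, Nat.add_sub_cancel, Measure.smul_apply,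
      ENNReal.smul_def, smul_eq_mul, ENNReal.coe_mul, mul_assoc]
    gcongr
    -- the boundary is a Lipschitz image of its projection
    have hinj : InjOn q S := fun x hx y hy hxy => by
      have h1 := hK x ⟨hx.1, Metric.ball_subset_ball (min_le_left _ _) hx.2⟩ y
        ⟨hy.1, Metric.ball_subset_ball (min_le_left _ _) hy.2⟩
      change dist x y ≤ K * dist (q x) (q y) at h1
      rw [hxy, dist_self, mul_zero] at h1
      exact dist_le_zero.1 h1
    set ψ := Function.invFunOn q S with hψ
    have hψl : ∀ x ∈ S, ψ (q x) = x := fun x hx => hinj.leftInvOn_invFunOn hx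
    have hLip : LipschitzOnWith K ψ (q '' (q ⁻¹' A ∩ S)) := by
      refine LipschitzOnWith.of_dist_le_mul ?_
      rintro _ ⟨x, hx, rfl⟩ _ ⟨y, hy, rfl⟩
      rw [hψl x hx.2, hψl y hy.2]
      exact hK x ⟨hx.2.1, Metric.ball_subset_ball (min_le_left _ _) hx.2.2⟩ y
        ⟨hy.2.1, Metric.ball_subset_ball (min_le_left _ _) hy.2.2⟩
    have himg : ψ '' (q '' (q ⁻¹' A ∩ S)) = q ⁻¹' A ∩ S := by
      rw [image_image]
      refine (image_congr fun x hx => hψl x hx.2).trans (by simp)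
    have := hLip.hausdorffMeasure_image_le (d := m) (by positivity)
    rw [himg, ENNReal.rpow_natCast] at this
    refine this.trans ?_
    rw [ENNReal.coe_pow]
    gcongr
    have hpi := hausdorffMeasure_pi_real (ι := Fin m)
    rw [Fintype.card_fin] at hpi
    rw [hpi]
    have hsub : q '' (q ⁻¹' A ∩ S) ⊆ A := by
      rintro _ ⟨x, hx, rfl⟩
      exact hx.1
    exact hsub
  have hM' : Measure.map q ((surf U).restrict S) ≤ (M : ℝ≥0∞) • (volume : Measure (Fin m → ℝ)) :=
    Measure.le_iff.2 fun A hA => by simpa using hM A hA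
  refine ⟨2 * M * k', ρ', by positivity, min_le_right _ _, fun g hg hg0 => ?_⟩
  have hg0' : ∀ x, x ∉ Metric.ball x₀ (r / 8) → g x = 0 := fun x hx =>
    hg0 x fun hx' => hx (Metric.ball_subset_ball (min_le_right _ _) hx')
  set F : EuclideanSpace ℝ (Fin (m + 1)) → ℝ≥0∞ := U.indicator fun y => ‖fderiv ℝ g y‖ₑ with hF
  have hFm : Measurable F :=
    ((hg.continuous_fderiv one_ne_zero).measurable.enorm).indicator hU.measurableSet
  have hFint : ∫⁻ x, F x = ∫⁻ x in U, ‖fderiv ℝ g x‖ₑ := lintegral_indicator hU.measurableSet _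
  set e' := MeasurableEquiv.piFinSuccAbove (fun _ : Fin (m + 1) => ℝ) 0 with he'
  have hmp := volume_preserving_piFinSuccAbove (fun _ : Fin (m + 1) => ℝ) 0
  set H : (Fin m → ℝ) → ℝ≥0∞ := fun y => ∫⁻ t : ℝ, F (L (Fin.cons t y)) with hH
  have hsymm : ∀ p : ℝ × (Fin m → ℝ), e'.symm p = (Fin.cons p.1 p.2 : Fin (m + 1) → ℝ) := fun p => by
    funext j
    refine Fin.cases ?_ (fun j => ?_) j <;> simp [he', MeasurableEquiv.piFinSuccAbove, Fin.insertNthEquiv]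
  have hGm : Measurable fun p : ℝ × (Fin m → ℝ) => F (L (Fin.cons p.1 p.2 : Fin (m + 1) → ℝ)) := by
    have : (fun p : ℝ × (Fin m → ℝ) => F (L (Fin.cons p.1 p.2 : Fin (m + 1) → ℝ))) =
        fun p => F (L (e'.symm p)) := by funext p; rw [hsymm]
    rw [this]
    exact hFm.comp (L.continuous.measurable.comp e'.symm.measurable)
  have hHm : Measurable H := hGm.lintegral_prod_left'
  have hHint : ∫⁻ y, H y = k' * ∫⁻ x in U, ‖fderiv ℝ g x‖ₑ := by
    rw [← hFint, ← (hk F).2, ← (hmp.symm e').lintegral_comp_emb e'.symm.measurableEmbedding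
      (fun z => F (L z))]
    simp only [hsymm]
    exact (lintegral_prod_symm' _ hGm).symm
  -- `H` integrates the gradient over the line through a boundary point in the cone direction
  have hpt : ∀ x ∈ S, ‖g x‖ₑ ≤ 2 * H (q x) := by
    intro x hx
    refine (h.enorm_le_lintegral_line hc hg hg0' (frontier_subset_closure hx.1) (hL 0)).trans_eq ?_
    congr 1
    rw [hH]
    have : ∀ t, L (Fin.cons t (q x)) = x + (t - L.symm x 0) • L (Pi.single 0 1) := by
      intro t
      have h1 : (Fin.cons t (q x) : Fin (m + 1) → ℝ) = Function.update (L.symm x) 0 t := by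
        funext j
        refine Fin.cases ?_ (fun j => ?_) j
        · simp
        · simp [hq]
      rw [h1, coords_update]; simp
    simp only [this]
    exact (lintegral_sub_right_eq_self (fun t : ℝ => F (x + t • L (Pi.single 0 1))) _).symm
  have hsupp : ∫⁻ x, ‖g x‖ₑ ∂(surf U) = ∫⁻ x in S, ‖g x‖ₑ ∂(surf U) := by
    rw [← lintegral_indicator hSm]
    refine lintegral_congr_ae ?_
    have : ∀ᵐ x ∂(surf U), x ∈ frontier U := ae_restrict_mem isClosed_frontier.measurableSet
    filter_upwards [this] with x hx
    by_cases hxb : x ∈ Metric.ball x₀ ρ'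
    · rw [indicator_of_mem (show x ∈ S from ⟨hx, hxb⟩)]
    · rw [indicator_of_notMem fun hxS : x ∈ S => hxb hxS.2, hg0 x hxb, enorm_zero]
  calc ∫⁻ x, ‖g x‖ₑ ∂(surf U) = ∫⁻ x in S, ‖g x‖ₑ ∂(surf U) := hsupp
    _ ≤ ∫⁻ x in S, 2 * H (q x) ∂(surf U) := setLIntegral_mono' hSm hpt
    _ = ∫⁻ y, 2 * H y ∂(Measure.map q ((surf U).restrict S)) :=
        (lintegral_map (hHm.const_mul 2) hqc.measurable).symm
    _ ≤ ∫⁻ y, 2 * H y ∂((M : ℝ≥0∞) • (volume : Measure (Fin m → ℝ))) :=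
        lintegral_mono' hM' le_rfl
    _ = _ := by
        rw [lintegral_smul_measure, lintegral_const_mul' _ _ (by norm_num), hHint]
        push_cast
        simp only [smul_eq_mul]
        ring

/-! ### Mollification along a cone direction -/

/-- The mollification `φ ⋆ f` of a function on `U`, extended by zero outside of `U`. -/
noncomputable def moll {n : ℕ} (U : Set (EuclideanSpace ℝ (Fin n)))
    (φ f : EuclideanSpace ℝ (Fin n) → ℝ) : EuclideanSpace ℝ (Fin n) → ℝ :=
  convolution φ (U.indicator f) (ContinuousLinearMap.lsmul ℝ ℝ) volume

section moll

variable {n : ℕ} {U : Set (EuclideanSpace ℝ (Fin n))} {φ f : EuclideanSpace ℝ (Fin n) → ℝ}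
  {F : EuclideanSpace ℝ (Fin n) → EuclideanSpace ℝ (Fin n)}

lemma moll_apply (hU : IsOpen U) (x : EuclideanSpace ℝ (Fin n)) :
    moll U φ f x = ∫ y in U, φ (x - y) * f y := by
  rw [moll, convolution_eq_swap, ← integral_indicator hU.measurableSet]
  congr 1
  funext y
  by_cases hy : y ∈ U <;> simp [hy]

lemma locallyIntegrable_indicator (hU : IsOpen U) (hf : IntegrableOn f U) :
    LocallyIntegrable (U.indicator f) :=
  ((integrable_indicator_iff hU.measurableSet).2 hf).locallyIntegrable

lemma contDiff_moll (hU : IsOpen U) (hf : IntegrableOn f U) (hφ : ContDiff ℝ ∞ φ)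
    (hφc : HasCompactSupport φ) : ContDiff ℝ ∞ (moll U φ f) :=
  hφc.contDiff_convolution_left _ hφ (locallyIntegrable_indicator hU hf)

/-- The derivative of a mollification falls on the weak gradient wherever the kernel, translated
to the given point, is supported in `U`. -/
lemma fderiv_moll (hU : IsOpen U) (hf : IntegrableOn f U) (hw : IsWeakGrad U f F)
    (hF : IntegrableOn F U) (hφ : ContDiff ℝ ∞ φ) (hφc : HasCompactSupport φ)
    {x : EuclideanSpace ℝ (Fin n)} (hx : ∀ y, x - y ∈ tsupport φ → y ∈ U) :
    fderiv ℝ (moll U φ f) x = innerSL ℝ (∫ y in U, φ (x - y) • F y) := by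
  have hφ1 : ContDiff ℝ 1 φ := hφ.of_le (by simp)
  have hli := locallyIntegrable_indicator hU hf
  rw [moll, (hφc.hasFDerivAt_convolution_left (ContinuousLinearMap.lsmul ℝ ℝ) hφ1 hli x).fderiv]
  ext v
  have hex := (hφc.fderiv ℝ).convolutionExists_left
    (ContinuousLinearMap.precompL (EuclideanSpace ℝ (Fin n)) (ContinuousLinearMap.lsmul ℝ ℝ))
    (hφ1.continuous_fderiv one_ne_zero) hli x
  rw [convolution, ContinuousLinearMap.integral_apply hex, innerSL_apply_apply]
  simp only [ContinuousLinearMap.precompL_apply, ContinuousLinearMap.lsmul_apply, smul_eq_mul]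
  have h1 : ∫ t, fderiv ℝ φ t v * U.indicator f (x - t) =
      ∫ y in U, fderiv ℝ φ (x - y) v * f y := by
    rw [← integral_sub_left_eq_self (fun t => fderiv ℝ φ t v * U.indicator f (x - t)) volume x,
      ← integral_indicator hU.measurableSet]
    congr 1
    funext y
    rw [sub_sub_cancel]
    by_cases hy : y ∈ U <;> simp [hy]
  rw [h1]
  set ψ : EuclideanSpace ℝ (Fin n) → ℝ := fun y => φ (x - y) with hψ
  have hψ' : ψ = φ ∘ (Homeomorph.subLeft x) := rfl
  have hψd : ContDiff ℝ ∞ ψ := hφ.comp (contDiff_const.sub contDiff_id)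
  have hψc : HasCompactSupport ψ := by
    rw [hψ']; exact hφc.comp_homeomorph _
  have hψs : tsupport ψ ⊆ U := by
    rw [hψ', tsupport_comp_eq_preimage]
    exact fun y hy => hx y hy
  have hψv : ∀ y, fderiv ℝ ψ y v = - fderiv ℝ φ (x - y) v := by
    intro y
    have h2 : HasFDerivAt (fun y => x - y) (-ContinuousLinearMap.id ℝ (EuclideanSpace ℝ (Fin n))) y := by
      simpa using (hasFDerivAt_id y).const_sub x
    have h3 := ((hφ1.differentiable one_ne_zero) (x - y)).hasFDerivAt.comp y h2
    have h4 : fderiv ℝ ψ y = _ := h3.fderiv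
    rw [h4]; simp
  have hmain := hw ψ hψd hψc hψs v
  have hint : IntegrableOn (fun y => ψ y • F y) U := by
    obtain ⟨M, hM⟩ := hψd.continuous.bounded_above_of_compact_support hψc
    exact Integrable.bdd_smul hF M hψd.continuous.aestronglyMeasurable (ae_of_all _ hM)
  rw [real_inner_comm, ← integral_inner hint v]
  calc ∫ y in U, fderiv ℝ φ (x - y) v * f y = - ∫ y in U, f y * fderiv ℝ ψ y v := by
        rw [← integral_neg]
        congr 1
        funext y
        rw [hψv]; ring
    _ = _ := by
        rw [hmain, neg_neg]
        congr 1
        funext y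
        rw [inner_smul_right, real_inner_comm]; ring

lemma enorm_fderiv_moll_le (hU : IsOpen U) (hf : IntegrableOn f U) (hw : IsWeakGrad U f F)
    (hF : IntegrableOn F U) (hφ : ContDiff ℝ ∞ φ) (hφc : HasCompactSupport φ)
    {x : EuclideanSpace ℝ (Fin n)} (hx : ∀ y, x - y ∈ tsupport φ → y ∈ U) :
    ‖fderiv ℝ (moll U φ f) x‖ₑ ≤ ∫⁻ y in U, ‖φ (x - y)‖ₑ * ‖F y‖ₑ := by
  rw [fderiv_moll hU hf hw hF hφ hφc hx, ← ofReal_norm, innerSL_apply_norm, ofReal_norm]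
  refine (enorm_integral_le_lintegral_enorm _).trans_eq ?_
  simp only [enorm_smul]

end moll

/-- Product rule for a weak gradient and a smooth function. -/
lemma IsWeakGrad.smooth_mul {n : ℕ} {U : Set (EuclideanSpace ℝ (Fin n))}
    {f χ : EuclideanSpace ℝ (Fin n) → ℝ}
    {F : EuclideanSpace ℝ (Fin n) → EuclideanSpace ℝ (Fin n)} (h : IsWeakGrad U f F)
    (hf : IntegrableOn f U) (hF : IntegrableOn F U) (hχ : ContDiff ℝ ∞ χ) :
    IsWeakGrad U (fun x => χ x * f x) (fun x => χ x • F x + f x • gradient χ x) := by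
  intro ψ hψ hψc hψU e
  have hχd := hχ.differentiable (by simp)
  have hψd := hψ.differentiable (by simp)
  have hder : ∀ x, fderiv ℝ (fun y => χ y * ψ y) x e =
      χ x * fderiv ℝ ψ x e + ψ x * fderiv ℝ χ x e := by
    intro x
    rw [fderiv_fun_mul (hχd x) (hψd x)]
    simp
  have hgrad : ∀ x, ⟪gradient χ x, e⟫_ℝ = fderiv ℝ χ x e := fun x => by
    rw [gradient, InnerProductSpace.toDual_symm_apply]
  have hmain := h (fun y => χ y * ψ y) (hχ.mul hψ) (hψc.mul_left)
    ((tsupport_mul_subset_right).trans hψU) e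
  have hψ' : Continuous fun x => fderiv ℝ ψ x e :=
    (hψ.continuous_fderiv (by simp)).clm_apply continuous_const
  have hχ' : Continuous fun x => fderiv ℝ χ x e :=
    (hχ.continuous_fderiv (by simp)).clm_apply continuous_const
  have hbint : ∀ g : EuclideanSpace ℝ (Fin n) → ℝ, Continuous g → HasCompactSupport g →
      IntegrableOn (fun x => f x * g x) U := fun g hg hgc => by
    obtain ⟨M, hM⟩ := hg.bounded_above_of_compact_support hgc
    exact Integrable.mul_bdd (c := M) hf hg.aestronglyMeasurable (ae_of_all _ hM)
  have hi1 : IntegrableOn (fun x => f x * (ψ x * fderiv ℝ χ x e)) U :=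
    hbint _ (hψ.continuous.mul hχ') hψc.mul_right
  have hi2 : IntegrableOn (fun x => f x * (χ x * fderiv ℝ ψ x e)) U :=
    hbint _ (hχ.continuous.mul hψ') ((hψc.fderiv_apply ℝ e).mul_left)
  have hi3 : IntegrableOn (fun x => ⟪F x, e⟫_ℝ * (χ x * ψ x)) U := by
    obtain ⟨M, hM⟩ := (hχ.continuous.mul hψ.continuous).bounded_above_of_compact_support
      hψc.mul_left
    exact Integrable.mul_bdd (c := M) (hF.inner_const e)
      (hχ.continuous.mul hψ.continuous).aestronglyMeasurable (ae_of_all _ hM)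
  have hsum : ∫ x in U, f x * fderiv ℝ (fun y => χ y * ψ y) x e =
      (∫ x in U, f x * (χ x * fderiv ℝ ψ x e)) + ∫ x in U, f x * (ψ x * fderiv ℝ χ x e) := by
    rw [← integral_add hi2 hi1]
    congr 1
    funext x
    rw [hder]; ring
  have hsum2 : ∫ x in U, ⟪χ x • F x + f x • gradient χ x, e⟫_ℝ * ψ x =
      (∫ x in U, ⟪F x, e⟫_ℝ * (χ x * ψ x)) + ∫ x in U, f x * (ψ x * fderiv ℝ χ x e) := by
    rw [← integral_add hi3 hi1]
    congr 1
    funext x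
    rw [inner_add_left, real_inner_smul_left, real_inner_smul_left, hgrad]; ring
  have hl : ∫ x in U, χ x * f x * fderiv ℝ ψ x e = ∫ x in U, f x * (χ x * fderiv ℝ ψ x e) := by
    congr 1
    funext x
    ring
  rw [hl, hsum2]
  linarith

/-- Approximation, near a point of the closure, by functions that are smooth up to the boundary
and beyond: mollify with kernels whose support lies on the side to which the cone points. -/
lemma ConeAt.exists_approx {n : ℕ} {U : Set (EuclideanSpace ℝ (Fin n))} (hU : IsOpen U)
    {x₀ e : EuclideanSpace ℝ (Fin n)} {c r : ℝ} (h : ConeAt U x₀ e c r) {ρ : ℝ} (hρ0 : 0 < ρ)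
    (hρr : ρ ≤ r / 8) {f : EuclideanSpace ℝ (Fin n) → ℝ}
    {F : EuclideanSpace ℝ (Fin n) → EuclideanSpace ℝ (Fin n)} (hfc : ContinuousOn f (closure U))
    (hf : IntegrableOn f U) (hw : IsWeakGrad U f F) (hF : IntegrableOn F U)
    (hf0 : ∀ x, x ∉ Metric.ball x₀ (ρ / 2) → f x = 0) :
    ∃ g : ℕ → EuclideanSpace ℝ (Fin n) → ℝ, (∀ k, ContDiff ℝ 1 (g k)) ∧
      (∀ k x, x ∉ Metric.ball x₀ ρ → g k x = 0) ∧
      (∀ x ∈ closure U, Tendsto (fun k => g k x) atTop (𝓝 (f x))) ∧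
      ∀ k, ∫⁻ x in U, ‖fderiv ℝ (g k) x‖ₑ ≤ ∫⁻ x in U, ‖F x‖ₑ := by
  obtain ⟨he, hc0, hc1, hr, hcone⟩ := id h
  set s : ℕ → ℝ := fun k => ρ / 8 / (k + 1) with hs
  have hs0 : ∀ k, 0 < s k := fun k => by positivity
  have hs1 : ∀ k, s k ≤ ρ / 8 := fun k => by
    rw [hs]
    exact div_le_self (by positivity) (by linarith [Nat.cast_nonneg (α := ℝ) k])
  have hslim : Tendsto s atTop (𝓝 0) := by
    have := (tendsto_one_div_add_atTop_nhds_zero_nat (𝕜 := ℝ)).const_mul (ρ / 8)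
    simpa [hs, div_eq_mul_inv] using this
  let b : ∀ k, ContDiffBump (-(s k) • e) := fun k =>
    ⟨s k * c / 4, s k * c / 2, by have := hs0 k; positivity,
      by have := hs0 k; have : 0 < s k * c := by positivity
         linarith⟩
  set φ : ℕ → EuclideanSpace ℝ (Fin n) → ℝ := fun k => (b k).normed volume with hφ
  have hφd : ∀ k, ContDiff ℝ ∞ (φ k) := fun k => (b k).contDiff_normed
  have hφc : ∀ k, HasCompactSupport (φ k) := fun k => (b k).hasCompactSupport_normed
  have hφt : ∀ k, tsupport (φ k) = Metric.closedBall (-(s k) • e) (s k * c / 2) := fun k =>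
    (b k).tsupport_normed_eq
  have hφi : ∀ k x, ∫ y, φ k (x - y) = 1 := fun k x => by
    rw [integral_sub_left_eq_self (φ k) volume x]; exact (b k).integral_normed
  have hφn : ∀ k x, 0 ≤ φ k x := fun k x => (b k).nonneg_normed x
  -- the kernel only sees points in direction of the cone
  have hdir : ∀ k x y, x - y ∈ tsupport (φ k) →
      ∃ v ∈ Metric.ball e c, y = x + s k • v := by
    intro k x y hy
    rw [hφt, Metric.mem_closedBall, dist_eq_norm] at hy
    refine ⟨(s k)⁻¹ • (y - x), ?_, ?_⟩
    · rw [Metric.mem_ball, dist_eq_norm]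
      have h1 : (s k)⁻¹ • (y - x) - e = -((s k)⁻¹ • (x - y - -(s k) • e)) := by
        rw [neg_smul, sub_neg_eq_add, smul_add, smul_smul, inv_mul_cancel₀ (hs0 k).ne', one_smul]
        module
      rw [h1, norm_neg, norm_smul, norm_inv, Real.norm_of_nonneg (hs0 k).le,
        inv_mul_lt_iff₀ (hs0 k)]
      have : 0 < s k * c := mul_pos (hs0 k) hc0
      linarith
    · rw [smul_smul, mul_inv_cancel₀ (hs0 k).ne', one_smul]; abel
  have hnear : ∀ k x y, x - y ∈ tsupport (φ k) → dist y x ≤ 2 * s k := by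
    intro k x y hy
    obtain ⟨v, hv, rfl⟩ := hdir k x y hy
    rw [dist_eq_norm, add_sub_cancel_left, norm_smul, Real.norm_of_nonneg (hs0 k).le, mul_comm]
    exact mul_le_mul_of_nonneg_right (h.norm_le_two hv) (hs0 k).le
  have hin : ∀ k, ∀ x ∈ closure U ∩ Metric.ball x₀ r, ∀ y, x - y ∈ tsupport (φ k) → y ∈ U := by
    intro k x hx y hy
    obtain ⟨v, hv, rfl⟩ := hdir k x y hy
    exact hcone x hx v hv (s k) ⟨hs0 k, by linarith [hs1 k]⟩
  have hφ0 : ∀ k x, x ∉ tsupport (φ k) → φ k x = 0 := fun k x hx => image_eq_zero_of_notMem_tsupport hx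
  have hzero : ∀ k x, x ∉ Metric.ball x₀ (3 * ρ / 4) → moll U (φ k) f x = 0 := by
    intro k x hx
    rw [moll_apply hU]
    refine (integral_congr_ae (ae_of_all _ fun y => ?_)).trans (integral_zero _ _)
    by_cases hy : x - y ∈ tsupport (φ k)
    · have h1 := hnear k x y hy
      have h2 : f y = 0 := by
        apply hf0
        rw [Metric.mem_ball, not_lt] at hx ⊢
        have := dist_triangle_left x x₀ y
        linarith [hs1 k]
      simp [h2]
    · simp [hφ0 k _ hy]
  refine ⟨fun k => moll U (φ k) f, fun k => (contDiff_moll hU hf (hφd k) (hφc k)).of_le (by simp),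
    fun k x hx => hzero k x fun h' => hx (Metric.ball_subset_ball (by linarith) h'), ?_, ?_⟩
  · intro x hx
    by_cases hxr : x ∈ Metric.ball x₀ r
    swap
    · have h1 : f x = 0 := hf0 x fun h' => hxr (Metric.ball_subset_ball (by linarith) h')
      rw [h1]
      refine tendsto_const_nhds.congr fun k => (hzero k x fun h' =>
        hxr (Metric.ball_subset_ball (by linarith) h')).symm
    rw [Metric.tendsto_atTop]
    intro ε hε
    obtain ⟨δ, hδ, hδf⟩ := Metric.continuousWithinAt_iff.1 (hfc x hx) (ε / 2) (by positivity)
    obtain ⟨N, hN⟩ := (Metric.tendsto_atTop.1 hslim) (δ / 2) (by positivity)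
    refine ⟨N, fun k hk => ?_⟩
    have hsk : s k < δ / 2 := by
      have := hN k hk
      rwa [Real.dist_eq, sub_zero, abs_of_pos (hs0 k)] at this
    have hφint : Integrable fun y => φ k (x - y) :=
      ((b k).integrable_normed (μ := volume)).comp_sub_left x
    have hconst : f x = ∫ y in U, φ k (x - y) * f x := by
      have h1 : ∫ y in U, φ k (x - y) * f x = ∫ y, φ k (x - y) * f x := by
        apply setIntegral_eq_integral_of_forall_compl_eq_zero
        intro y hy
        rw [hφ0 k _ fun h' => hy (hin k x ⟨hx, hxr⟩ y h'), zero_mul]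
      rw [h1, integral_mul_const, hφi, one_mul]
    have hfint : IntegrableOn (fun y => φ k (x - y) * f y) U := by
      obtain ⟨M, hM⟩ := (hφd k).continuous.bounded_above_of_compact_support (hφc k)
      exact Integrable.bdd_mul (c := M) hf
        ((hφd k).continuous.comp (continuous_const.sub continuous_id)).aestronglyMeasurable
        (ae_of_all _ fun y => hM _)
    change dist (moll U (φ k) f x) (f x) < ε
    rw [moll_apply hU, Real.dist_eq]
    nth_rewrite 1 [hconst]
    rw [← integral_sub hfint (hφint.mul_const _).integrableOn]
    calc |∫ y in U, φ k (x - y) * f y - φ k (x - y) * f x|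
        ≤ ∫ y in U, φ k (x - y) * (ε / 2) := by
          rw [← Real.norm_eq_abs]
          refine norm_integral_le_of_norm_le (hφint.mul_const (ε / 2)).integrableOn ?_
          filter_upwards [ae_restrict_mem hU.measurableSet] with y hyU
          rw [← mul_sub, norm_mul, Real.norm_of_nonneg (hφn k _)]
          by_cases hy : x - y ∈ tsupport (φ k)
          · refine mul_le_mul_of_nonneg_left ?_ (hφn k _)
            have h1 := hnear k x y hy
            have := hδf (subset_closure hyU) (by linarith)
            rw [Real.dist_eq] at this
            exact this.le
          · simp [hφ0 k _ hy]
      _ ≤ ∫ y, φ k (x - y) * (ε / 2) := by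
          refine setIntegral_le_integral (hφint.mul_const _) (ae_of_all _ fun y => ?_)
          exact mul_nonneg (hφn k _) (by positivity)
      _ = ε / 2 := by rw [integral_mul_const, hφi, one_mul]
      _ < ε := by linarith
  · intro k
    have hpt : ∀ x ∈ U, ‖fderiv ℝ (moll U (φ k) f) x‖ₑ ≤
        ∫⁻ y in U, ‖φ k (x - y)‖ₑ * ‖F y‖ₑ := by
      intro x hx
      by_cases hxr : x ∈ Metric.ball x₀ r
      · exact enorm_fderiv_moll_le hU hf hw hF (hφd k) (hφc k)
          (hin k x ⟨subset_closure hx, hxr⟩)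
      · have h1 : moll U (φ k) f =ᶠ[𝓝 x] fun _ => 0 := by
          have hx' : x ∈ (Metric.closedBall x₀ (3 * ρ / 4))ᶜ := fun h' =>
            hxr (Metric.closedBall_subset_ball (by linarith) h')
          filter_upwards [Metric.isClosed_closedBall.isOpen_compl.mem_nhds hx'] with y hy
          exact hzero k y fun h' => hy (Metric.ball_subset_closedBall h')
        rw [h1.fderiv_eq, fderiv_fun_const, Pi.zero_apply]
        rw [← ofReal_norm, norm_zero, ENNReal.ofReal_zero]
        exact zero_le
    calc ∫⁻ x in U, ‖fderiv ℝ (moll U (φ k) f) x‖ₑ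
        ≤ ∫⁻ x in U, ∫⁻ y in U, ‖φ k (x - y)‖ₑ * ‖F y‖ₑ := setLIntegral_mono' hU.measurableSet hpt
      _ ≤ ∫⁻ x, ∫⁻ y in U, ‖φ k (x - y)‖ₑ * ‖F y‖ₑ := setLIntegral_le_lintegral _ _
      _ = ∫⁻ y in U, ∫⁻ x, ‖φ k (x - y)‖ₑ * ‖F y‖ₑ := by
          apply lintegral_lintegral_swap
          have h1 : Continuous (φ k) := (hφd k).continuous
          have h2 : AEMeasurable (fun z : EuclideanSpace ℝ (Fin n) × EuclideanSpace ℝ (Fin n) =>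
              ‖φ k (z.1 - z.2)‖ₑ) (volume.prod (volume.restrict U)) :=
            (h1.comp (continuous_fst.sub continuous_snd)).measurable.enorm.aemeasurable
          exact h2.mul hF.aestronglyMeasurable.enorm.comp_snd
      _ = ∫⁻ y in U, ‖F y‖ₑ := by
          refine lintegral_congr fun y => ?_
          rw [lintegral_mul_const' _ _ enorm_ne_top]
          have : ∫⁻ x, ‖φ k (x - y)‖ₑ = 1 := by
            rw [lintegral_sub_right_eq_self (fun x => ‖φ k x‖ₑ) y]
            have h1 := (b k).integrable_normed (μ := volume)
            have h2 := ofReal_integral_norm_eq_lintegral_enorm h1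
            rw [← h2]
            have h3 : ∫ x, ‖φ k x‖ = 1 := by
              rw [← (b k).integral_normed (μ := volume)]
              exact integral_congr_ae (ae_of_all _ fun x => Real.norm_of_nonneg (hφn k x))
            rw [h3, ENNReal.ofReal_one]
          rw [this, one_mul]

/-! ### Sobolev and trace inequalities on the domain, and the chain rule -/

lemma ConeAt.mono {E : Type*} [NormedAddCommGroup E] [NormedSpace ℝ E] {U : Set E} {x₀ e : E}
    {c c' r : ℝ} (h : ConeAt U x₀ e c r) (hc' : 0 < c') (hcc : c' ≤ c) : ConeAt U x₀ e c' r :=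
  ⟨h.1, hc', hcc.trans h.2.2.1, h.2.2.2.1, fun x hx v hv t ht =>
    h.2.2.2.2 x hx v (Metric.ball_subset_ball hcc hv) t ht⟩

lemma exists_coneAt_le_half {n : ℕ} (hn : 1 ≤ n) {U : Set (EuclideanSpace ℝ (Fin n))}
    (hU : IsOpen U) (hC1 : HasC1Boundary U) {x₀ : EuclideanSpace ℝ (Fin n)}
    (hx₀ : x₀ ∈ closure U) : ∃ e c r, ConeAt U x₀ e c r ∧ c ≤ 1 / 2 := by
  obtain ⟨e, c, r, h⟩ := exists_coneAt hn hU hC1 hx₀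
  exact ⟨e, min c (1 / 2), r, h.mono (lt_min h.2.1 (by norm_num)) (min_le_left _ _),
    min_le_right _ _⟩

lemma ContinuousOn.integrableOn_of_closure {n : ℕ} {U : Set (EuclideanSpace ℝ (Fin n))}
    (hUb : Bornology.IsBounded U) {f : EuclideanSpace ℝ (Fin n) → ℝ}
    (hf : ContinuousOn f (closure U)) : IntegrableOn f U :=
  (hf.integrableOn_compact hUb.isCompact_closure).mono_set subset_closure

/-- Localized form of `ConeAt.exists_approx`, for functions that need not vanish anywhere. -/
lemma ConeAt.exists_local_approx {n : ℕ} {U : Set (EuclideanSpace ℝ (Fin n))} (hU : IsOpen U)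
    (hUb : Bornology.IsBounded U)
    {x₀ e : EuclideanSpace ℝ (Fin n)} {c r : ℝ} (h : ConeAt U x₀ e c r) {ρ : ℝ} (hρ0 : 0 < ρ)
    (hρr : ρ ≤ r / 8) :
    ∃ M : ℝ≥0, ∀ (f : EuclideanSpace ℝ (Fin n) → ℝ)
      (F : EuclideanSpace ℝ (Fin n) → EuclideanSpace ℝ (Fin n)), ContinuousOn f (closure U) →
      IsWeakGrad U f F → IntegrableOn F U →
      ∃ g : ℕ → EuclideanSpace ℝ (Fin n) → ℝ, (∀ k, ContDiff ℝ 1 (g k)) ∧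
        (∀ k x, x ∉ Metric.ball x₀ ρ → g k x = 0) ∧
        (∀ x ∈ closure U ∩ Metric.ball x₀ (ρ / 4), Tendsto (fun k => g k x) atTop (𝓝 (f x))) ∧
        ∀ k, ∫⁻ x in U, ‖fderiv ℝ (g k) x‖ₑ ≤
          M * ((∫⁻ x in U, ‖f x‖ₑ) + ∫⁻ x in U, ‖F x‖ₑ) := by
  let χ : ContDiffBump x₀ := ⟨ρ / 4, ρ / 2, by positivity, by linarith⟩
  have hχd : ContDiff ℝ ∞ χ := χ.contDiff
  have hχg : ∀ x, ‖gradient χ x‖ = ‖fderiv ℝ χ x‖ := fun x => by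
    rw [gradient, LinearIsometryEquiv.norm_map]
  obtain ⟨B, hB⟩ := (hχd.continuous_fderiv (by simp)).bounded_above_of_compact_support
    (χ.hasCompactSupport.fderiv ℝ)
  refine ⟨1 + B.toNNReal, fun f F hfc hw hF => ?_⟩
  have hf := ContinuousOn.integrableOn_of_closure hUb hfc
  have hgc : Continuous (gradient χ) :=
    (LinearIsometryEquiv.continuous _).comp (hχd.continuous_fderiv (by simp))
  have hF' : IntegrableOn (fun x => χ x • F x + f x • gradient χ x) U := by
    refine Integrable.add ?_ ?_
    · exact Integrable.bdd_smul hF 1 hχd.continuous.aestronglyMeasurable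
        (ae_of_all _ fun x => by
          rw [Real.norm_of_nonneg χ.nonneg]; exact χ.le_one)
    · exact Integrable.smul_bdd hf B hgc.aestronglyMeasurable
        (ae_of_all _ fun x => (hχg x).trans_le (hB x))
  obtain ⟨g, hg1, hg2, hg3, hg4⟩ := h.exists_approx hU hρ0 hρr
    (f := fun x => χ x * f x) (hχd.continuous.continuousOn.mul hfc)
    (ContinuousOn.integrableOn_of_closure hUb (hχd.continuous.continuousOn.mul hfc))
    (hw.smooth_mul hf hF hχd) hF' (fun x hx => by
      rw [χ.zero_of_le_dist (not_lt.1 hx), zero_mul])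
  refine ⟨g, hg1, hg2, fun x hx => ?_, fun k => (hg4 k).trans ?_⟩
  · have := hg3 x hx.1
    rwa [χ.one_of_mem_closedBall (Metric.ball_subset_closedBall hx.2), one_mul] at this
  · calc ∫⁻ x in U, ‖χ x • F x + f x • gradient χ x‖ₑ
        ≤ ∫⁻ x in U, (‖F x‖ₑ + B.toNNReal * ‖f x‖ₑ) := by
          refine lintegral_mono fun x => (enorm_add_le _ _).trans ?_
          rw [enorm_smul, enorm_smul, mul_comm ‖f x‖ₑ]
          gcongr
          · refine mul_le_of_le_one_left' ?_
            rw [← ofReal_norm, Real.norm_of_nonneg χ.nonneg]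
            exact ENNReal.ofReal_le_one.2 χ.le_one
          · rw [← ofReal_norm, hχg]
            exact ENNReal.ofReal_le_ofReal (hB x)
      _ = (∫⁻ x in U, ‖F x‖ₑ) + B.toNNReal * ∫⁻ x in U, ‖f x‖ₑ := by
          rw [lintegral_add_left' hF.aestronglyMeasurable.enorm,
            lintegral_const_mul' _ _ ENNReal.coe_ne_top]
      _ ≤ _ := by
          rw [ENNReal.coe_add, ENNReal.coe_one]
          set a := ∫⁻ x in U, ‖F x‖ₑ
          set b := ∫⁻ x in U, ‖f x‖ₑ
          calc a + B.toNNReal * b ≤ (b + a) + B.toNNReal * (b + a) := by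
                gcongr
                · exact le_add_self
                · exact le_self_add
            _ = _ := by ring

/-- Trace inequality: the `L¹` norm on the boundary is controlled by the `W^{1,1}` norm. -/
theorem exists_trace_const {n : ℕ} (hn : 1 ≤ n) {U : Set (EuclideanSpace ℝ (Fin n))}
    (hU : IsOpen U) (hUb : Bornology.IsBounded U) (hC1 : HasC1Boundary U) :
    ∃ C : ℝ≥0, ∀ (f : EuclideanSpace ℝ (Fin n) → ℝ)
      (F : EuclideanSpace ℝ (Fin n) → EuclideanSpace ℝ (Fin n)), ContinuousOn f (closure U) →
      IsWeakGrad U f F → IntegrableOn F U →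
      ∫⁻ x, ‖f x‖ₑ ∂(surf U) ≤ C * ((∫⁻ x in U, ‖f x‖ₑ) + ∫⁻ x in U, ‖F x‖ₑ) := by
  have hfr : ∀ᵐ x ∂(surf U), x ∈ closure U := by
    filter_upwards [ae_restrict_mem isClosed_frontier.measurableSet] with x hx
    exact frontier_subset_closure hx
  obtain ⟨C, hC⟩ := hUb.isCompact_closure.induction_on (p := fun s => ∃ C : ℝ≥0,
      ∀ (f : EuclideanSpace ℝ (Fin n) → ℝ)
      (F : EuclideanSpace ℝ (Fin n) → EuclideanSpace ℝ (Fin n)), ContinuousOn f (closure U) →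
      IsWeakGrad U f F → IntegrableOn F U →
      ∫⁻ x in s, ‖f x‖ₑ ∂(surf U) ≤ C * ((∫⁻ x in U, ‖f x‖ₑ) + ∫⁻ x in U, ‖F x‖ₑ))
    ⟨0, fun f F _ _ _ => by simp⟩
    (fun s t hst ⟨C, hC⟩ => ⟨C, fun f F h1 h2 h3 =>
      (lintegral_mono_set hst).trans (hC f F h1 h2 h3)⟩)
    (fun s t ⟨C, hC⟩ ⟨D, hD⟩ => ⟨C + D, fun f F h1 h2 h3 => by
      refine (lintegral_union_le _ _ _).trans ?_
      rw [ENNReal.coe_add, add_mul]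
      exact add_le_add (hC f F h1 h2 h3) (hD f F h1 h2 h3)⟩)
    (fun x₀ hx₀ => by
      obtain ⟨e, c, r, h, hc⟩ := exists_coneAt_le_half hn hU hC1 hx₀
      obtain ⟨C, ρ, hρ0, hρr, hC⟩ := h.exists_trace hn hU hc
      obtain ⟨M, hM⟩ := h.exists_local_approx hU hUb hρ0 hρr
      refine ⟨Metric.ball x₀ (ρ / 4), mem_nhdsWithin_of_mem_nhds
        (Metric.ball_mem_nhds _ (by positivity)), C * M, fun f F hfc hw hF => ?_⟩
      obtain ⟨g, hg1, hg2, hg3, hg4⟩ := hM f F hfc hw hF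
      calc ∫⁻ x in Metric.ball x₀ (ρ / 4), ‖f x‖ₑ ∂(surf U)
          = ∫⁻ x in Metric.ball x₀ (ρ / 4), liminf (fun k => ‖g k x‖ₑ) atTop ∂(surf U) := by
            refine lintegral_congr_ae ?_
            filter_upwards [ae_restrict_of_ae hfr,
              ae_restrict_mem Metric.isOpen_ball.measurableSet] with x hx hxb
            exact ((hg3 x ⟨hx, hxb⟩).enorm).liminf_eq.symm
        _ ≤ ∫⁻ x, liminf (fun k => ‖g k x‖ₑ) atTop ∂(surf U) := setLIntegral_le_lintegral _ _
        _ ≤ liminf (fun k => ∫⁻ x, ‖g k x‖ₑ ∂(surf U)) atTop :=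
            lintegral_liminf_le fun k => (hg1 k).continuous.measurable.enorm
        _ ≤ liminf (fun _ : ℕ => (C * M : ℝ≥0) * ((∫⁻ x in U, ‖f x‖ₑ) + ∫⁻ x in U, ‖F x‖ₑ))
              atTop := by
            refine liminf_le_liminf (Eventually.of_forall fun k => ?_)
            rw [ENNReal.coe_mul, mul_assoc]
            exact (hC (g k) (hg1 k) (hg2 k)).trans (by gcongr; exact hg4 k)
        _ = _ := liminf_const _)
  refine ⟨C, fun f F h1 h2 h3 => ?_⟩
  rw [← Measure.restrict_eq_self_of_ae_mem hfr]
  exact hC f F h1 h2 h3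

/-- Gagliardo–Nirenberg–Sobolev inequality for `W^{1,1}(U)`. -/
theorem exists_sobolev_const {n : ℕ} (hn : 2 ≤ n) {U : Set (EuclideanSpace ℝ (Fin n))}
    (hU : IsOpen U) (hUb : Bornology.IsBounded U) (hC1 : HasC1Boundary U) :
    ∃ C : ℝ≥0, ∀ (f : EuclideanSpace ℝ (Fin n) → ℝ)
      (F : EuclideanSpace ℝ (Fin n) → EuclideanSpace ℝ (Fin n)), ContinuousOn f (closure U) →
      IsWeakGrad U f F → IntegrableOn F U →
      ∫⁻ x in U, ‖f x‖ₑ ^ ((n : ℝ) / (n - 1)) ≤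
        C * ((∫⁻ x in U, ‖f x‖ₑ) + ∫⁻ x in U, ‖F x‖ₑ) ^ ((n : ℝ) / (n - 1)) := by
  have hn1 : (0 : ℝ) < n - 1 := by
    have : (2 : ℝ) ≤ n := by exact_mod_cast hn
    linarith
  have hp0 : (0 : ℝ) ≤ (n : ℝ) / (n - 1) := by positivity
  obtain ⟨C, hC⟩ := hUb.isCompact_closure.induction_on (p := fun s => ∃ C : ℝ≥0,
      ∀ (f : EuclideanSpace ℝ (Fin n) → ℝ)
      (F : EuclideanSpace ℝ (Fin n) → EuclideanSpace ℝ (Fin n)), ContinuousOn f (closure U) →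
      IsWeakGrad U f F → IntegrableOn F U →
      ∫⁻ x in U ∩ s, ‖f x‖ₑ ^ ((n : ℝ) / (n - 1)) ≤
        C * ((∫⁻ x in U, ‖f x‖ₑ) + ∫⁻ x in U, ‖F x‖ₑ) ^ ((n : ℝ) / (n - 1)))
    ⟨0, fun f F _ _ _ => by simp⟩
    (fun s t hst ⟨C, hC⟩ => ⟨C, fun f F h1 h2 h3 =>
      (lintegral_mono_set (inter_subset_inter_right _ hst)).trans (hC f F h1 h2 h3)⟩)
    (fun s t ⟨C, hC⟩ ⟨D, hD⟩ => ⟨C + D, fun f F h1 h2 h3 => by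
      rw [inter_union_distrib_left]
      refine (lintegral_union_le _ _ _).trans ?_
      rw [ENNReal.coe_add, add_mul]
      exact add_le_add (hC f F h1 h2 h3) (hD f F h1 h2 h3)⟩)
    (fun x₀ hx₀ => by
      obtain ⟨e, c, r, h, hc⟩ := exists_coneAt_le_half (by omega) hU hC1 hx₀
      obtain ⟨C, hC⟩ := h.exists_sobolev hn hU hc
      have hr := h.2.2.2.1
      obtain ⟨M, hM⟩ := h.exists_local_approx hU hUb (ρ := r / 8) (by positivity) le_rfl
      refine ⟨Metric.ball x₀ (r / 8 / 4), mem_nhdsWithin_of_mem_nhds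
        (Metric.ball_mem_nhds _ (by positivity)), C * M ^ ((n : ℝ) / (n - 1)),
        fun f F hfc hw hF => ?_⟩
      obtain ⟨g, hg1, hg2, hg3, hg4⟩ := hM f F hfc hw hF
      calc ∫⁻ x in U ∩ Metric.ball x₀ (r / 8 / 4), ‖f x‖ₑ ^ ((n : ℝ) / (n - 1))
          = ∫⁻ x in U ∩ Metric.ball x₀ (r / 8 / 4),
              liminf (fun k => ‖g k x‖ₑ ^ ((n : ℝ) / (n - 1))) atTop := by
            refine lintegral_congr_ae ?_
            filter_upwards [ae_restrict_mem
              (hU.measurableSet.inter Metric.isOpen_ball.measurableSet)] with x hx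
            exact ((ENNReal.continuous_rpow_const.tendsto _).comp
              ((hg3 x ⟨subset_closure hx.1, hx.2⟩).enorm)).liminf_eq.symm
        _ ≤ ∫⁻ x in U, liminf (fun k => ‖g k x‖ₑ ^ ((n : ℝ) / (n - 1))) atTop :=
            lintegral_mono_set inter_subset_left
        _ ≤ liminf (fun k => ∫⁻ x in U, ‖g k x‖ₑ ^ ((n : ℝ) / (n - 1))) atTop :=
            lintegral_liminf_le fun k => (hg1 k).continuous.measurable.enorm.pow_const _
        _ ≤ liminf (fun _ : ℕ => (C * M ^ ((n : ℝ) / (n - 1)) : ℝ≥0) *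
              ((∫⁻ x in U, ‖f x‖ₑ) + ∫⁻ x in U, ‖F x‖ₑ) ^ ((n : ℝ) / (n - 1))) atTop := by
            refine liminf_le_liminf (Eventually.of_forall fun k => ?_)
            rw [ENNReal.coe_mul, mul_assoc, ENNReal.coe_rpow_of_nonneg _ hp0,
              ← ENNReal.mul_rpow_of_nonneg _ _ hp0]
            refine (hC (g k) (hg1 k) (hg2 k)).trans ?_
            gcongr
            exact hg4 k
        _ = _ := liminf_const _)
  refine ⟨C, fun f F h1 h2 h3 => ?_⟩
  have := hC f F h1 h2 h3
  rwa [inter_eq_left.2 subset_closure] at this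

set_option maxHeartbeats 600000 in
/-- Chain rule for weak gradients. On the support of the test function, mollification converges
uniformly and commutes with the gradient. -/
theorem IsWeakGrad.comp_contDiff {n : ℕ} {U : Set (EuclideanSpace ℝ (Fin n))}
    (hU : IsOpen U) (hUb : Bornology.IsBounded U) {f : EuclideanSpace ℝ (Fin n) → ℝ}
    {F : EuclideanSpace ℝ (Fin n) → EuclideanSpace ℝ (Fin n)} (hfc : ContinuousOn f (closure U))
    (hw : IsWeakGrad U f F) (hF : IntegrableOn F U) {Ψ : ℝ → ℝ} (hΨ : ContDiff ℝ 1 Ψ) :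
    IsWeakGrad U (fun x => Ψ (f x)) (fun x => deriv Ψ (f x) • F x) := by
  intro ψ hψ hψc hψU e
  have hf := ContinuousOn.integrableOn_of_closure hUb hfc
  have hψ1 : ContDiff ℝ 1 ψ := hψ.of_le (by simp)
  obtain ⟨δ, hδ, hδU⟩ : ∃ δ > 0, Metric.cthickening δ (tsupport ψ) ⊆ U :=
    hψc.exists_cthickening_subset_open hU hψU
  set s : ℕ → ℝ := fun k => δ / (k + 1) with hs
  have hs0 : ∀ k, 0 < s k := fun k => by positivity
  have hs1 : ∀ k, s k ≤ δ := fun k => div_le_self hδ.le (by linarith [Nat.cast_nonneg (α := ℝ) k])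
  have hslim : Tendsto s atTop (𝓝 0) := by
    have := (tendsto_one_div_add_atTop_nhds_zero_nat (𝕜 := ℝ)).const_mul δ
    simpa [hs, div_eq_mul_inv] using this
  let b : ℕ → ContDiffBump (0 : EuclideanSpace ℝ (Fin n)) := fun k =>
    ⟨s k / 2, s k, by have := hs0 k; positivity, by linarith [hs0 k]⟩
  set φ : ℕ → EuclideanSpace ℝ (Fin n) → ℝ := fun k => (b k).normed volume with hφ
  have hφd : ∀ k, ContDiff ℝ ∞ (φ k) := fun k => (b k).contDiff_normed
  have hφc : ∀ k, HasCompactSupport (φ k) := fun k => (b k).hasCompactSupport_normed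
  have hφt : ∀ k, tsupport (φ k) = Metric.closedBall 0 (s k) := fun k => (b k).tsupport_normed_eq
  have hφs : ∀ k x, φ k (-x) = φ k x := fun k x => (b k).normed_neg x
  set u : ℕ → EuclideanSpace ℝ (Fin n) → ℝ := fun k => moll U (φ k) f with hu
  have hud : ∀ k, ContDiff ℝ 1 (u k) := fun k => (contDiff_moll hU hf (hφd k) (hφc k)).of_le (by simp)
  have hder : ∀ k, ∀ x ∈ tsupport ψ,
      fderiv ℝ (u k) x e = ∫ y in U, φ k (x - y) * ⟪F y, e⟫_ℝ := by
    intro k x hx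
    have h1 := fderiv_moll (x := x) hU hf hw hF (hφd k) (hφc k) (fun y hy => hδU (by
      rw [hφt, mem_closedBall_zero_iff] at hy
      refine Metric.mem_cthickening_of_dist_le y x δ _ hx ?_
      rw [dist_comm, dist_eq_norm]
      exact hy.trans (hs1 k)))
    rw [hu, h1, innerSL_apply_apply, real_inner_comm, ← integral_inner]
    · congr 1
      funext y
      rw [inner_smul_right, real_inner_comm]
    · obtain ⟨M, hM⟩ := (hφd k).continuous.bounded_above_of_compact_support (hφc k)
      exact Integrable.bdd_smul hF M
        ((hφd k).continuous.comp (continuous_const.sub continuous_id)).aestronglyMeasurable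
        (ae_of_all _ fun y => hM _)
  -- uniform convergence near each point of `U`
  have hconv : ∀ x ∈ U, Tendsto (fun p : ℕ × EuclideanSpace ℝ (Fin n) => u p.1 p.2)
      (atTop ×ˢ 𝓝 x) (𝓝 (f x)) := by
    intro x hx
    have h1 : Tendsto (U.indicator f) (𝓝 x) (𝓝 (f x)) := by
      have h2 : U.indicator f =ᶠ[𝓝 x] f := by
        filter_upwards [hU.mem_nhds hx] with y hy
        exact indicator_of_mem hy f
      exact ((hfc.mono subset_closure).continuousAt (hU.mem_nhds hx)).congr h2.symm |>.tendsto.trans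
        (by rw [indicator_of_mem hx])
    exact ContDiffBump.convolution_tendsto_right (μ := volume)
      (φ := fun p : ℕ × EuclideanSpace ℝ (Fin n) => b p.1)
      (g := fun _ => U.indicator f) (k := fun p => p.2) (hslim.comp tendsto_fst)
      (Eventually.of_forall fun _ =>
        ((integrable_indicator_iff hU.measurableSet).2 hf).aestronglyMeasurable)
      (h1.comp tendsto_snd) tendsto_snd
  obtain ⟨R, hR⟩ : ∃ R, ∀ x ∈ closure U, ‖f x‖ ≤ R :=
    hUb.isCompact_closure.exists_bound_of_continuousOn hfc
  have hR0 : ∀ x, ‖U.indicator f x‖ ≤ max R 0 := fun x => by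
    by_cases hx : x ∈ U
    · rw [indicator_of_mem hx]; exact (hR x (subset_closure hx)).trans (le_max_left _ _)
    · rw [indicator_of_notMem hx]; simp
  have huR : ∀ k x, ‖u k x‖ ≤ max R 0 := by
    intro k x
    have hi := (b k).integrable_normed (μ := (volume : Measure (EuclideanSpace ℝ (Fin n))))
    calc ‖u k x‖ = ‖∫ t, φ k t * U.indicator f (x - t)‖ := rfl
      _ ≤ ∫ t, φ k t * max R 0 := by
          refine norm_integral_le_of_norm_le (hi.mul_const _) (ae_of_all _ fun t => ?_)
          rw [norm_mul, Real.norm_of_nonneg ((b k).nonneg_normed t)]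
          exact mul_le_mul_of_nonneg_left (hR0 _) ((b k).nonneg_normed t)
      _ = max R 0 := by
          rw [integral_mul_const]
          have := (b k).integral_normed (μ := (volume : Measure (EuclideanSpace ℝ (Fin n))))
          rw [this, one_mul]
  clear_value u
  have hΨ' : Continuous (deriv Ψ) := hΨ.continuous_deriv le_rfl
  obtain ⟨A, hA⟩ : ∃ A, ∀ t ∈ Icc (-(max R 0)) (max R 0), ‖Ψ t‖ ≤ A :=
    isCompact_Icc.exists_bound_of_continuousOn hΨ.continuous.continuousOn
  obtain ⟨A', hA'⟩ : ∃ A', ∀ t ∈ Icc (-(max R 0)) (max R 0), ‖deriv Ψ t‖ ≤ A' :=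
    isCompact_Icc.exists_bound_of_continuousOn hΨ'.continuousOn
  have huA' : ∀ k x, ‖deriv Ψ (u k x)‖ ≤ A' := fun k x => hA' _ (abs_le.1 (huR k x))
  have huA : ∀ k x, ‖Ψ (u k x)‖ ≤ A := fun k x => hA _ (abs_le.1 (huR k x))
  set ζ : ℕ → EuclideanSpace ℝ (Fin n) → ℝ := fun k x => deriv Ψ (u k x) * ψ x with hζ
  have hζc : ∀ k, Continuous (ζ k) := fun k => (hΨ'.comp (hud k).continuous).mul hψ.continuous
  have hζs : ∀ k, HasCompactSupport (ζ k) := fun k => hψc.mul_left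
  have hψe : Continuous fun x => fderiv ℝ ψ x e :=
    (hψ.continuous_fderiv (by simp)).clm_apply continuous_const
  have hψec : HasCompactSupport fun x => fderiv ℝ ψ x e := hψc.fderiv_apply ℝ e
  -- the identity for the mollified functions
  have hid : ∀ k, ∫ x in U, Ψ (u k x) * fderiv ℝ ψ x e =
      - ∫ y in U, ⟪F y, e⟫_ℝ * convolution (φ k) (ζ k) (ContinuousLinearMap.lsmul ℝ ℝ) volume y := by
    intro k
    have hΨu : ContDiff ℝ 1 fun x => Ψ (u k x) := hΨ.comp (hud k)
    have hΨuc : Continuous fun x => fderiv ℝ (fun x => Ψ (u k x)) x e :=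
      (hΨu.continuous_fderiv one_ne_zero).clm_apply continuous_const
    have h1 : ∫ x in U, Ψ (u k x) * fderiv ℝ ψ x e = ∫ x, Ψ (u k x) * fderiv ℝ ψ x e := by
      apply setIntegral_eq_integral_of_forall_compl_eq_zero
      intro x hx
      rw [show fderiv ℝ ψ x = 0 from image_eq_zero_of_notMem_tsupport fun h' =>
        hx (hψU (tsupport_fderiv_subset ℝ h'))]
      simp
    rw [h1, integral_mul_fderiv_eq_neg_fderiv_mul_of_integrable
      ((hΨuc.mul hψ.continuous).integrable_of_hasCompactSupport hψc.mul_left)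
      ((hΨu.continuous.mul hψe).integrable_of_hasCompactSupport hψec.mul_left)
      ((hΨu.continuous.mul hψ.continuous).integrable_of_hasCompactSupport hψc.mul_left)
      (fun x _ => hΨu.differentiable one_ne_zero x) (fun x _ => hψ1.differentiable one_ne_zero x)]
    congr 1
    have h2 : ∀ x, fderiv ℝ (fun x => Ψ (u k x)) x e * ψ x =
        ∫ y in U, ζ k x * (φ k (x - y) * ⟪F y, e⟫_ℝ) := by
      intro x
      by_cases hx : x ∈ tsupport ψ
      · have h3 : HasFDerivAt (fun x => Ψ (u k x)) (deriv Ψ (u k x) • fderiv ℝ (u k) x) x :=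
          ((hΨ.differentiable one_ne_zero) (u k x)).hasDerivAt.comp_hasFDerivAt x
            ((hud k).differentiable one_ne_zero x).hasFDerivAt
        rw [h3.fderiv, integral_const_mul, ← hder k x hx, hζ]
        simp only [_root_.smul_apply, smul_eq_mul]
        ring
      · simp [hζ, image_eq_zero_of_notMem_tsupport hx]
    simp only [h2]
    rw [integral_integral_swap]
    · congr 1
      funext y
      rw [convolution_eq_swap, ← integral_const_mul]
      congr 1
      funext x
      rw [ContinuousLinearMap.lsmul_apply, smul_eq_mul, ← hφs k (y - x), neg_sub]
      ring
    · obtain ⟨M, hM⟩ := (hφd k).continuous.bounded_above_of_compact_support (hφc k)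
      have h3 : Integrable (fun z : EuclideanSpace ℝ (Fin n) × EuclideanSpace ℝ (Fin n) =>
          ζ k z.1 * ⟪F z.2, e⟫_ℝ) (volume.prod (volume.restrict U)) :=
        ((hζc k).integrable_of_hasCompactSupport (hζs k)).mul_prod (hF.inner_const e)
      have hφm : Continuous fun z : EuclideanSpace ℝ (Fin n) × EuclideanSpace ℝ (Fin n) =>
          φ k (z.1 - z.2) := (hφd k).continuous.comp (continuous_fst.sub continuous_snd)
      have hφb : ∀ z : EuclideanSpace ℝ (Fin n) × EuclideanSpace ℝ (Fin n),
          ‖φ k (z.1 - z.2)‖ ≤ M := fun z => hM _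
      have h4 := h3.bdd_mul hφm.aestronglyMeasurable (ae_of_all _ hφb)
      refine h4.congr (ae_of_all _ fun z => ?_)
      simp only [Function.uncurry]
      ring
  -- pass to the limit on both sides
  have hlim1 : Tendsto (fun k => ∫ x in U, Ψ (u k x) * fderiv ℝ ψ x e) atTop
      (𝓝 (∫ x in U, Ψ (f x) * fderiv ℝ ψ x e)) := by
    refine tendsto_integral_of_dominated_convergence (fun x => A * ‖fderiv ℝ ψ x e‖)
      (fun k => ((hΨ.continuous.comp (hud k).continuous).mul hψe).aestronglyMeasurable)
      ((hψe.norm.integrable_of_hasCompactSupport hψec.norm).integrableOn.const_mul A)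
      (fun k => ae_of_all _ fun x => ?_) ?_
    · rw [norm_mul]
      exact mul_le_mul_of_nonneg_right (huA k x) (norm_nonneg _)
    · filter_upwards [ae_restrict_mem hU.measurableSet] with x hx
      refine Tendsto.mul_const _ ((hΨ.continuous.tendsto _).comp ?_)
      exact (hconv x hx).comp (tendsto_id.prodMk tendsto_const_nhds)
  obtain ⟨B, hB⟩ := hψ.continuous.bounded_above_of_compact_support hψc
  have hlim2 : Tendsto (fun k => ∫ y in U, ⟪F y, e⟫_ℝ *
      convolution (φ k) (ζ k) (ContinuousLinearMap.lsmul ℝ ℝ) volume y) atTop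
      (𝓝 (∫ y in U, ⟪F y, e⟫_ℝ * (deriv Ψ (f y) * ψ y))) := by
    have hB0 : 0 ≤ B := (norm_nonneg _).trans (hB 0)
    have hA0 : 0 ≤ A' := (norm_nonneg _).trans (huA' 0 0)
    have hζb : ∀ k x, ‖ζ k x‖ ≤ A' * B := fun k x => by
      rw [hζ, norm_mul]
      exact mul_le_mul (huA' k x) (hB x) (norm_nonneg _) hA0
    refine tendsto_integral_of_dominated_convergence (fun y => ‖⟪F y, e⟫_ℝ‖ * (A' * B))
      (fun k => (hF.inner_const e).aestronglyMeasurable.mul ?_)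
      ((hF.inner_const e).norm.mul_const _) (fun k => ae_of_all _ fun y => ?_) ?_
    · exact ((hφc k).continuous_convolution_left _ (hφd k).continuous
        (hζc k).locallyIntegrable).aestronglyMeasurable
    · rw [norm_mul]
      gcongr
      have hi := (b k).integrable_normed (μ := (volume : Measure (EuclideanSpace ℝ (Fin n))))
      calc ‖convolution (φ k) (ζ k) (ContinuousLinearMap.lsmul ℝ ℝ) volume y‖
          = ‖∫ t, φ k t * ζ k (y - t)‖ := rfl
        _ ≤ ∫ t, φ k t * (A' * B) := by
            refine norm_integral_le_of_norm_le (hi.mul_const _) (ae_of_all _ fun t => ?_)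
            rw [norm_mul, Real.norm_of_nonneg ((b k).nonneg_normed t)]
            exact mul_le_mul_of_nonneg_left (hζb k _) ((b k).nonneg_normed t)
        _ = A' * B := by
            rw [integral_mul_const]
            have := (b k).integral_normed (μ := (volume : Measure (EuclideanSpace ℝ (Fin n))))
            rw [this, one_mul]
    · filter_upwards [ae_restrict_mem hU.measurableSet] with y hy
      refine Tendsto.const_mul _ ?_
      refine ContDiffBump.convolution_tendsto_right (μ := volume) (φ := b) (g := ζ)
        (k := fun _ => y) hslim (Eventually.of_forall fun k => (hζc k).aestronglyMeasurable)
        ?_ tendsto_const_nhds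
      exact ((hΨ'.tendsto _).comp (hconv y hy)).mul ((hψ.continuous.tendsto y).comp tendsto_snd)
  have hlim3 := tendsto_nhds_unique (hlim1.congr hid) hlim2.neg
  rw [hlim3]
  congr 2
  funext y
  rw [real_inner_smul_left]
  ring

/-! ### The nonlinearity and its energy density -/

namespace GenPoly

variable (P : GenPoly)

lemma expo_last_pos : 0 < P.expo (Fin.last P.N) := by
  rw [← P.expo_zero]
  refine P.expo_strictMono ?_
  rw [Fin.lt_def]
  have := P.one_le_N
  simpa using (by omega : 0 < P.N)

lemma a_pos : 0 < P.a := div_pos P.expo_last_pos (by linarith [P.expo_last_pos])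

lemma one_sub_a : 1 - P.a = 1 / (P.expo (Fin.last P.N) + 1) := by
  have := P.expo_last_pos
  rw [a]; field_simp; ring

lemma a_lt_one : P.a < 1 := by
  have h := P.expo_last_pos
  have h1 : 0 < 1 - P.a := by rw [one_sub_a]; positivity
  linarith

lemma g_pos {s : ℝ} (hs : 0 ≤ s) : 0 < P.g s := (P.coeff_pos 0).trans_le (P.coeff_zero_le_g hs)

lemma root_nonneg {ξ : ℝ} (hξ : 0 ≤ ξ) : 0 ≤ P.root ξ := (P.root_spec hξ).1

lemma root_mul_g {ξ : ℝ} (hξ : 0 ≤ ξ) : P.root ξ * P.g (P.root ξ) = ξ := (P.root_spec hξ).2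

lemma K_mul {ξ : ℝ} (hξ : 0 ≤ ξ) : P.K ξ * ξ = P.root ξ := by
  have h := P.g_pos (P.root_nonneg hξ)
  rw [K, one_div, inv_mul_eq_iff_eq_mul₀ h.ne', mul_comm]
  exact (P.root_mul_g hξ).symm

lemma K_nonneg {ξ : ℝ} (hξ : 0 ≤ ξ) : 0 ≤ P.K ξ :=
  one_div_nonneg.2 (P.g_pos (P.root_nonneg hξ)).le

lemma root_mono {ξ η : ℝ} (hξ : 0 ≤ ξ) (h : ξ ≤ η) : P.root ξ ≤ P.root η := by
  by_contra hcon
  push Not at hcon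
  have hη := hξ.trans h
  have h1 : P.root η * P.g (P.root η) < P.root ξ * P.g (P.root ξ) :=
    calc P.root η * P.g (P.root η) ≤ P.root η * P.g (P.root ξ) :=
          mul_le_mul_of_nonneg_left (P.g_mono (P.root_nonneg hη) hcon.le) (P.root_nonneg hη)
      _ < _ := mul_lt_mul_of_pos_right hcon (P.g_pos (P.root_nonneg hξ))
  rw [P.root_mul_g hξ, P.root_mul_g hη] at h1
  linarith

lemma measurable_root_max : Measurable fun ξ : ℝ => P.root (max ξ 0) :=
  Monotone.measurable fun _ _ h => P.root_mono (le_max_right _ _) (max_le_max_right 0 h)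

lemma measurable_K_norm {E : Type*} [NormedAddCommGroup E] [MeasurableSpace E]
    [OpensMeasurableSpace E] : Measurable fun x : E => P.K ‖x‖ := by
  have h : (fun x : E => P.K ‖x‖) = fun x : E => 1 / P.g (P.root (max ‖x‖ 0)) := by
    funext x
    rw [max_eq_left (norm_nonneg x)]; rfl
  rw [h]
  exact (P.continuous_g.measurable.comp
    (P.measurable_root_max.comp continuous_norm.measurable)).const_div 1

/-- The antiderivative of `s ↦ s g(s)`. -/
noncomputable def primitive (s : ℝ) : ℝ := ∑ i, P.coeff i * (s ^ (P.expo i + 2) / (P.expo i + 2))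

/-- The antiderivative `∫₀^ξ K(t) t dt` of `ξ ↦ K(ξ) ξ = s(ξ)`, as the Legendre transform of
`primitive`. -/
noncomputable def energy (ξ : ℝ) : ℝ := ξ * P.root ξ - P.primitive (P.root ξ)

lemma sq_mul_g {s : ℝ} (hs : 0 ≤ s) : s * (s * P.g s) = ∑ i, P.coeff i * s ^ (P.expo i + 2) := by
  rw [g, Finset.mul_sum, Finset.mul_sum]
  refine Finset.sum_congr rfl fun i _ => ?_
  rw [Real.rpow_add_of_nonneg hs (P.expo_nonneg i) (by norm_num)]
  norm_num
  ring

/-- Convexity of `primitive`, in the form of the tangent line inequality. -/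
lemma primitive_tangent {s t : ℝ} (hs : 0 ≤ s) (ht : 0 ≤ t) :
    P.primitive t + t * P.g t * (s - t) ≤ P.primitive s := by
  have h : t * P.g t * (s - t) = ∑ i, P.coeff i * (t ^ (P.expo i + 1) * s - t ^ (P.expo i + 2)) := by
    have h1 := P.sq_mul_g ht
    have h2 : t * P.g t = ∑ i, P.coeff i * t ^ (P.expo i + 1) := by
      rw [g, Finset.mul_sum]
      refine Finset.sum_congr rfl fun i _ => ?_
      rw [Real.rpow_add_of_nonneg ht (P.expo_nonneg i) (by norm_num), Real.rpow_one]
      ring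
    calc t * P.g t * (s - t) = t * P.g t * s - t * (t * P.g t) := by ring
      _ = _ := by
        rw [h1, h2, Finset.sum_mul, ← Finset.sum_sub_distrib]
        refine Finset.sum_congr rfl fun i _ => ?_
        ring
  rw [h, primitive, primitive, ← Finset.sum_add_distrib]
  refine Finset.sum_le_sum fun i _ => ?_
  rw [← mul_add]
  refine mul_le_mul_of_nonneg_left ?_ (P.coeff_pos i).le
  set q := P.expo i + 2 with hq
  have hq2 : 2 ≤ q := by linarith [P.expo_nonneg i]
  have hconj : Real.HolderConjugate q (q / (q - 1)) := Real.HolderConjugate.conjExponent (by linarith)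
  have hy := Real.young_inequality_of_nonneg hs (Real.rpow_nonneg ht (q - 1)) hconj
  have hq1 : q - 1 ≠ 0 := by linarith
  rw [← Real.rpow_mul ht, mul_div_cancel₀ _ hq1] at hy
  have he : P.expo i + 1 = q - 1 := by rw [hq]; ring
  have h3 : t ^ q / (q / (q - 1)) = t ^ q - t ^ q / q := by field_simp
  rw [he]
  rw [h3] at hy
  linarith

/-- Convexity of `energy`, in the form of the tangent line inequality. -/
lemma energy_tangent {ξ η : ℝ} (hξ : 0 ≤ ξ) (hη : 0 ≤ η) :
    P.energy ξ + P.root ξ * (η - ξ) ≤ P.energy η := by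
  have h := P.primitive_tangent (P.root_nonneg hξ) (P.root_nonneg hη)
  rw [P.root_mul_g hη] at h
  rw [energy, energy]
  linarith

lemma primitive_nonneg {s : ℝ} (hs : 0 ≤ s) : 0 ≤ P.primitive s :=
  Finset.sum_nonneg fun i _ => mul_nonneg (P.coeff_pos i).le
    (div_nonneg (Real.rpow_nonneg hs _) (by linarith [P.expo_nonneg i]))

lemma energy_le {ξ : ℝ} (hξ : 0 ≤ ξ) : P.energy ξ ≤ ξ * P.root ξ := by
  rw [energy]; linarith [P.primitive_nonneg (P.root_nonneg hξ)]

lemma half_le_energy {ξ : ℝ} (hξ : 0 ≤ ξ) : ξ * P.root ξ / 2 ≤ P.energy ξ := by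
  have hs := P.root_nonneg hξ
  have h1 : ξ * P.root ξ = ∑ i, P.coeff i * P.root ξ ^ (P.expo i + 2) := by
    rw [← P.sq_mul_g hs, P.root_mul_g hξ, mul_comm]
  have h2 : P.primitive (P.root ξ) ≤ ξ * P.root ξ / 2 := by
    rw [h1, primitive, Finset.sum_div]
    refine Finset.sum_le_sum fun i _ => ?_
    rw [mul_div_assoc]
    refine mul_le_mul_of_nonneg_left ?_ (P.coeff_pos i).le
    exact div_le_div_of_nonneg_left (Real.rpow_nonneg hs _) (by norm_num)
      (by linarith [P.expo_nonneg i])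
  rw [energy]; linarith

lemma exists_root_le : ∃ C : ℝ, 0 < C ∧ ∀ ξ : ℝ, 0 ≤ ξ → P.root ξ ≤ C * ξ ^ (1 - P.a) := by
  have hc := P.coeff_pos (Fin.last P.N)
  have he := P.expo_last_pos
  set b := P.expo (Fin.last P.N) + 1 with hb
  refine ⟨(1 / P.coeff (Fin.last P.N)) ^ (1 - P.a), by positivity, fun ξ hξ => ?_⟩
  have hs := P.root_nonneg hξ
  have h1 : P.coeff (Fin.last P.N) * P.root ξ ^ b ≤ ξ := by
    conv_rhs => rw [← P.root_mul_g hξ]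
    rw [hb, Real.rpow_add_of_nonneg hs he.le zero_le_one, Real.rpow_one, ← mul_assoc, mul_comm]
    refine mul_le_mul_of_nonneg_left ?_ hs
    exact Finset.single_le_sum (f := fun i => P.coeff i * P.root ξ ^ P.expo i)
      (fun i _ => mul_nonneg (P.coeff_pos i).le (Real.rpow_nonneg hs _)) (Finset.mem_univ _)
  have h2 : P.root ξ ^ b ≤ 1 / P.coeff (Fin.last P.N) * ξ := by
    rw [div_mul_eq_mul_div, one_mul, le_div_iff₀ hc]; linarith
  have h3 : P.root ξ = (P.root ξ ^ b) ^ (1 - P.a) := by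
    rw [← Real.rpow_mul hs, P.one_sub_a, mul_one_div_cancel (by positivity), Real.rpow_one]
  rw [← Real.mul_rpow (by positivity) hξ, h3]
  exact Real.rpow_le_rpow (Real.rpow_nonneg hs _) h2 (by linarith [P.a_lt_one])

lemma exists_rpow_le : ∃ C : ℝ, 0 < C ∧ ∀ ξ : ℝ, 0 ≤ ξ →
    ξ ^ (2 - P.a) ≤ C * (ξ * P.root ξ) + C := by
  have hg1 := P.g_pos zero_le_one
  have ha := P.a_lt_one
  have he := P.expo_last_pos
  set b := P.expo (Fin.last P.N) with hb
  refine ⟨max (P.g 1 ^ (2 - P.a)) (P.g 1 ^ (1 - P.a)), by positivity, fun ξ hξ => ?_⟩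
  have hs := P.root_nonneg hξ
  have hss := P.root_mul_g hξ
  set C := max (P.g 1 ^ (2 - P.a)) (P.g 1 ^ (1 - P.a)) with hC
  have hC0 : 0 < C := by positivity
  have hξs : 0 ≤ C * (ξ * P.root ξ) := by positivity
  rcases le_total (P.root ξ) 1 with h1 | h1
  · have h2 : ξ ≤ P.g 1 := by
      rw [← hss]
      calc P.root ξ * P.g (P.root ξ) ≤ 1 * P.g 1 :=
            mul_le_mul h1 (P.g_mono hs h1) (P.g_pos hs).le zero_le_one
        _ = _ := one_mul _
    have h3 : ξ ^ (2 - P.a) ≤ P.g 1 ^ (2 - P.a) := Real.rpow_le_rpow hξ h2 (by linarith)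
    linarith [le_max_left (P.g 1 ^ (2 - P.a)) (P.g 1 ^ (1 - P.a))]
  · have h2 : P.g (P.root ξ) ≤ P.g 1 * P.root ξ ^ b := by
      rw [g, g, Finset.sum_mul]
      refine Finset.sum_le_sum fun i _ => ?_
      rw [Real.one_rpow, mul_one]
      refine mul_le_mul_of_nonneg_left ?_ (P.coeff_pos i).le
      exact Real.rpow_le_rpow_of_exponent_le h1 (P.expo_strictMono.monotone (Fin.le_last i))
    have h3 : ξ ≤ P.g 1 * P.root ξ ^ (b + 1) := by
      rw [Real.rpow_add_of_nonneg hs he.le zero_le_one, Real.rpow_one]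
      calc ξ = P.root ξ * P.g (P.root ξ) := hss.symm
        _ ≤ P.root ξ * (P.g 1 * P.root ξ ^ b) := by gcongr
        _ = _ := by ring
    have h4 : ξ ^ (1 - P.a) ≤ P.g 1 ^ (1 - P.a) * P.root ξ := by
      calc ξ ^ (1 - P.a) ≤ (P.g 1 * P.root ξ ^ (b + 1)) ^ (1 - P.a) :=
            Real.rpow_le_rpow hξ h3 (by linarith)
        _ = P.g 1 ^ (1 - P.a) * P.root ξ := by
            rw [Real.mul_rpow hg1.le (Real.rpow_nonneg hs _), ← Real.rpow_mul hs, P.one_sub_a,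
              ← hb, mul_one_div_cancel (by positivity), Real.rpow_one]
    have h5 : ξ ^ (2 - P.a) = ξ * ξ ^ (1 - P.a) := by
      rw [show 2 - P.a = 1 + (1 - P.a) by ring,
        Real.rpow_add_of_nonneg hξ zero_le_one (by linarith), Real.rpow_one]
    rw [h5]
    calc ξ * ξ ^ (1 - P.a) ≤ ξ * (P.g 1 ^ (1 - P.a) * P.root ξ) := by gcongr
      _ = P.g 1 ^ (1 - P.a) * (ξ * P.root ξ) := by ring
      _ ≤ C * (ξ * P.root ξ) := by gcongr; exact le_max_right _ _
      _ ≤ _ := by linarith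

section inner

variable {E : Type*} [NormedAddCommGroup E] [InnerProductSpace ℝ E]

lemma energy_norm_tangent (ξ η : E) :
    P.energy ‖ξ‖ + P.K ‖ξ‖ * ⟪ξ, η - ξ⟫_ℝ ≤ P.energy ‖η‖ := by
  refine le_trans ?_ (P.energy_tangent (norm_nonneg ξ) (norm_nonneg η))
  rw [← P.K_mul (norm_nonneg ξ), inner_sub_right, real_inner_self_eq_norm_sq]
  have h := mul_le_mul_of_nonneg_left (real_inner_le_norm ξ η) (P.K_nonneg (norm_nonneg ξ))
  linarith

lemma K_norm_mul_inner_self (ξ : E) : P.K ‖ξ‖ * ⟪ξ, ξ⟫_ℝ = ‖ξ‖ * P.root ‖ξ‖ := by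
  rw [← P.K_mul (norm_nonneg ξ), real_inner_self_eq_norm_sq]; ring

lemma abs_K_norm_mul_inner_le (ξ η : E) : |P.K ‖ξ‖ * ⟪ξ, η⟫_ℝ| ≤ P.root ‖ξ‖ * ‖η‖ := by
  rw [← P.K_mul (norm_nonneg ξ), abs_mul, abs_of_nonneg (P.K_nonneg (norm_nonneg ξ)), mul_assoc]
  exact mul_le_mul_of_nonneg_left (abs_real_inner_le_norm ξ η) (P.K_nonneg (norm_nonneg ξ))

end inner

lemma measurable_energy_norm {E : Type*} [NormedAddCommGroup E] [MeasurableSpace E]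
    [OpensMeasurableSpace E] :
    Measurable fun x : E => P.energy ‖x‖ := by
  have h : (fun x : E => P.energy ‖x‖) = fun x : E => ‖x‖ * P.root (max ‖x‖ 0) -
      ∑ i, P.coeff i * (P.root (max ‖x‖ 0) ^ (P.expo i + 2) / (P.expo i + 2)) := by
    funext x
    rw [max_eq_left (norm_nonneg x)]; rfl
  rw [h]
  have hm : Measurable fun x : E => P.root (max ‖x‖ 0) :=
    P.measurable_root_max.comp continuous_norm.measurable
  exact (continuous_norm.measurable.mul hm).sub
    (Finset.measurable_sum _ fun i _ => ((hm.pow_const _).div_const _).const_mul _)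

end GenPoly

/-! ### Powers of non-negative Sobolev functions -/

/-- Hölder's inequality, written with weights: `∫ f^s g^t ≤ (∫ f)^s (∫ g)^t` for `s + t = 1`. -/
lemma integral_rpow_mul_rpow_le {X : Type*} [MeasurableSpace X] {μ : Measure X} {f g : X → ℝ}
    (hf : Integrable f μ) (hg : Integrable g μ) (hf0 : 0 ≤ᵐ[μ] f) (hg0 : 0 ≤ᵐ[μ] g) {s t : ℝ}
    (hs : 0 ≤ s) (ht : 0 ≤ t) (hst : s + t = 1) :
    ∫ x, f x ^ s * g x ^ t ∂μ ≤ (∫ x, f x ∂μ) ^ s * (∫ x, g x ∂μ) ^ t := by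
  have hm : AEStronglyMeasurable (fun x => f x ^ s * g x ^ t) μ :=
    ((hf.aemeasurable.pow_const s).mul (hg.aemeasurable.pow_const t)).aestronglyMeasurable
  have h0 : 0 ≤ᵐ[μ] fun x => f x ^ s * g x ^ t := by
    filter_upwards [hf0, hg0] with x h1 h2
    exact mul_nonneg (Real.rpow_nonneg h1 _) (Real.rpow_nonneg h2 _)
  have hF : 0 ≤ ∫ x, f x ∂μ := integral_nonneg_of_ae hf0
  have hG : 0 ≤ ∫ x, g x ∂μ := integral_nonneg_of_ae hg0
  rw [integral_eq_lintegral_of_nonneg_ae h0 hm]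
  refine ENNReal.toReal_le_of_le_ofReal
    (mul_nonneg (Real.rpow_nonneg hF _) (Real.rpow_nonneg hG _)) ?_
  rw [ENNReal.ofReal_mul (Real.rpow_nonneg hF _), ← ENNReal.ofReal_rpow_of_nonneg hF hs,
    ← ENNReal.ofReal_rpow_of_nonneg hG ht, ofReal_integral_eq_lintegral_ofReal hf hf0,
    ofReal_integral_eq_lintegral_ofReal hg hg0]
  refine le_trans (le_of_eq ?_) (ENNReal.lintegral_mul_norm_pow_le hf.aemeasurable.ennreal_ofReal
    hg.aemeasurable.ennreal_ofReal hs ht hst)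
  refine lintegral_congr_ae ?_
  filter_upwards [hf0, hg0] with x h1 h2
  rw [ENNReal.ofReal_mul (Real.rpow_nonneg h1 _), ENNReal.ofReal_rpow_of_nonneg h1 hs,
    ENNReal.ofReal_rpow_of_nonneg h2 ht]

/-- Non-negative functions in `C(closure U) ∩ W^{1,p}(U)`, together with their weak gradients. -/
structure IsNonnegSobolev {n : ℕ} (U : Set (EuclideanSpace ℝ (Fin n))) (p : ℝ)
    (v : EuclideanSpace ℝ (Fin n) → ℝ)
    (D : EuclideanSpace ℝ (Fin n) → EuclideanSpace ℝ (Fin n)) : Prop where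
  nonneg : ∀ x ∈ closure U, 0 ≤ v x
  continuousOn : ContinuousOn v (closure U)
  weakGrad : IsWeakGrad U v D
  memLp : MemLp D (ENNReal.ofReal p) (volume.restrict U)

namespace IsNonnegSobolev

variable {n : ℕ} {U : Set (EuclideanSpace ℝ (Fin n))} {p : ℝ} {v : EuclideanSpace ℝ (Fin n) → ℝ}
    {D : EuclideanSpace ℝ (Fin n) → EuclideanSpace ℝ (Fin n)}

lemma ae_nonneg (h : IsNonnegSobolev U p v D) (hU : IsOpen U) :
    ∀ᵐ x ∂(volume.restrict U), 0 ≤ v x := by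
  filter_upwards [ae_restrict_mem hU.measurableSet] with x hx
  exact h.nonneg x (subset_closure hx)

lemma exists_bound (h : IsNonnegSobolev U p v D) (hUb : Bornology.IsBounded U) :
    ∃ M, 0 ≤ M ∧ ∀ x ∈ closure U, v x ≤ M := by
  obtain ⟨M, hM⟩ := hUb.isCompact_closure.exists_bound_of_continuousOn h.continuousOn
  exact ⟨max M 0, le_max_right _ _, fun x hx =>
    ((le_abs_self _).trans (hM x hx)).trans (le_max_left _ _)⟩

lemma continuousOn_rpow (h : IsNonnegSobolev U p v D) {β : ℝ} (hβ : 0 ≤ β) :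
    ContinuousOn (fun x => v x ^ β) (closure U) :=
  h.continuousOn.rpow_const fun _ _ => Or.inr hβ

lemma integrableOn_rpow (h : IsNonnegSobolev U p v D) (hUb : Bornology.IsBounded U) {β : ℝ}
    (hβ : 0 ≤ β) : IntegrableOn (fun x => v x ^ β) U :=
  ContinuousOn.integrableOn_of_closure hUb (h.continuousOn_rpow hβ)

lemma integrableOn_norm_rpow (h : IsNonnegSobolev U p v D) (hp : 0 < p) :
    IntegrableOn (fun x => ‖D x‖ ^ p) U := by
  have := h.memLp.integrable_norm_rpow (by simpa using hp) ENNReal.ofReal_ne_top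
  rwa [ENNReal.toReal_ofReal hp.le] at this

lemma integrableOn_grad (h : IsNonnegSobolev U p v D) (hUb : Bornology.IsBounded U)
    (hp : 1 ≤ p) : IntegrableOn D U := by
  have : IsFiniteMeasure (volume.restrict U) := ⟨by
    simpa using hUb.measure_lt_top⟩
  exact memLp_one_iff_integrable.1 (h.memLp.mono_exponent (by simpa using hp))

lemma integrableOn_rpow_mul (h : IsNonnegSobolev U p v D) (hU : IsOpen U)
    (hUb : Bornology.IsBounded U) {γ : ℝ} (hγ : 0 ≤ γ) {f : EuclideanSpace ℝ (Fin n) → ℝ}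
    (hf : IntegrableOn f U) : IntegrableOn (fun x => v x ^ γ * f x) U := by
  obtain ⟨M, hM0, hM⟩ := h.exists_bound hUb
  refine Integrable.bdd_mul (c := M ^ γ) hf
    (h.integrableOn_rpow hUb hγ).aestronglyMeasurable ?_
  filter_upwards [ae_restrict_mem hU.measurableSet] with x hx
  have h0 := h.nonneg x (subset_closure hx)
  rw [Real.norm_of_nonneg (Real.rpow_nonneg h0 _)]
  exact Real.rpow_le_rpow h0 (hM x (subset_closure hx)) hγ

lemma memLp_rpow_smul (h : IsNonnegSobolev U p v D) (hU : IsOpen U)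
    (hUb : Bornology.IsBounded U) {γ : ℝ} (hγ : 0 ≤ γ) (c : ℝ) :
    MemLp (fun x => (c * v x ^ γ) • D x) (ENNReal.ofReal p) (volume.restrict U) := by
  obtain ⟨M, hM0, hM⟩ := h.exists_bound hUb
  refine h.memLp.of_le_mul (c := |c| * M ^ γ) (AEStronglyMeasurable.smul
    ((h.integrableOn_rpow hUb hγ).aestronglyMeasurable.const_mul c) h.memLp.1) ?_
  filter_upwards [ae_restrict_mem hU.measurableSet] with x hx
  have h0 := h.nonneg x (subset_closure hx)
  rw [norm_smul, norm_mul, Real.norm_of_nonneg (Real.rpow_nonneg h0 _), Real.norm_eq_abs]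
  have := Real.rpow_le_rpow h0 (hM x (subset_closure hx)) hγ
  gcongr

lemma weakGrad_rpow (h : IsNonnegSobolev U p v D) (hU : IsOpen U)
    (hUb : Bornology.IsBounded U) (hp : 1 ≤ p) {β : ℝ} (hβ : 1 ≤ β) :
    IsWeakGrad U (fun x => v x ^ β) (fun x => (β * v x ^ (β - 1)) • D x) := by
  have h1 := h.weakGrad.comp_contDiff hU hUb h.continuousOn (h.integrableOn_grad hUb hp)
    (Ψ := fun s => s ^ β) (by
      simpa using Real.contDiff_rpow_const_of_le (n := 1) (by simpa using hβ))
  simpa only [Real.deriv_rpow_const] using h1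

lemma integral_rpow_nonneg (h : IsNonnegSobolev U p v D) (hU : IsOpen U) (β : ℝ) :
    0 ≤ ∫ x in U, v x ^ β := by
  refine integral_nonneg_of_ae ?_
  filter_upwards [h.ae_nonneg hU] with x hx
  exact Real.rpow_nonneg hx _

lemma integral_rpow_mul_norm_nonneg (h : IsNonnegSobolev U p v D) (hU : IsOpen U) (γ q : ℝ) :
    0 ≤ ∫ x in U, v x ^ γ * ‖D x‖ ^ q := by
  refine integral_nonneg_of_ae ?_
  filter_upwards [h.ae_nonneg hU] with x hx
  have := Real.rpow_nonneg hx γ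
  simp only [Pi.zero_apply]; positivity

lemma integrableOn_rpow_smul (h : IsNonnegSobolev U p v D) (hU : IsOpen U)
    (hUb : Bornology.IsBounded U) (hp : 1 ≤ p) {γ : ℝ} (hγ : 0 ≤ γ) (c : ℝ) :
    IntegrableOn (fun x => (c * v x ^ γ) • D x) U := by
  have h2 := h.memLp_rpow_smul hU hUb hγ c
  have : IsFiniteMeasure (volume.restrict U) := ⟨by simpa using hUb.measure_lt_top⟩
  exact memLp_one_iff_integrable.1 (h2.mono_exponent (by simpa using hp))

lemma lintegral_rpow (h : IsNonnegSobolev U p v D) (hU : IsOpen U)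
    (hUb : Bornology.IsBounded U) {β : ℝ} (hβ : 0 ≤ β) :
    ∫⁻ x in U, ‖v x ^ β‖ₑ = ENNReal.ofReal (∫ x in U, v x ^ β) := by
  rw [← ofReal_integral_norm_eq_lintegral_enorm (h.integrableOn_rpow hUb hβ)]
  congr 1
  refine integral_congr_ae ?_
  filter_upwards [h.ae_nonneg hU] with x hx
  exact Real.norm_of_nonneg (Real.rpow_nonneg hx _)

/-- The `W^{1,1}` norm of `v^β`. -/
lemma lintegral_rpow_add (h : IsNonnegSobolev U p v D) (hU : IsOpen U)
    (hUb : Bornology.IsBounded U) (hp : 1 ≤ p) {β : ℝ} (hβ : 1 ≤ β) :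
    (∫⁻ x in U, ‖v x ^ β‖ₑ) + ∫⁻ x in U, ‖(β * v x ^ (β - 1)) • D x‖ₑ =
      ENNReal.ofReal ((∫ x in U, v x ^ β) + β * ∫ x in U, v x ^ (β - 1) * ‖D x‖) := by
  have hβ0 : 0 ≤ β := by linarith
  have e2 : ∫⁻ x in U, ‖(β * v x ^ (β - 1)) • D x‖ₑ =
      ENNReal.ofReal (β * ∫ x in U, v x ^ (β - 1) * ‖D x‖) := by
    rw [← ofReal_integral_norm_eq_lintegral_enorm (f := fun x => (β * v x ^ (β - 1)) • D x)
      (h.integrableOn_rpow_smul hU hUb hp (by linarith) β), ← integral_const_mul]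
    congr 1
    refine integral_congr_ae ?_
    filter_upwards [h.ae_nonneg hU] with x hx
    rw [norm_smul, norm_mul, Real.norm_of_nonneg hβ0, Real.norm_of_nonneg (Real.rpow_nonneg hx _),
      mul_assoc]
  have p2 : 0 ≤ ∫ x in U, v x ^ (β - 1) * ‖D x‖ := by
    simpa using h.integral_rpow_mul_norm_nonneg hU (β - 1) 1
  rw [h.lintegral_rpow hU hUb hβ0, e2,
    ← ENNReal.ofReal_add (h.integral_rpow_nonneg hU β) (by positivity)]

end IsNonnegSobolev

lemma isWeakGrad_const {n : ℕ} {U : Set (EuclideanSpace ℝ (Fin n))} (hU : IsOpen U)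
    (hUb : Bornology.IsBounded U) (c : ℝ) : IsWeakGrad U (fun _ => c) fun _ => 0 := by
  have h0 : IsWeakGrad U (fun _ => (0 : ℝ)) fun _ => 0 := fun ψ _ _ _ e => by simp
  simpa using h0.comp_contDiff hU hUb continuousOn_const integrableOn_zero
    (Ψ := fun _ => c) contDiff_const

/-- The boundary has finite surface measure. -/
theorem surf_lt_top {n : ℕ} (hn : 1 ≤ n) {U : Set (EuclideanSpace ℝ (Fin n))}
    (hU : IsOpen U) (hUb : Bornology.IsBounded U) (hC1 : HasC1Boundary U) :
    IsFiniteMeasure (surf U) := by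
  obtain ⟨C, hC⟩ := exists_trace_const hn hU hUb hC1
  refine ⟨?_⟩
  have := hC (fun _ => 1) (fun _ => 0) continuousOn_const (isWeakGrad_const hU hUb 1)
    integrableOn_zero
  simp only [enorm_one, lintegral_const, one_mul, enorm_zero, zero_mul, add_zero,
    Measure.restrict_apply_univ] at this
  exact this.trans_lt (ENNReal.mul_lt_top ENNReal.coe_lt_top hUb.measure_lt_top)

lemma ContinuousOn.integrable_surf {n : ℕ} (hn : 1 ≤ n) {U : Set (EuclideanSpace ℝ (Fin n))}
    (hU : IsOpen U) (hUb : Bornology.IsBounded U) (hC1 : HasC1Boundary U)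
    {f : EuclideanSpace ℝ (Fin n) → ℝ} (hf : ContinuousOn f (frontier U)) :
    Integrable f (surf U) := by
  have := surf_lt_top hn hU hUb hC1
  have hK : IsCompact (frontier U) :=
    hUb.isCompact_closure.of_isClosed_subset isClosed_frontier frontier_subset_closure
  obtain ⟨M, hM⟩ := hK.exists_bound_of_continuousOn hf
  refine Integrable.of_bound (hf.aestronglyMeasurable isClosed_frontier.measurableSet) M ?_
  filter_upwards [ae_restrict_mem isClosed_frontier.measurableSet] with x hx
  exact hM x hx

/-- Trace inequality for powers. -/
theorem exists_trace_rpow {n : ℕ} (hn : 1 ≤ n) {U : Set (EuclideanSpace ℝ (Fin n))}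
    (hU : IsOpen U) (hUb : Bornology.IsBounded U) (hC1 : HasC1Boundary U) {p : ℝ} (hp : 1 ≤ p) :
    ∃ C : ℝ, 0 ≤ C ∧ ∀ v D, IsNonnegSobolev U p v D → ∀ β : ℝ, 1 ≤ β →
      ∫ x, v x ^ β ∂(surf U) ≤
        C * ((∫ x in U, v x ^ β) + β * ∫ x in U, v x ^ (β - 1) * ‖D x‖) := by
  obtain ⟨C, hC⟩ := exists_trace_const hn hU hUb hC1
  refine ⟨C, C.2, fun v D h β hβ => ?_⟩
  have hβ0 : 0 ≤ β := by linarith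
  have h1 := hC _ _ (h.continuousOn_rpow hβ0) (h.weakGrad_rpow hU hUb hp hβ)
    (h.integrableOn_rpow_smul hU hUb hp (by linarith) β)
  have p0 : 0 ≤ (∫ x in U, v x ^ β) + β * ∫ x in U, v x ^ (β - 1) * ‖D x‖ := by
    have := h.integral_rpow_mul_norm_nonneg hU (β - 1) 1
    simp only [Real.rpow_one] at this
    have := h.integral_rpow_nonneg hU β
    positivity
  have hs := ContinuousOn.integrable_surf hn hU hUb hC1
    ((h.continuousOn_rpow hβ0).mono frontier_subset_closure)
  have e3 : ∫⁻ x, ‖v x ^ β‖ₑ ∂(surf U) = ENNReal.ofReal (∫ x, v x ^ β ∂(surf U)) := by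
    rw [← ofReal_integral_norm_eq_lintegral_enorm hs]
    congr 1
    refine integral_congr_ae ?_
    filter_upwards [ae_restrict_mem isClosed_frontier.measurableSet] with x hx
    exact Real.norm_of_nonneg (Real.rpow_nonneg (h.nonneg x (frontier_subset_closure hx)) _)
  rw [h.lintegral_rpow_add hU hUb hp hβ, e3, ← ENNReal.ofReal_coe_nnreal,
    ← ENNReal.ofReal_mul C.coe_nonneg,
    ENNReal.ofReal_le_ofReal_iff (mul_nonneg C.coe_nonneg p0)] at h1
  exact h1

/-- Sobolev inequality for powers. -/
theorem exists_sobolev_rpow {n : ℕ} (hn : 2 ≤ n) {U : Set (EuclideanSpace ℝ (Fin n))}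
    (hU : IsOpen U) (hUb : Bornology.IsBounded U) (hC1 : HasC1Boundary U) {p : ℝ} (hp : 1 ≤ p) :
    ∃ C : ℝ, 0 ≤ C ∧ ∀ v D, IsNonnegSobolev U p v D → ∀ β : ℝ, 1 ≤ β →
      ∫ x in U, v x ^ (β * ((n : ℝ) / (n - 1))) ≤
        C * ((∫ x in U, v x ^ β) + β * ∫ x in U, v x ^ (β - 1) * ‖D x‖) ^ ((n : ℝ) / (n - 1)) := by
  obtain ⟨C, hC⟩ := exists_sobolev_const hn hU hUb hC1
  refine ⟨C, C.2, fun v D h β hβ => ?_⟩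
  have hβ0 : 0 ≤ β := by linarith
  have hn1 : (0 : ℝ) < n - 1 := by
    have : (2 : ℝ) ≤ n := by exact_mod_cast hn
    linarith
  have hq0 : (0 : ℝ) ≤ (n : ℝ) / (n - 1) := by positivity
  have h1 := hC _ _ (h.continuousOn_rpow hβ0) (h.weakGrad_rpow hU hUb hp hβ)
    (h.integrableOn_rpow_smul hU hUb hp (by linarith) β)
  have p0 : 0 ≤ (∫ x in U, v x ^ β) + β * ∫ x in U, v x ^ (β - 1) * ‖D x‖ := by
    have := h.integral_rpow_mul_norm_nonneg hU (β - 1) 1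
    simp only [Real.rpow_one] at this
    have := h.integral_rpow_nonneg hU β
    positivity
  have hs := h.integrableOn_rpow hUb (β := β * ((n : ℝ) / (n - 1))) (by positivity)
  have e3 : ∫⁻ x in U, ‖v x ^ β‖ₑ ^ ((n : ℝ) / (n - 1)) =
      ENNReal.ofReal (∫ x in U, v x ^ (β * ((n : ℝ) / (n - 1)))) := by
    rw [ofReal_integral_eq_lintegral_ofReal hs (by
      filter_upwards [h.ae_nonneg hU] with x hx
      exact Real.rpow_nonneg hx _)]
    refine lintegral_congr_ae ?_
    filter_upwards [h.ae_nonneg hU] with x hx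
    rw [← ofReal_norm, Real.norm_of_nonneg (Real.rpow_nonneg hx _),
      ENNReal.ofReal_rpow_of_nonneg (Real.rpow_nonneg hx _) hq0, ← Real.rpow_mul hx]
  rw [h.lintegral_rpow_add hU hUb hp hβ, e3, ← ENNReal.ofReal_coe_nnreal,
    ENNReal.ofReal_rpow_of_nonneg p0 hq0, ← ENNReal.ofReal_mul C.coe_nonneg,
    ENNReal.ofReal_le_ofReal_iff (mul_nonneg C.coe_nonneg (Real.rpow_nonneg p0 _))] at h1
  exact h1

/-! ### Interpolation -/

/-- Weighted Young inequality with a small parameter. -/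
lemma rpow_mul_rpow_le_add {x y ε θ : ℝ} (hx : 0 ≤ x) (hy : 0 ≤ y) (hε : 0 < ε) (hθ0 : 0 ≤ θ)
    (hθ1 : θ < 1) :
    x ^ θ * y ≤ ε * x + ε ^ (-(θ / (1 - θ))) * y ^ (1 / (1 - θ)) := by
  have h1 : 0 < 1 - θ := by linarith
  set z := ε ^ (-(θ / (1 - θ))) * y ^ (1 / (1 - θ)) with hz
  have hz0 : 0 ≤ z := by positivity
  have h := Real.geom_mean_le_arith_mean2_weighted hθ0 h1.le (by positivity : 0 ≤ ε * x) hz0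
    (by ring)
  have hzp : z ^ (1 - θ) = ε ^ (-θ) * y := by
    rw [hz, Real.mul_rpow (by positivity) (by positivity), ← Real.rpow_mul hε.le,
      ← Real.rpow_mul hy, one_div_mul_cancel h1.ne', Real.rpow_one]
    congr 2
    field_simp
  rw [hzp, Real.mul_rpow hε.le hx, Real.rpow_neg hε.le] at h
  have h2 : ε ^ θ * x ^ θ * ((ε ^ θ)⁻¹ * y) = x ^ θ * y := by
    have : ε ^ θ ≠ 0 := (Real.rpow_pos_of_pos hε θ).ne'
    field_simp
  rw [h2] at h
  have h3 : θ * (ε * x) ≤ ε * x := mul_le_of_le_one_left (by positivity) hθ1.le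
  have h4 : (1 - θ) * z ≤ z := mul_le_of_le_one_left hz0 (by linarith)
  linarith

/-- Young's inequality for the integrand that arises from the trace inequality. -/
lemma exists_young_trace {p d β ε : ℝ} (hp : 1 < p) (hβ : d + p ≤ β) (hβd : 0 ≤ β + d / (p - 1))
    (hε : 0 < ε) :
    ∃ C : ℝ, 0 ≤ C ∧ ∀ b x y : ℝ, 0 ≤ b → 0 ≤ x → 0 ≤ y →
      b * (x ^ (β - 1) * y) ≤ ε * (x ^ (β - (d + p)) * y ^ p) +
        C * (b ^ (p / (p - 1)) * x ^ (β + d / (p - 1))) := by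
  have hp1 : 0 < p - 1 := by linarith
  have hip : 1 / p < 1 := by rw [div_lt_one (by linarith)]; exact hp
  refine ⟨ε ^ (-(1 / p / (1 - 1 / p))), by positivity, fun b x y hb hx hy => ?_⟩
  have h := rpow_mul_rpow_le_add (x := x ^ (β - (d + p)) * y ^ p)
    (y := b * x ^ ((β + d / (p - 1)) * ((p - 1) / p))) (θ := 1 / p)
    (by positivity) (by positivity) hε (by positivity) hip
  have e1 : 1 / (1 - 1 / p) = p / (p - 1) := by field_simp
  have e2 : (x ^ (β - (d + p)) * y ^ p) ^ (1 / p) = x ^ ((β - (d + p)) / p) * y := by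
    rw [Real.mul_rpow (by positivity) (by positivity), ← Real.rpow_mul hx, ← Real.rpow_mul hy,
      mul_one_div_cancel (by positivity), Real.rpow_one, mul_one_div]
  have e3 : (b * x ^ ((β + d / (p - 1)) * ((p - 1) / p))) ^ (p / (p - 1)) =
      b ^ (p / (p - 1)) * x ^ (β + d / (p - 1)) := by
    rw [Real.mul_rpow hb (by positivity), ← Real.rpow_mul hx]
    congr 2
    field_simp
  have e4 : x ^ ((β - (d + p)) / p) * x ^ ((β + d / (p - 1)) * ((p - 1) / p)) = x ^ (β - 1) := by
    rw [← Real.rpow_add_of_nonneg hx (div_nonneg (by linarith) (by linarith))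
      (mul_nonneg hβd (by positivity))]
    congr 1
    field_simp
    ring
  rw [e2, e1, e3] at h
  refine le_trans (le_of_eq ?_) h
  rw [← e4]; ring

lemma rpow_le_one_add_rpow {x β β' : ℝ} (hx : 0 ≤ x) (hβ : 0 ≤ β) (h : β ≤ β') :
    x ^ β ≤ 1 + x ^ β' := by
  rcases le_total x 1 with h1 | h1
  · have := Real.rpow_le_one hx h1 hβ
    have := Real.rpow_nonneg hx β'
    linarith
  · have := Real.rpow_le_rpow_of_exponent_le h1 h
    linarith

namespace IsNonnegSobolev

variable {n : ℕ} {U : Set (EuclideanSpace ℝ (Fin n))} {p : ℝ} {v : EuclideanSpace ℝ (Fin n) → ℝ}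
    {D : EuclideanSpace ℝ (Fin n) → EuclideanSpace ℝ (Fin n)}

lemma integral_rpow_le (h : IsNonnegSobolev U p v D) (hU : IsOpen U)
    (hUb : Bornology.IsBounded U) {β β' : ℝ} (hβ : 0 ≤ β) (hβ' : β ≤ β') :
    ∫ x in U, v x ^ β ≤ volume.real U + ∫ x in U, v x ^ β' := by
  have : IsFiniteMeasure (volume.restrict U) := ⟨by simpa using hUb.measure_lt_top⟩
  have h1 : ∫ x in U, (1 + v x ^ β') = volume.real U + ∫ x in U, v x ^ β' := by
    rw [integral_add (integrable_const _) (h.integrableOn_rpow hUb (hβ.trans hβ'))]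
    simp
  rw [← h1]
  refine integral_mono_ae (h.integrableOn_rpow hUb hβ)
    ((integrable_const _).add (h.integrableOn_rpow hUb (hβ.trans hβ'))) ?_
  filter_upwards [h.ae_nonneg hU] with x hx
  exact rpow_le_one_add_rpow hx hβ hβ'

lemma integrableOn_rpow_mul_norm_rpow (h : IsNonnegSobolev U p v D) (hU : IsOpen U)
    (hUb : Bornology.IsBounded U) (hp : 0 < p) {γ : ℝ} (hγ : 0 ≤ γ) :
    IntegrableOn (fun x => v x ^ γ * ‖D x‖ ^ p) U :=
  h.integrableOn_rpow_mul hU hUb hγ (h.integrableOn_norm_rpow hp)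

end IsNonnegSobolev

/-- Weighted Sobolev inequality: apply the `W^{1,1}` inequality to a power of `v`, and absorb. -/
theorem exists_weighted_sobolev {n : ℕ} (hn : 2 ≤ n) {U : Set (EuclideanSpace ℝ (Fin n))}
    (hU : IsOpen U) (hUb : Bornology.IsBounded U) (hC1 : HasC1Boundary U) {p e : ℝ} (hp : 1 < p)
    (hpn : p < n) (he : p ≤ e) :
    ∃ C : ℝ, 0 ≤ C ∧ ∀ v D, IsNonnegSobolev U p v D →
      ∫ x in U, v x ^ (n * e / (n - p)) ≤
        C * ((∫ x in U, v x ^ (e - p) * ‖D x‖ ^ p) + ∫ x in U, v x ^ e) ^ (n / (n - p)) := by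
  obtain ⟨C₀, hC₀, hS⟩ := exists_sobolev_rpow hn hU hUb hC1 hp.le
  have hN1 : (1 : ℝ) < n := by linarith
  set N : ℝ := (n : ℝ) with hN
  have hNp : 0 < N - p := by linarith
  have hN1' : 0 < N - 1 := by linarith
  have hp0 : 0 < p := by linarith
  have he0 : 0 < e := by linarith
  set r := (N - 1) * e / (N - p) with hr
  set Q := N * e / (N - p) with hQ
  have hQ0 : 0 ≤ Q := by positivity
  have hr1 : 1 ≤ r := by
    rw [hr, le_div_iff₀ hNp]; nlinarith
  have hrQ : r * (N / (N - 1)) = Q := by rw [hr, hQ]; field_simp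
  have ip0 : 0 ≤ 1 / p := by positivity
  have ip1 : 0 ≤ 1 - 1 / p := by
    rw [sub_nonneg, div_le_one hp0]; exact hp.le
  set m := (1 - 1 / p) * (N / (N - 1)) with hm
  have hm1 : 1 - m = (N - p) / (p * (N - 1)) := by rw [hm]; field_simp; ring
  have hm1' : 0 < 1 - m := by rw [hm1]; positivity
  set C₁ := C₀ * (1 + r) ^ (N / (N - 1)) with hC₁
  have hC₁0 : 0 ≤ C₁ := by positivity
  refine ⟨C₁ ^ (1 / (1 - m)), by positivity, fun v D h => ?_⟩
  set I := ∫ x in U, v x ^ Q with hI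
  set X := ∫ x in U, v x ^ (e - p) * ‖D x‖ ^ p with hX
  set Z := ∫ x in U, v x ^ e with hZ
  have hI0 : 0 ≤ I := h.integral_rpow_nonneg hU Q
  have hZ0 : 0 ≤ Z := h.integral_rpow_nonneg hU e
  have hX0 : 0 ≤ X := h.integral_rpow_mul_norm_nonneg hU (e - p) p
  -- the absorption divides by a power of `I`
  rcases hI0.eq_or_lt with hIz | hIpos
  · rw [← hIz]; positivity
  have hexp : e / p + Q * (1 - 1 / p) = r := by rw [hr, hQ]; field_simp; ring
  -- Hölder, with the power of `v` split as `r = e / p + Q (1 - 1 / p)`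
  have h2 : ∫ x in U, v x ^ r ≤ Z ^ (1 / p) * I ^ (1 - 1 / p) := by
    refine le_trans (le_of_eq ?_) (integral_rpow_mul_rpow_le (h.integrableOn_rpow hUb he0.le)
      (h.integrableOn_rpow hUb hQ0) ?_ ?_ ip0 ip1 (by ring))
    · refine integral_congr_ae ?_
      filter_upwards [h.ae_nonneg hU] with x hx
      rw [← Real.rpow_mul hx, ← Real.rpow_mul hx, ← Real.rpow_add_of_nonneg hx (by positivity)
        (by positivity), mul_one_div, hexp]
    · filter_upwards [h.ae_nonneg hU] with x hx
      exact Real.rpow_nonneg hx _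
    · filter_upwards [h.ae_nonneg hU] with x hx
      exact Real.rpow_nonneg hx _
  have h3 : ∫ x in U, v x ^ (r - 1) * ‖D x‖ ≤ X ^ (1 / p) * I ^ (1 - 1 / p) := by
    refine le_trans (le_of_eq ?_) (integral_rpow_mul_rpow_le
      (h.integrableOn_rpow_mul_norm_rpow hU hUb hp0 (by linarith : 0 ≤ e - p))
      (h.integrableOn_rpow hUb hQ0) ?_ ?_ ip0 ip1 (by ring))
    · refine integral_congr_ae ?_
      filter_upwards [h.ae_nonneg hU] with x hx
      rw [Real.mul_rpow (Real.rpow_nonneg hx _) (by positivity), ← Real.rpow_mul hx,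
        ← Real.rpow_mul hx, ← Real.rpow_mul (norm_nonneg _), mul_one_div_cancel hp0.ne',
        Real.rpow_one]
      have : v x ^ (r - 1) = v x ^ ((e - p) * (1 / p)) * v x ^ (Q * (1 - 1 / p)) := by
        rw [← Real.rpow_add_of_nonneg hx (mul_nonneg (by linarith) ip0) (by positivity), ← hexp]
        congr 1
        field_simp
        ring
      rw [this]; ring
    · filter_upwards [h.ae_nonneg hU] with x hx
      have := Real.rpow_nonneg hx (e - p)
      simp only [Pi.zero_apply]; positivity
    · filter_upwards [h.ae_nonneg hU] with x hx
      exact Real.rpow_nonneg hx _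
  have h4 : (∫ x in U, v x ^ r) + r * ∫ x in U, v x ^ (r - 1) * ‖D x‖ ≤
      (1 + r) * ((X + Z) ^ (1 / p) * I ^ (1 - 1 / p)) := by
    have hZ' : Z ^ (1 / p) ≤ (X + Z) ^ (1 / p) := Real.rpow_le_rpow hZ0 (by linarith) ip0
    have hX' : X ^ (1 / p) ≤ (X + Z) ^ (1 / p) := Real.rpow_le_rpow hX0 (by linarith) ip0
    have hI' : 0 ≤ I ^ (1 - 1 / p) := by positivity
    rw [add_mul, one_mul]
    refine add_le_add (h2.trans (mul_le_mul_of_nonneg_right hZ' hI')) ?_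
    exact mul_le_mul_of_nonneg_left (h3.trans (mul_le_mul_of_nonneg_right hX' hI')) (by linarith)
  have p4 : 0 ≤ (∫ x in U, v x ^ r) + r * ∫ x in U, v x ^ (r - 1) * ‖D x‖ := by
    have := h.integral_rpow_mul_norm_nonneg hU (r - 1) 1
    simp only [Real.rpow_one] at this
    have := h.integral_rpow_nonneg hU r
    positivity
  -- the power `m < 1` of `I` on the right is absorbed on the left
  have h5 : I ≤ C₁ * (X + Z) ^ (1 / p * (N / (N - 1))) * I ^ m := by
    have h1 := hS v D h r hr1
    rw [hrQ] at h1
    refine h1.trans ?_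
    rw [hC₁, mul_assoc, mul_assoc]
    refine mul_le_mul_of_nonneg_left ?_ hC₀
    refine (Real.rpow_le_rpow p4 h4 (by positivity)).trans_eq ?_
    rw [Real.mul_rpow (by positivity) (by positivity), Real.mul_rpow (by positivity)
      (by positivity), ← Real.rpow_mul (by positivity), ← Real.rpow_mul hI0]
  have h6 : I ^ (1 - m) ≤ C₁ * (X + Z) ^ (1 / p * (N / (N - 1))) := by
    rw [Real.rpow_sub hIpos, Real.rpow_one, div_le_iff₀ (Real.rpow_pos_of_pos hIpos m)]
    exact h5
  have h7 := Real.rpow_le_rpow (by positivity) h6 (by positivity : 0 ≤ 1 / (1 - m))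
  rw [← Real.rpow_mul hI0, mul_one_div_cancel hm1'.ne', Real.rpow_one,
    Real.mul_rpow hC₁0 (by positivity), ← Real.rpow_mul (by positivity)] at h7
  have h8 : 1 / p * (N / (N - 1)) * (1 / (1 - m)) = N / (N - p) := by
    rw [hm1]; field_simp
  rwa [h8] at h7

/-- Interpolation between the natural energy and `∫ v^α`: the higher power `α + d / (p - 1)` is
absorbed by the energy at the cost of a superlinear power of `∫ v^α`. The lower bound
`n d / (p - 1) < α` makes `θ < 1`. -/
theorem exists_interpolation {n : ℕ} (hn : 2 ≤ n) {U : Set (EuclideanSpace ℝ (Fin n))}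
    (hU : IsOpen U) (hUb : Bornology.IsBounded U) (hC1 : HasC1Boundary U) {p d α θ κ ε : ℝ}
    (hp : 1 < p) (hpn : p < n) (hd : 0 < d) (hαd : d + p ≤ α) (hα : n * d / (p - 1) < α)
    (hθ : θ = n * d / ((p - 1) * (α * p - n * d)))
    (hκ : κ = 1 + d / (p - 1) * (1 + θ * (p - 1)) / (1 - θ) / α) (hε : 0 < ε) :
    ∃ C : ℝ, 0 ≤ C ∧ ∀ v D, IsNonnegSobolev U p v D → ∀ b : ℝ, 0 ≤ b →
      b * ∫ x in U, v x ^ (α + d / (p - 1)) ≤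
        ε * (∫ x in U, v x ^ (α - (d + p)) * ‖D x‖ ^ p) +
          C * ((1 + b ^ (1 / (1 - θ))) * (1 + ∫ x in U, v x ^ α) ^ κ) := by
  obtain ⟨C₀, hC₀, hS⟩ := exists_weighted_sobolev hn hU hUb hC1 (e := α - d) hp hpn (by linarith)
  have hp0 : 0 < p := by linarith
  have hp1 : 0 < p - 1 := by linarith
  set N : ℝ := (n : ℝ) with hN
  have hN0 : 0 < N := by linarith
  have hNp : 0 < N - p := by linarith
  have hα0 : 0 < α := by linarith
  rw [div_lt_iff₀ hp1] at hα
  have hden : 0 < α * p - N * d := by nlinarith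
  have hθ0 : 0 < θ := by rw [hθ]; positivity
  have hθ1 : θ < 1 := by
    rw [hθ, div_lt_one (by positivity)]
    nlinarith [mul_pos hp1 hα0]
  have hθ1' : 0 < 1 - θ := by linarith
  set μ := d / (p - 1) with hμ
  have hμ0 : 0 < μ := by positivity
  set Q := N * (α - d) / (N - p) with hQ
  have hQ0 : 0 ≤ Q := div_nonneg (mul_nonneg hN0.le (by linarith)) hNp.le
  set s := θ * (N - p) / N with hs
  have hs0 : 0 < s := by positivity
  have hs1 : s < 1 := by
    rw [hs, div_lt_one hN0]; nlinarith
  have hθeq : θ * ((p - 1) * (α * p - N * d)) = N * d := by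
    rw [hθ, div_mul_cancel₀ _ (mul_pos hp1 hden).ne']
  -- the power `α + μ` is interpolated between `Q` and `α` with weight `s`
  have hsQ : Q * s + α * (1 - s) = α + μ := by
    have e1 : Q * s = θ * (α - d) := by rw [hQ, hs]; field_simp
    have e2 : α * s = α * (θ * (N - p) / N) := by rw [hs]
    have e3 : μ = θ * (α * p - N * d) / N := by
      rw [hμ]; field_simp; linarith
    rw [mul_sub, e1, e2, e3]; field_simp; ring
  have hκ' : (1 - s) / (1 - θ) = κ := by
    have e1 : α * (1 - s) = α + μ - θ * (α - d) := by
      have : Q * s = θ * (α - d) := by rw [hQ, hs]; field_simp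
      linarith
    have e2 : μ * (p - 1) = d := by rw [hμ]; field_simp
    have e3 : 1 - s = (α + μ - θ * (α - d)) / α := by
      field_simp; linarith
    have e4 : μ * (1 + θ * (p - 1)) = μ + θ * d := by rw [← e2]; ring
    rw [hκ, e3, e4]
    field_simp
    ring
  have hκ1 : 1 ≤ κ := by
    rw [hκ]
    have : 0 ≤ μ * (1 + θ * (p - 1)) / (1 - θ) / α := by positivity
    linarith
  set m := volume.real U with hm
  have hm0 : 0 ≤ m := measureReal_nonneg
  set A := ε ^ (-(θ / (1 - θ))) * (C₀ ^ s) ^ (1 / (1 - θ)) with hA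
  have hA0 : 0 ≤ A := by positivity
  refine ⟨A + ε * (m + 1), by positivity, fun v D h b hb => ?_⟩
  set I := ∫ x in U, v x ^ Q with hI
  set X := ∫ x in U, v x ^ (α - (d + p)) * ‖D x‖ ^ p with hX
  set Y := ∫ x in U, v x ^ α with hY
  set Z := ∫ x in U, v x ^ (α - d) with hZ
  have hI0 : 0 ≤ I := h.integral_rpow_nonneg hU Q
  have hZ0 : 0 ≤ Z := h.integral_rpow_nonneg hU _
  have hY0 : 0 ≤ Y := h.integral_rpow_nonneg hU _
  have hX0 : 0 ≤ X := h.integral_rpow_mul_norm_nonneg hU _ _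
  have hIS : I ≤ C₀ * (X + Z) ^ (N / (N - p)) := by
    have := hS v D h
    rwa [show α - d - p = α - (d + p) by ring] at this
  have hZY : Z ≤ (m + 1) * (1 + Y) := by
    have := h.integral_rpow_le hU hUb (β := α - d) (β' := α) (by linarith) (by linarith)
    nlinarith
  have h1Y : 1 + Y ≤ (1 + Y) ^ κ := Real.self_le_rpow_of_one_le (by linarith) hκ1
  have h1 : ∫ x in U, v x ^ (α + μ) ≤ I ^ s * Y ^ (1 - s) := by
    refine le_trans (le_of_eq ?_) (integral_rpow_mul_rpow_le (h.integrableOn_rpow hUb hQ0)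
      (h.integrableOn_rpow hUb hα0.le) ?_ ?_ hs0.le (by linarith : 0 ≤ 1 - s) (by ring))
    · refine integral_congr_ae ?_
      filter_upwards [h.ae_nonneg hU] with x hx
      rw [← Real.rpow_mul hx, ← Real.rpow_mul hx, ← Real.rpow_add_of_nonneg hx (by positivity)
        (mul_nonneg hα0.le (by linarith)), hsQ]
    · filter_upwards [h.ae_nonneg hU] with x hx
      exact Real.rpow_nonneg hx _
    · filter_upwards [h.ae_nonneg hU] with x hx
      exact Real.rpow_nonneg hx _
  have h2 : I ^ s ≤ C₀ ^ s * (X + Z) ^ θ := by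
    refine (Real.rpow_le_rpow hI0 hIS hs0.le).trans_eq ?_
    rw [Real.mul_rpow hC₀ (by positivity), ← Real.rpow_mul (by positivity)]
    congr 2
    rw [hs]; field_simp
  have hY' : 0 ≤ Y ^ (1 - s) := by positivity
  have h3 := rpow_mul_rpow_le_add (x := X + Z) (y := b * (C₀ ^ s * Y ^ (1 - s))) (by positivity)
    (by positivity) hε hθ0.le hθ1
  have h4 : (b * (C₀ ^ s * Y ^ (1 - s))) ^ (1 / (1 - θ)) =
      b ^ (1 / (1 - θ)) * ((C₀ ^ s) ^ (1 / (1 - θ)) * Y ^ κ) := by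
    rw [Real.mul_rpow hb (by positivity), Real.mul_rpow (by positivity) hY',
      ← Real.rpow_mul hY0 (1 - s), mul_one_div, hκ']
  rw [h4] at h3
  have hYκ : Y ^ κ ≤ (1 + Y) ^ κ := Real.rpow_le_rpow hY0 (by linarith) (by linarith)
  have hbθ : 0 ≤ b ^ (1 / (1 - θ)) := by positivity
  have h5 : b * ∫ x in U, v x ^ (α + μ) ≤ (X + Z) ^ θ * (b * (C₀ ^ s * Y ^ (1 - s))) := by
    refine (mul_le_mul_of_nonneg_left (h1.trans (mul_le_mul_of_nonneg_right h2 hY')) hb).trans_eq ?_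
    ring
  refine (h5.trans h3).trans ?_
  have hPκ : (0 : ℝ) ≤ (1 + Y) ^ κ := by positivity
  clear_value I X Y Z A
  generalize b ^ (1 / (1 - θ)) = B at *
  generalize (1 + Y) ^ κ = R at *
  generalize Y ^ κ = R' at *
  have h6 : A * (B * R') ≤ A * ((1 + B) * R) := by
    refine mul_le_mul_of_nonneg_left ?_ hA0
    have := mul_le_mul_of_nonneg_left hYκ hbθ
    linarith
  have h7 : ε * Z ≤ ε * ((m + 1) * ((1 + B) * R)) := by
    refine mul_le_mul_of_nonneg_left (hZY.trans ?_) hε.le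
    refine mul_le_mul_of_nonneg_left ?_ (by linarith)
    have := mul_nonneg hbθ hPκ
    linarith
  have h8 : ε ^ (-(θ / (1 - θ))) * (B * ((C₀ ^ s) ^ (1 / (1 - θ)) * R')) = A * (B * R') := by
    rw [hA]; ring
  rw [h8]
  linarith

/-! ### The moment inequality at a fixed time -/

lemma rpow_sub_one_mul_le {x y p : ℝ} (hx : 0 ≤ x) (hy : 0 ≤ y) (hp : 1 < p) :
    x ^ (p - 1) * y ≤ x ^ p + y ^ p := by
  have hsum : ∀ z : ℝ, 0 ≤ z → z ^ (p - 1) * z = z ^ p := fun z hz => by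
    rw [← Real.rpow_add_one' hz (by linarith)]; congr 1; ring
  have hxp : 0 ≤ x ^ p := by positivity
  have hyp : 0 ≤ y ^ p := by positivity
  rcases le_total x y with h | h
  · have := mul_le_mul_of_nonneg_right (Real.rpow_le_rpow hx h (by linarith : 0 ≤ p - 1)) hy
    rw [hsum y hy] at this
    linarith
  · have := mul_le_mul_of_nonneg_left h (Real.rpow_nonneg hx (p - 1))
    rw [hsum x hx] at this
    linarith

lemma one_add_rpow_le {x q : ℝ} (hx : 0 ≤ x) (hq : 0 ≤ q) :
    (1 + x) ^ q ≤ 2 ^ q * (1 + x ^ q) := by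
  rw [mul_add, mul_one, ← Real.mul_rpow (by norm_num) hx]
  have h2 : (0 : ℝ) ≤ 2 ^ q := by positivity
  have h3 : (0 : ℝ) ≤ (2 * x) ^ q := by positivity
  rcases le_total x 1 with h | h
  · have := Real.rpow_le_rpow (by linarith) (by linarith : 1 + x ≤ 2) hq
    linarith
  · have := Real.rpow_le_rpow (by linarith) (by linarith : 1 + x ≤ 2 * x) hq
    linarith

section exponents

variable {n : ℕ} {a lam α : ℝ}

lemma theta_eq (hn : 2 ≤ n) (ha1 : a < 1) (had : 1 - lam < a) :
    theta n a lam α = n * (a - (1 - lam)) /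
      ((2 - a - 1) * (α * (2 - a) - n * (a - (1 - lam)))) := by
  have hn0 : (0 : ℝ) < n := by exact_mod_cast (by omega : 0 < n)
  have hd : 0 < a - (1 - lam) := by linarith
  have hp : 0 < 2 - a := by linarith
  have h1a : 0 < 1 - a := by linarith
  rw [theta, alphaStar]
  have e : (1 - a) * (α / (n * (a - (1 - lam)) / (2 - a)) - 1) =
      (2 - a - 1) * (α * (2 - a) - n * (a - (1 - lam))) / (n * (a - (1 - lam))) := by
    field_simp
    ring
  rw [e, one_div_div]

lemma theta_mem (hn : 2 ≤ n) (ha1 : a < 1) (had : 1 - lam < a) (hα : n * mu0 a lam < α) :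
    theta n a lam α ∈ Ioo 0 1 := by
  have hn0 : (0 : ℝ) < n := by exact_mod_cast (by omega : 0 < n)
  have hd : 0 < a - (1 - lam) := by linarith
  have h1a : 0 < 1 - a := by linarith
  rw [mu0, ← mul_div_assoc, div_lt_iff₀ h1a] at hα
  have hα0 : 0 < α := by
    by_contra hcon
    have : 0 < n * (a - (1 - lam)) := by positivity
    nlinarith
  have hden : 0 < α * (2 - a) - n * (a - (1 - lam)) := by nlinarith
  rw [theta_eq hn ha1 had]
  have h2a : 0 < 2 - a - 1 := by linarith
  refine ⟨by positivity, ?_⟩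
  rw [div_lt_one (by positivity)]
  nlinarith [mul_pos h1a hα0]

lemma one_le_phiExp (hn : 2 ≤ n) (ha1 : a < 1) (had : 1 - lam < a) (hα : n * mu0 a lam < α) :
    1 ≤ phiExp n a lam α := by
  obtain ⟨h0, h1⟩ := theta_mem hn ha1 had hα
  rw [phiExp, one_le_div (mul_pos (by linarith) (by linarith))]
  nlinarith

lemma mu0_pos (ha1 : a < 1) (had : 1 - lam < a) : 0 < mu0 a lam :=
  div_pos (by linarith) (by linarith)

lemma mu1_pos (hn : 2 ≤ n) (ha1 : a < 1) (had : 1 - lam < a) (hα : n * mu0 a lam < α) :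
    0 < mu1 n a lam α := by
  obtain ⟨h0, h1⟩ := theta_mem hn ha1 had hα
  have := mu0_pos ha1 had
  have : 0 < 1 - a := by linarith
  have : 0 < 1 - theta n a lam α := by linarith
  rw [mu1]; positivity

end exponents

lemma memLp_integrable_rpow {X E : Type*} [MeasurableSpace X] {μ : Measure X}
    [NormedAddCommGroup E] {D : X → E} {p : ℝ} (hp : 0 < p) (hD : MemLp D (ENNReal.ofReal p) μ) :
    Integrable (fun x => ‖D x‖ ^ p) μ := by
  have := hD.integrable_norm_rpow (by simpa using hp) ENNReal.ofReal_ne_top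
  rwa [ENNReal.toReal_ofReal hp.le] at this

section flux

variable {X E : Type*} [MeasurableSpace X] {μ : Measure X} [NormedAddCommGroup E]
  [MeasurableSpace E] [OpensMeasurableSpace E] (P : GenPoly)

lemma aestronglyMeasurable_root {D : X → E} (hD : AEMeasurable D μ) :
    AEStronglyMeasurable (fun x => P.root ‖D x‖) μ := by
  have h : (fun x => P.root ‖D x‖) = fun x => (fun ξ : ℝ => P.root (max ξ 0)) ‖D x‖ := by
    funext x
    simp only [max_eq_left (norm_nonneg (D x))]
  rw [h]
  exact (P.measurable_root_max.comp_aemeasurable hD.norm).aestronglyMeasurable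

lemma integrable_root_mul_norm [BorelSpace E] {D F : X → E}
    (hD : MemLp D (ENNReal.ofReal (2 - P.a)) μ) (hF : MemLp F (ENNReal.ofReal (2 - P.a)) μ) :
    Integrable (fun x => P.root ‖D x‖ * ‖F x‖) μ := by
  obtain ⟨C, hC, hroot⟩ := P.exists_root_le
  have ha := P.a_lt_one
  refine (((memLp_integrable_rpow (by linarith) hD).add
    (memLp_integrable_rpow (by linarith) hF)).const_mul C).mono'
    ((aestronglyMeasurable_root P hD.1.aemeasurable).mul hF.1.norm) (ae_of_all _ fun x => ?_)
  rw [Real.norm_of_nonneg (mul_nonneg (P.root_nonneg (norm_nonneg _)) (norm_nonneg _))]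
  have h1 := rpow_sub_one_mul_le (norm_nonneg (D x)) (norm_nonneg (F x))
    (by linarith : 1 < 2 - P.a)
  rw [show 2 - P.a - 1 = 1 - P.a by ring] at h1
  have h2 := mul_le_mul_of_nonneg_right (hroot ‖D x‖ (norm_nonneg _)) (norm_nonneg (F x))
  have h3 := mul_le_mul_of_nonneg_left h1 hC.le
  simp only [Pi.add_apply]
  linarith

end flux

set_option maxHeartbeats 800000 in
/-- The basic inequality at a fixed time: testing the equation with `v^(α - lam)` and absorbing the
boundary term into the dissipation bounds the derivative `w₀` of `∫ v^α` by a superlinear power of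
`1 + ∫ v^α`. -/
theorem exists_moment_inequality {n : ℕ} (hn : 2 ≤ n) {U : Set (EuclideanSpace ℝ (Fin n))}
    (hU : IsOpen U) (hUb : Bornology.IsBounded U) (hC1 : HasC1Boundary U) (P : GenPoly)
    {lam α : ℝ} (hlam : 0 < lam) (ha : 1 - lam < P.a) (hα1 : n * mu0 P.a lam < α)
    (hα2 : lam + 1 < α) :
    ∃ C : ℝ, 0 < C ∧ ∀ v D, IsNonnegSobolev U (2 - P.a) v D →
      ∀ (φ : EuclideanSpace ℝ (Fin n) → ℝ) (B w₀ : ℝ), ContinuousOn φ (frontier U) → 0 ≤ B →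
        (∀ᵐ x ∂(surf U), -B ≤ φ x) →
        w₀ + (∫ x in U, P.K ‖D x‖ * ⟪D x, ((α - lam) * v x ^ (α - lam - 1)) • D x⟫_ℝ) +
          (∫ x, φ x * v x ^ lam * v x ^ (α - lam) ∂(surf U)) = 0 →
        w₀ + ∫ x, v x ^ α ∂(surf U) ≤
          C * ((1 + B ^ phiExp n P.a lam α) *
            (1 + ∫ x in U, v x ^ α) ^ (1 + mu1 n P.a lam α / α)) := by
  have ha1 := P.a_lt_one
  have hE1 := one_le_phiExp hn ha1 ha hα1
  obtain ⟨hθ0, hθ1⟩ := theta_mem hn ha1 ha hα1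
  have hκ0 := mu1_pos hn ha1 ha hα1
  set E := phiExp n P.a lam α with hE
  set κ := 1 + mu1 n P.a lam α / α with hκ
  set θ := theta n P.a lam α with hθ
  set p := 2 - P.a with hp
  set d := P.a - (1 - lam) with hd
  have hp1 : 1 < p := by linarith
  have hd0 : 0 < d := by linarith
  have hdp : d + p = lam + 1 := by rw [hd, hp]; ring
  have hα0 : 0 < α := by linarith
  have hc1 : 1 ≤ α - lam := by linarith
  have hpn : p < n := by
    have h2 : (2 : ℝ) ≤ n := by exact_mod_cast hn
    have := P.a_pos
    linarith
  obtain ⟨CK, hCK, hKp⟩ := P.exists_rpow_le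
  obtain ⟨CT, hCT, hT⟩ := exists_trace_rpow (by omega) hU hUb hC1 hp1.le
  set c := α - lam with hc
  set ε := c / (2 * CK) with hε
  have hε0 : 0 < ε := by positivity
  obtain ⟨C₁, hC₁, hY1⟩ := exists_young_trace (d := d) (β := α) hp1 (by linarith)
    (by have : 0 < p - 1 := by linarith
        positivity) hε0
  have hp1' : 0 < p - 1 := by linarith
  have hθ' : 0 < 1 - θ := by linarith
  obtain ⟨C₂, hC₂, hI⟩ := exists_interpolation (d := d) (α := α) (θ := θ) (κ := κ) hn hU hUb hC1
    hp1 hpn hd0 (by linarith) (by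
      have : p - 1 = 1 - P.a := by rw [hp]; ring
      rw [mu0, ← mul_div_assoc] at hα1
      rwa [this]) (by rw [hθ, theta_eq hn ha1 ha]) (by
      rw [hκ, mu1, mu0, ← hθ]
      have : p - 1 = 1 - P.a := by rw [hp]; ring
      rw [this]) hε0
  set C₃ := (C₁ * (CT * α) ^ (p / (p - 1))) ^ (1 / (1 - θ)) with hC₃
  have hC₃0 : 0 ≤ C₃ := by positivity
  set m := volume.real U with hm
  have hm0 : 0 ≤ m := measureReal_nonneg
  refine ⟨(c * (m + 1) + CT + C₂ * (1 + C₃)) * 2 ^ E, by positivity,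
    fun v D h φ B w₀ hφ hB hφB heq => ?_⟩
  have hsurf := surf_lt_top (by omega) hU hUb hC1
  have hγ0 : 0 ≤ α - (d + p) := by linarith
  have hbd : ∀ᵐ x ∂(surf U), 0 ≤ v x := by
    filter_upwards [ae_restrict_mem isClosed_frontier.measurableSet] with x hx
    exact h.nonneg x (frontier_subset_closure hx)
  have hvα : ContinuousOn (fun x => v x ^ α) (frontier U) :=
    (h.continuousOn_rpow hα0.le).mono frontier_subset_closure
  -- the diffusion term dominates the weighted energy
  have hdiff : c / CK * (∫ x in U, v x ^ (α - (d + p)) * ‖D x‖ ^ p) -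
      c * ∫ x in U, v x ^ (α - (d + p)) ≤
      ∫ x in U, P.K ‖D x‖ * ⟪D x, (c * v x ^ (c - 1)) • D x⟫_ℝ := by
    have hexp : c - 1 = α - (d + p) := by rw [hc]; linarith
    have hrw : ∀ x, P.K ‖D x‖ * ⟪D x, (c * v x ^ (c - 1)) • D x⟫_ℝ =
        c * (v x ^ (α - (d + p)) * (P.root ‖D x‖ * ‖D x‖)) := fun x => by
      rw [inner_smul_right, ← hexp]
      have := P.K_norm_mul_inner_self (D x)
      linear_combination (c * v x ^ (c - 1)) * this
    simp only [hrw]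
    rw [← integral_const_mul, ← integral_const_mul, ← integral_sub
      ((h.integrableOn_rpow_mul_norm_rpow hU hUb (by linarith) hγ0).const_mul _)
      ((h.integrableOn_rpow hUb hγ0).const_mul _)]
    refine integral_mono_ae
      (((h.integrableOn_rpow_mul_norm_rpow hU hUb (by linarith) hγ0).const_mul _).sub
      ((h.integrableOn_rpow hUb hγ0).const_mul _))
      ((h.integrableOn_rpow_mul hU hUb hγ0
        (integrable_root_mul_norm P h.memLp h.memLp)).const_mul c) ?_
    filter_upwards [h.ae_nonneg hU] with x hx
    have h1 := hKp ‖D x‖ (norm_nonneg _)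
    have h2 : ‖D x‖ ^ p / CK - 1 ≤ P.root ‖D x‖ * ‖D x‖ := by
      rw [sub_le_iff_le_add, div_le_iff₀ hCK]; linarith
    have h3 := mul_le_mul_of_nonneg_left h2
      (mul_nonneg (by linarith : 0 ≤ c) (Real.rpow_nonneg hx (α - (d + p))))
    have e : c * v x ^ (α - (d + p)) * (‖D x‖ ^ p / CK - 1) =
        c / CK * (v x ^ (α - (d + p)) * ‖D x‖ ^ p) - c * v x ^ (α - (d + p)) := by ring
    linarith
  -- only the negative part of `φ` counts on the boundary
  have hbdry : -(B * ∫ x, v x ^ α ∂(surf U)) ≤ ∫ x, φ x * v x ^ lam * v x ^ c ∂(surf U) := by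
    rw [← integral_const_mul, ← integral_neg]
    have hi := ContinuousOn.integrable_surf (by omega) hU hUb hC1 hvα
    have hrw : ∀ᵐ x ∂(surf U), φ x * v x ^ lam * v x ^ c = φ x * v x ^ α := by
      filter_upwards [hbd] with x hx
      rw [mul_assoc, ← Real.rpow_add_of_nonneg hx hlam.le (by linarith)]
      congr 2; rw [hc]; ring
    rw [integral_congr_ae hrw]
    refine integral_mono_ae (hi.const_mul B).neg
      (ContinuousOn.integrable_surf (by omega) hU hUb hC1 (hφ.mul hvα)) ?_
    filter_upwards [hφB, hbd] with x h1 h2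
    have := mul_le_mul_of_nonneg_right h1 (Real.rpow_nonneg h2 α)
    linarith
  have hS0 : 0 ≤ ∫ x, v x ^ α ∂(surf U) := by
    refine integral_nonneg_of_ae ?_
    filter_upwards [hbd] with x hx
    exact Real.rpow_nonneg hx _
  have hTr := hT v D h α (by linarith)
  -- `B + 1` instead of `B` leaves a boundary integral of `v^α` on the left of the final estimate
  have hYi : (B + 1) * (CT * α) * ∫ x in U, v x ^ (α - 1) * ‖D x‖ ≤
      ε * (∫ x in U, v x ^ (α - (d + p)) * ‖D x‖ ^ p) +
        C₁ * (((B + 1) * (CT * α)) ^ (p / (p - 1)) * ∫ x in U, v x ^ (α + d / (p - 1))) := by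
    have hμ0 : 0 ≤ α + d / (p - 1) := by positivity
    have i1 := (h.integrableOn_rpow_mul_norm_rpow hU hUb (by linarith) hγ0).const_mul ε
    have i2 := ((h.integrableOn_rpow hUb hμ0).const_mul
      (((B + 1) * (CT * α)) ^ (p / (p - 1)))).const_mul C₁
    rw [← integral_const_mul, ← integral_const_mul, ← integral_const_mul, ← integral_const_mul,
      ← integral_add i1 i2]
    refine integral_mono_ae ((h.integrableOn_rpow_mul hU hUb (by linarith)
      (h.integrableOn_grad hUb hp1.le).norm).const_mul _) (i1.add i2) ?_
    filter_upwards [h.ae_nonneg hU] with x hx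
    exact hY1 _ _ _ (by positivity) hx (norm_nonneg _)
  have hInt := hI v D h (C₁ * ((B + 1) * (CT * α)) ^ (p / (p - 1))) (by positivity)
  have hpow : (C₁ * ((B + 1) * (CT * α)) ^ (p / (p - 1))) ^ (1 / (1 - θ)) = C₃ * (1 + B) ^ E := by
    have e : C₁ * ((B + 1) * (CT * α)) ^ (p / (p - 1)) =
        C₁ * (CT * α) ^ (p / (p - 1)) * (1 + B) ^ (p / (p - 1)) := by
      rw [Real.mul_rpow (by positivity) (by positivity), add_comm B 1]; ring
    rw [e, hC₃, Real.mul_rpow (by positivity) (by positivity), ← Real.rpow_mul (by positivity)]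
    congr 2
    rw [hE, phiExp, ← hθ]
    have : p - 1 = 1 - P.a := by rw [hp]; ring
    rw [← this, ← hp]
    field_simp
  rw [hpow] at hInt
  have hlow := h.integral_rpow_le hU hUb (β := α - (d + p)) (β' := α) hγ0 (by linarith)
  have hY0 := h.integral_rpow_nonneg hU α
  have hX0 := h.integral_rpow_mul_norm_nonneg hU (α - (d + p)) p
  have hB1 := one_add_rpow_le hB (by linarith : 0 ≤ E)
  have hBE : 1 + B ≤ (1 + B) ^ E := Real.self_le_rpow_of_one_le (by linarith) hE1
  have hYκ : 1 + ∫ x in U, v x ^ α ≤ (1 + ∫ x in U, v x ^ α) ^ κ :=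
    Real.self_le_rpow_of_one_le (by linarith) (by
      have : 0 < mu1 n P.a lam α / α := by positivity
      linarith)
  have hεc : ε * 2 = c / CK := by rw [hε]; field_simp
  have hc0 : 0 ≤ c := by linarith
  clear_value E κ θ p d c ε m C₃
  clear hT hY1 hI hKp hφB hbd hvα hφ hpow h
  generalize (∫ x in U, v x ^ (α - (d + p)) * ‖D x‖ ^ p) = X at *
  generalize (∫ x in U, v x ^ (α - (d + p))) = Z at *
  generalize (∫ x, v x ^ α ∂(surf U)) = S at *
  generalize (∫ x in U, v x ^ (α - 1) * ‖D x‖) = W at *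
  generalize (∫ x in U, v x ^ (α + d / (p - 1))) = V at *
  generalize (∫ x in U, v x ^ α) = Y at *
  generalize (∫ x in U, P.K ‖D x‖ * ⟪D x, (c * v x ^ (c - 1)) • D x⟫_ℝ) = G at *
  generalize (∫ x, φ x * v x ^ lam * v x ^ c ∂(surf U)) = H at *
  generalize ((B + 1) * (CT * α)) ^ (p / (p - 1)) = b at *
  generalize (1 + Y) ^ κ = R at *
  generalize (1 + B) ^ E = Q at *
  have hR1 : 1 ≤ R := by linarith
  have hQ1 : 1 ≤ Q := by linarith
  have hQR : R ≤ Q * R := by nlinarith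
  have f1 : (B + 1) * S ≤ (B + 1) * (CT * (Y + α * W)) :=
    mul_le_mul_of_nonneg_left hTr (by linarith)
  have f2 : CT * ((B + 1) * Y) ≤ CT * (Q * R) := by
    refine mul_le_mul_of_nonneg_left ?_ hCT
    refine mul_le_mul (by linarith) (by linarith) hY0 (by linarith)
  have f3 : c * Z ≤ c * ((m + 1) * (Q * R)) := by
    refine mul_le_mul_of_nonneg_left ?_ hc0
    have : m + Y ≤ (m + 1) * R := by nlinarith
    have : (m + 1) * R ≤ (m + 1) * (Q * R) := mul_le_mul_of_nonneg_left hQR (by linarith)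
    linarith
  have f4 : C₂ * ((1 + C₃ * Q) * R) ≤ C₂ * ((1 + C₃) * (Q * R)) := by
    refine mul_le_mul_of_nonneg_left ?_ hC₂
    linarith
  have f5 : (c * (m + 1) + CT + C₂ * (1 + C₃)) * (Q * R) ≤
      (c * (m + 1) + CT + C₂ * (1 + C₃)) * (2 ^ E * (1 + B ^ E) * R) := by
    refine mul_le_mul_of_nonneg_left ?_ (by positivity)
    exact mul_le_mul_of_nonneg_right hB1 (by linarith)
  have f6 : c / CK * X = 2 * (ε * X) := by rw [← hεc]; ring
  linarith

/-! ### Calculus in the time variable -/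

section cylinder

variable {X : Type*} [TopologicalSpace X] {K : Set X} {a b : ℝ} {f : ℝ → X → ℝ}

lemma exists_bound_cylinder (hK : IsCompact K)
    (hf : ContinuousOn (fun q : ℝ × X => f q.1 q.2) (Icc a b ×ˢ K)) :
    ∃ M : ℝ, 0 ≤ M ∧ ∀ t ∈ Icc a b, ∀ x ∈ K, |f t x| ≤ M := by
  obtain ⟨M, hM⟩ := (isCompact_Icc.prod hK).exists_bound_of_continuousOn hf
  exact ⟨max M 0, le_max_right _ _, fun t ht x hx =>
    (hM (t, x) ⟨ht, hx⟩).trans (le_max_left _ _)⟩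

lemma continuousOn_slice_right
    (hf : ContinuousOn (fun q : ℝ × X => f q.1 q.2) (Icc a b ×ˢ K)) {t : ℝ} (ht : t ∈ Icc a b) :
    ContinuousOn (f t) K :=
  hf.comp (f := fun x => (t, x)) (by fun_prop) fun _ hx => ⟨ht, hx⟩

lemma continuousOn_slice_left
    (hf : ContinuousOn (fun q : ℝ × X => f q.1 q.2) (Icc a b ×ˢ K)) {x : X} (hx : x ∈ K) :
    ContinuousOn (fun t => f t x) (Icc a b) :=
  hf.comp (f := fun t => (t, x)) (by fun_prop) fun _ ht => ⟨ht, hx⟩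

variable [MeasurableSpace X] [OpensMeasurableSpace X] [T2Space X] {μ : Measure X}

lemma integrable_slice [IsFiniteMeasure μ] (hK : IsCompact K) (hμ : ∀ᵐ x ∂μ, x ∈ K)
    {g : X → ℝ} (hg : ContinuousOn g K) : Integrable g μ := by
  obtain ⟨M, hM⟩ := hK.exists_bound_of_continuousOn hg
  have hres : μ.restrict K = μ := Measure.restrict_eq_self_of_ae_mem hμ
  refine Integrable.of_bound (C := M) (hres ▸ hg.aestronglyMeasurable hK.measurableSet) ?_
  filter_upwards [hμ] with x hx
  exact hM x hx

lemma continuousOn_integral_cylinder [IsFiniteMeasure μ] (hK : IsCompact K)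
    (hμ : ∀ᵐ x ∂μ, x ∈ K)
    (hf : ContinuousOn (fun q : ℝ × X => f q.1 q.2) (Icc a b ×ˢ K)) :
    ContinuousOn (fun t => ∫ x, f t x ∂μ) (Icc a b) := by
  obtain ⟨M, hM0, hM⟩ := exists_bound_cylinder hK hf
  refine continuousOn_of_dominated (bound := fun _ => M)
    (fun t ht => (integrable_slice hK hμ (continuousOn_slice_right hf ht)).1)
    (fun t ht => ?_) (integrable_const M) ?_
  · filter_upwards [hμ] with x hx
    exact hM t ht x hx
  · filter_upwards [hμ] with x hx
    exact continuousOn_slice_left hf hx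

variable [SecondCountableTopology X]

lemma integrable_cylinder [IsFiniteMeasure μ] (hK : IsCompact K) (hμ : ∀ᵐ x ∂μ, x ∈ K)
    (hf : ContinuousOn (fun q : ℝ × X => f q.1 q.2) (Icc a b ×ˢ K)) :
    Integrable (fun q : ℝ × X => f q.1 q.2) ((volume.restrict (Ioc a b)).prod μ) := by
  obtain ⟨M, hM0, hM⟩ := exists_bound_cylinder hK hf
  have hres : μ.restrict K = μ := Measure.restrict_eq_self_of_ae_mem hμ
  have hms : MeasurableSet (Ioc a b ×ˢ K) := measurableSet_Ioc.prod hK.measurableSet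
  have e : (volume.restrict (Ioc a b)).prod μ =
      ((volume : Measure ℝ).prod μ).restrict (Ioc a b ×ˢ K) := by
    rw [← Measure.prod_restrict, hres]
  rw [e]
  have : IsFiniteMeasure (((volume : Measure ℝ).prod μ).restrict (Ioc a b ×ˢ K)) := by
    rw [← e]; infer_instance
  refine Integrable.of_bound ((hf.mono (prod_mono Ioc_subset_Icc_self
    subset_rfl)).aestronglyMeasurable hms) M ?_
  filter_upwards [ae_restrict_mem hms] with q hq
  exact hM q.1 (Ioc_subset_Icc_self hq.1) q.2 hq.2

end cylinder

section scalar

variable {a b L lam β : ℝ} {z η : ℝ → ℝ}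

lemma lipschitzOnWith_of_abs_le (hL : ∀ s ∈ Icc a b, ∀ t ∈ Icc a b, |z t - z s| ≤ L * |t - s|) :
    LipschitzOnWith L.toNNReal z (Icc a b) := by
  refine LipschitzOnWith.of_dist_le_mul fun s hs t ht => ?_
  rw [Real.dist_eq, Real.dist_eq]
  exact (hL t ht s hs).trans (mul_le_mul_of_nonneg_right (Real.le_coe_toNNReal L) (abs_nonneg _))

lemma absolutelyContinuous_rpow (hab : a ≤ b) (hz : ∀ t ∈ Icc a b, 0 ≤ z t)
    (hL : ∀ s ∈ Icc a b, ∀ t ∈ Icc a b, |z t - z s| ≤ L * |t - s|) (hβ : 1 ≤ β) :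
    AbsolutelyContinuousOnInterval (fun t => z t ^ β) a b := by
  have h1 := lipschitzOnWith_of_abs_le hL
  obtain ⟨M, hM⟩ := isCompact_Icc.exists_bound_of_continuousOn h1.continuousOn
  obtain ⟨K, hK⟩ := ((Real.contDiff_rpow_const_of_le (p := β) (n := 1)
    (by simpa using hβ)).contDiffOn (s := Icc 0 M)).exists_lipschitzOnWith (by simp)
      (convex_Icc 0 M) isCompact_Icc
  rw [← uIcc_of_le hab] at h1
  refine (hK.comp h1 fun t ht => ?_).absolutelyContinuousOnInterval
  rw [uIcc_of_le hab] at ht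
  exact ⟨hz t ht, (le_abs_self _).trans (hM t ht)⟩

/-- The chain rule for powers of `z`, when only the power `z^lam` is known to be absolutely
continuous. -/
lemma ae_hasDerivAt_rpow (hlam : 0 < lam) (hβ : lam ≤ β) (hz : ∀ t ∈ Icc a b, 0 ≤ z t)
    (hv : IntervalIntegrable η volume a b)
    (h : ∀ t ∈ Icc a b, z t ^ lam - z a ^ lam = ∫ τ in a..t, η τ) :
    ∀ᵐ t, t ∈ Ioo a b →
      HasDerivAt (fun s => z s ^ β) (β / lam * z t ^ (β - lam) * η t) t := by
  filter_upwards [hv.ae_hasDerivAt_integral] with t ht htab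
  have hab : a ≤ b := (htab.1.trans htab.2).le
  have htI : t ∈ Icc a b := Ioo_subset_Icc_self htab
  have hnhds : Icc a b ∈ 𝓝 t := Icc_mem_nhds htab.1 htab.2
  have h1 := ht (by rwa [uIcc_of_le hab]) a (by simp)
  have h2 : HasDerivAt (fun s => z s ^ lam) (η t) t := by
    have h3 := h1.add_const (z a ^ lam)
    refine h3.congr_of_eventuallyEq ?_
    filter_upwards [hnhds] with s hs
    rw [← h s hs]; ring
  have h4 := h2.rpow_const (p := β / lam) (Or.inr (by rwa [one_le_div hlam]))
  have h5 : (z t ^ lam) ^ (β / lam - 1) = z t ^ (β - lam) := by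
    rw [← Real.rpow_mul (hz t htI)]
    congr 1
    field_simp
  rw [h5] at h4
  have h6 := h4.congr_of_eventuallyEq (f₁ := fun s => z s ^ β) (by
    filter_upwards [hnhds] with s hs
    rw [← Real.rpow_mul (hz s hs), mul_div_cancel₀ _ hlam.ne'])
  have h7 : η t * (β / lam) * z t ^ (β - lam) = β / lam * z t ^ (β - lam) * η t := by ring
  rwa [h7] at h6

lemma ae_restrict_Ioc_of_Ioo {Q : ℝ → Prop} (h : ∀ᵐ t, t ∈ Ioo a b → Q t) :
    ∀ᵐ t ∂(volume.restrict (Ioc a b)), Q t := by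
  rw [← Measure.restrict_congr_set Ioo_ae_eq_Ioc, ae_restrict_iff' measurableSet_Ioo]
  exact h

lemma integral_rpow_eq_sub (hab : a ≤ b) (hlam : 0 < lam) (hβ : lam ≤ β) (hβ1 : 1 ≤ β)
    (hz : ∀ t ∈ Icc a b, 0 ≤ z t)
    (hL : ∀ s ∈ Icc a b, ∀ t ∈ Icc a b, |z t - z s| ≤ L * |t - s|)
    (hv : IntervalIntegrable η volume a b)
    (h : ∀ t ∈ Icc a b, z t ^ lam - z a ^ lam = ∫ τ in a..t, η τ) :
    ∫ t in Ioc a b, β / lam * z t ^ (β - lam) * η t = z b ^ β - z a ^ β := by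
  rw [← (absolutelyContinuous_rpow hab hz hL hβ1).integral_deriv_eq_sub,
    intervalIntegral.integral_of_le hab]
  refine integral_congr_ae ?_
  filter_upwards [ae_restrict_Ioc_of_Ioo (ae_hasDerivAt_rpow hlam hβ hz hv h)] with t ht
  exact ht.deriv.symm

lemma ae_differentiableAt_of_lipschitz
    (hL : ∀ s ∈ Icc a b, ∀ t ∈ Icc a b, |z t - z s| ≤ L * |t - s|) :
    ∀ᵐ t ∂(volume.restrict (Ioc a b)), DifferentiableAt ℝ z t := by
  refine ae_restrict_Ioc_of_Ioo ?_
  filter_upwards [(lipschitzOnWith_of_abs_le hL).ae_differentiableWithinAt_of_mem_real] with t ht hI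
  exact (ht (Ioo_subset_Icc_self hI)).differentiableAt (Icc_mem_nhds hI.1 hI.2)

/-- Integration by parts against the derivative of a power of a Lipschitz function. -/
lemma integral_mul_rpow_mul_deriv (hab : a ≤ b) (hlam : 0 ≤ lam) (hz : ∀ t ∈ Icc a b, 0 ≤ z t)
    (hL : ∀ s ∈ Icc a b, ∀ t ∈ Icc a b, |z t - z s| ≤ L * |t - s|) {ψ : ℝ → ℝ}
    (hv : IntervalIntegrable η volume a b)
    (h : ∀ t ∈ Icc a b, ψ t - ψ a = ∫ τ in a..t, η τ) :
    (lam + 1) * ∫ t in Ioc a b, ψ t * z t ^ lam * deriv z t =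
      ψ b * z b ^ (lam + 1) - ψ a * z a ^ (lam + 1) - ∫ t in Ioc a b, η t * z t ^ (lam + 1) := by
  have hAC := absolutelyContinuous_rpow hab hz hL (by linarith : 1 ≤ lam + 1)
  have hF : AbsolutelyContinuousOnInterval (fun t => ψ a + ∫ τ in a..t, η τ) a b := by
    have h1 := hv.absolutelyContinuousOnInterval_intervalIntegral (c := a) (by simp)
    have h2 : AbsolutelyContinuousOnInterval (fun _ : ℝ => ψ a) a b :=
      (LipschitzWith.const (ψ a)).lipschitzOnWith.absolutelyContinuousOnInterval
    exact h2.add h1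
  have hFψ : ∀ t ∈ Icc a b, ψ a + ∫ τ in a..t, η τ = ψ t := fun t ht => by
    rw [← h t ht]; ring
  have h1 := hF.integral_mul_deriv_eq_deriv_mul hAC
  rw [hFψ b ⟨hab, le_rfl⟩, hFψ a ⟨le_rfl, hab⟩, intervalIntegral.integral_of_le hab,
    intervalIntegral.integral_of_le hab] at h1
  rw [← integral_const_mul]
  have e1 : ∫ t in Ioc a b, (lam + 1) * (ψ t * z t ^ lam * deriv z t) =
      ∫ t in Ioc a b, (ψ a + ∫ τ in a..t, η τ) * deriv (fun t => z t ^ (lam + 1)) t := by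
    refine integral_congr_ae ?_
    filter_upwards [ae_differentiableAt_of_lipschitz hL, ae_restrict_mem measurableSet_Ioc]
      with t ht htI
    have hd := (ht.hasDerivAt.rpow_const (p := lam + 1) (Or.inr (by linarith))).deriv
    rw [hFψ t (Ioc_subset_Icc_self htI)]
    rw [show deriv (fun t => z t ^ (lam + 1)) t = deriv z t * (lam + 1) * z t ^ (lam + 1 - 1)
      from hd, add_sub_cancel_right]
    ring
  have e2 : ∫ t in Ioc a b, deriv (fun t => ψ a + ∫ τ in a..t, η τ) t * z t ^ (lam + 1) =
      ∫ t in Ioc a b, η t * z t ^ (lam + 1) := by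
    refine integral_congr_ae ?_
    have h3 : ∀ᵐ t, t ∈ Ioo a b → HasDerivAt (fun t => ∫ τ in a..t, η τ) (η t) t := by
      filter_upwards [hv.ae_hasDerivAt_integral] with t ht htI
      exact ht (by rw [uIcc_of_le hab]; exact Ioo_subset_Icc_self htI) a (by simp)
    filter_upwards [ae_restrict_Ioc_of_Ioo h3] with t ht
    rw [(ht.const_add (ψ a)).deriv]
  rw [e1, ← e2, h1]

end scalar

/-- Backward difference quotients of a function which is Lipschitz in time converge to its time
derivative, weakly against integrable functions. -/
lemma tendsto_integral_diffQuot {X : Type*} [MeasurableSpace X] {μ : Measure X} [SFinite μ]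
    {a b c L : ℝ} (hca : c < a) {u ψ : ℝ → X → ℝ} {h : ℕ → ℝ}
    (hh : Tendsto h atTop (𝓝[>] 0)) (hha : ∀ k, h k ≤ a - c)
    (hψ : Integrable (fun q : ℝ × X => ψ q.1 q.2) ((volume.restrict (Ioc a b)).prod μ))
    (hmeas : ∀ k, AEStronglyMeasurable (fun q : ℝ × X => (u q.1 q.2 - u (q.1 - h k) q.2) / h k)
      ((volume.restrict (Ioc a b)).prod μ))
    (hpos : ∀ k, 0 < h k)
    (hL : ∀ᵐ x ∂μ, ∀ s ∈ Icc c b, ∀ t ∈ Icc c b, |u t x - u s x| ≤ L * |t - s|) :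
    (∀ k, Integrable (fun q : ℝ × X => ψ q.1 q.2 * ((u q.1 q.2 - u (q.1 - h k) q.2) / h k))
      ((volume.restrict (Ioc a b)).prod μ)) ∧
    Tendsto (fun k => ∫ t in Ioc a b, ∫ x, ψ t x * ((u t x - u (t - h k) x) / h k) ∂μ) atTop
      (𝓝 (∫ x, (∫ t in Ioc a b, ψ t x * deriv (fun s => u s x) t) ∂μ)) := by
  have hbd : ∀ᵐ x ∂μ, ∀ k, ∀ t ∈ Ioc a b, |(u t x - u (t - h k) x) / h k| ≤ L := by
    filter_upwards [hL] with x hx k t ht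
    have h1 := hx (t - h k) ⟨by linarith [hha k, ht.1], by linarith [hpos k, ht.2]⟩ t
      ⟨by linarith [ht.1], ht.2⟩
    rw [abs_div, abs_of_pos (hpos k), div_le_iff₀ (hpos k)]
    rwa [show t - (t - h k) = h k by ring, abs_of_pos (hpos k)] at h1
  have hswap : ∀ᵐ q ∂((volume.restrict (Ioc a b)).prod μ), q.1 ∈ Ioc a b ∧
      ∀ k, ∀ t ∈ Ioc a b, |(u t q.2 - u (t - h k) q.2) / h k| ≤ L :=
    (Measure.quasiMeasurePreserving_fst.ae (ae_restrict_mem measurableSet_Ioc)).and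
      (Measure.quasiMeasurePreserving_snd.ae hbd)
  have hint : ∀ k, Integrable (fun q : ℝ × X => ψ q.1 q.2 *
      ((u q.1 q.2 - u (q.1 - h k) q.2) / h k)) ((volume.restrict (Ioc a b)).prod μ) := by
    intro k
    refine Integrable.mul_bdd (c := L) hψ (hmeas k) ?_
    filter_upwards [hswap] with q hq
    exact hq.2 k q.1 hq.1
  refine ⟨hint, ?_⟩
  have e : ∀ k, ∫ t in Ioc a b, ∫ x, ψ t x * ((u t x - u (t - h k) x) / h k) ∂μ =
      ∫ x, (∫ t in Ioc a b, ψ t x * ((u t x - u (t - h k) x) / h k)) ∂μ := fun k =>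
    integral_integral_swap (hint k)
  simp only [e]
  have hψx := hψ.prod_left_ae
  refine tendsto_integral_of_dominated_convergence
    (fun x => L * ∫ t in Ioc a b, ‖ψ t x‖)
    (fun k => (hint k).integral_prod_right.1) (hψ.norm.integral_prod_right.const_mul L) ?_ ?_
  · intro k
    filter_upwards [hbd, hψx] with x hx hψx
    rw [← integral_const_mul]
    refine norm_integral_le_of_norm_le (hψx.norm.const_mul L) ?_
    filter_upwards [ae_restrict_mem measurableSet_Ioc] with t ht
    rw [norm_mul, mul_comm]
    exact mul_le_mul_of_nonneg_right (hx k t ht) (norm_nonneg _)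
  · have hmx : ∀ᵐ x ∂μ, ∀ k, Integrable (fun t => ψ t x * ((u t x - u (t - h k) x) / h k))
        (volume.restrict (Ioc a b)) := ae_all_iff.2 fun k => (hint k).prod_left_ae
    filter_upwards [hbd, hψx, hL, hmx] with x hx hψx hLx hmx
    refine tendsto_integral_of_dominated_convergence (fun t => L * ‖ψ t x‖)
      (fun k => (hmx k).1) (hψx.norm.const_mul L) ?_ ?_
    · intro k
      filter_upwards [ae_restrict_mem measurableSet_Ioc] with t ht
      rw [norm_mul, mul_comm]
      exact mul_le_mul_of_nonneg_right (hx k t ht) (norm_nonneg _)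
    · have hdiff := ae_differentiableAt_of_lipschitz (a := c) (b := b) hLx
      have hdiff' := ae_restrict_of_ae_restrict_of_subset
        (Ioc_subset_Ioc_left (a₁ := c) (a₂ := a) (b := b) hca.le) hdiff
      filter_upwards [hdiff'] with t ht
      refine Tendsto.const_mul _ ?_
      have h1 := hasDerivAt_iff_tendsto_slope_zero.1 ht.hasDerivAt
      have h2 : Tendsto (fun k => -h k) atTop (𝓝[≠] 0) := by
        refine tendsto_nhdsWithin_iff.2 ⟨?_, Eventually.of_forall fun k => ?_⟩
        · simpa using (tendsto_nhdsWithin_iff.1 hh).1.neg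
        · simpa using (hpos k).ne'
      refine (h1.comp h2).congr fun k => ?_
      have := (hpos k).ne'
      simp only [Function.comp, smul_eq_mul, ← sub_eq_add_neg]
      field_simp
      ring

/-! ### Regularity of solutions in time, and a nonlinear Gronwall inequality -/

section negNorm

variable {n : ℕ} {U : Set (EuclideanSpace ℝ (Fin n))} {T : ℝ}
  {φ φt : ℝ → EuclideanSpace ℝ (Fin n) → ℝ} {t : ℝ}

lemma negNorm_le_of_ae {c : ℝ} (hc : 0 ≤ c) (h : ∀ᵐ x ∂(surf U), -c ≤ φ t x) :
    negNorm U φ t ≤ ENNReal.ofReal c := by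
  rw [negNorm, eLpNorm_exponent_top]
  refine eLpNormEssSup_le_of_ae_bound ?_
  filter_upwards [h] with x hx
  rw [Real.norm_of_nonneg (le_max_right _ _)]
  exact max_le (by linarith) hc

lemma isCompact_frontier (hUb : Bornology.IsBounded U) : IsCompact (frontier U) :=
  hUb.isCompact_closure.of_isClosed_subset isClosed_frontier frontier_subset_closure

lemma ae_mem_frontier : ∀ᵐ x ∂(surf U), x ∈ frontier U :=
  ae_restrict_mem isClosed_frontier.measurableSet

lemma negNorm_lt_top (hUb : Bornology.IsBounded U) (hφ : ContinuousOn (φ t) (frontier U)) :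
    negNorm U φ t < ⊤ := by
  obtain ⟨M, hM⟩ := (isCompact_frontier hUb).exists_bound_of_continuousOn hφ
  refine (negNorm_le_of_ae (c := max M 0) (le_max_right _ _) ?_).trans_lt ENNReal.ofReal_lt_top
  filter_upwards [ae_mem_frontier] with x hx
  have := (neg_abs_le (φ t x))
  have h2 : |φ t x| ≤ M := hM x hx
  linarith [le_max_left M 0]

lemma ae_neg_negNorm_le (hUb : Bornology.IsBounded U) (hφ : ContinuousOn (φ t) (frontier U)) :
    ∀ᵐ x ∂(surf U), -(negNorm U φ t).toReal ≤ φ t x := by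
  have h := ae_le_eLpNormEssSup (f := fun x => max (-φ t x) 0) (μ := surf U)
  filter_upwards [h] with x hx
  rw [← eLpNorm_exponent_top] at hx
  have h1 := ENNReal.toReal_mono (negNorm_lt_top hUb hφ).ne hx
  rw [toReal_enorm, Real.norm_of_nonneg (le_max_right _ _)] at h1
  linarith [le_max_left (-φ t x) 0]

lemma IsBoundaryData.continuousOn_slice (hφ : IsBoundaryData U T φ φt) (ht : t ∈ Icc 0 T) :
    ContinuousOn (φ t) (frontier U) :=
  continuousOn_slice_right hφ.continuousOn ht

lemma IsBoundaryData.continuousOn_negNorm (hφ : IsBoundaryData U T φ φt)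
    (hUb : Bornology.IsBounded U) :
    ContinuousOn (fun t => (negNorm U φ t).toReal) (Icc 0 T) := by
  have hu := (isCompact_Icc.prod (isCompact_frontier hUb)).uniformContinuousOn_of_continuous
    hφ.continuousOn
  rw [Metric.uniformContinuousOn_iff] at hu
  have key : ∀ ε : ℝ, 0 < ε → ∃ δ > 0, ∀ s ∈ Icc 0 T, ∀ t ∈ Icc 0 T, dist s t < δ →
      (negNorm U φ s).toReal ≤ (negNorm U φ t).toReal + ε := by
    intro ε hε
    obtain ⟨δ, hδ, h⟩ := hu ε hε
    refine ⟨δ, hδ, fun s hs t ht hst => ?_⟩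
    have hB : 0 ≤ (negNorm U φ t).toReal := ENNReal.toReal_nonneg
    refine ENNReal.toReal_le_of_le_ofReal (by linarith) (negNorm_le_of_ae (by linarith) ?_)
    filter_upwards [ae_neg_negNorm_le hUb (hφ.continuousOn_slice ht), ae_mem_frontier] with x hx hxf
    have h1 := h (s, x) ⟨hs, hxf⟩ (t, x) ⟨ht, hxf⟩ (by
      rw [Prod.dist_eq, dist_self]; exact max_lt hst hδ)
    rw [Real.dist_eq] at h1
    linarith [neg_abs_le (φ s x - φ t x)]
  rw [Metric.continuousOn_iff]
  intro t ht ε hε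
  obtain ⟨δ, hδ, h⟩ := key (ε / 2) (by linarith)
  refine ⟨δ, hδ, fun s hs hst => ?_⟩
  rw [Real.dist_eq, abs_lt]
  have h1 := h s hs t ht hst
  have h2 := h t ht s hs (by rwa [dist_comm])
  constructor <;> linarith

end negNorm

section solution

variable {n : ℕ} {U : Set (EuclideanSpace ℝ (Fin n))} {P : GenPoly} {lam T : ℝ}
  {φ φt : ℝ → EuclideanSpace ℝ (Fin n) → ℝ} {u₀ : EuclideanSpace ℝ (Fin n) → ℝ}
  {u : ℝ → EuclideanSpace ℝ (Fin n) → ℝ}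
  {Du : ℝ → EuclideanSpace ℝ (Fin n) → EuclideanSpace ℝ (Fin n)}
  {w : ℝ → EuclideanSpace ℝ (Fin n) → ℝ}

lemma isFiniteMeasure_restrict (hUb : Bornology.IsBounded U) :
    IsFiniteMeasure (volume.restrict U) := ⟨by simpa using hUb.measure_lt_top⟩

lemma ae_mem_closure (hU : IsOpen U) : ∀ᵐ x ∂(volume.restrict U), x ∈ closure U := by
  filter_upwards [ae_restrict_mem hU.measurableSet] with x hx
  exact subset_closure hx

namespace IsSolution

lemma isNonnegSobolev (hs : IsSolution U P lam T φ u₀ u Du w) {t : ℝ} (ht : t ∈ Icc 0 T) :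
    IsNonnegSobolev U (2 - P.a) (u t) (Du t) :=
  ⟨hs.nonneg t ht, continuousOn_slice_right hs.continuousOn ht, hs.weakGrad t ht, hs.memLp t ht⟩

lemma continuousOn_rpow (hs : IsSolution U P lam T φ u₀ u Du w) {β : ℝ} (hβ : 0 ≤ β) :
    ContinuousOn (fun q : ℝ × EuclideanSpace ℝ (Fin n) => u q.1 q.2 ^ β)
      (Icc 0 T ×ˢ closure U) :=
  hs.continuousOn.rpow_const fun _ _ => Or.inr hβ

lemma continuousOn_integral (hs : IsSolution U P lam T φ u₀ u Du w) (hU : IsOpen U)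
    (hUb : Bornology.IsBounded U) {β : ℝ} (hβ : 0 ≤ β) :
    ContinuousOn (fun t => ∫ x in U, u t x ^ β) (Icc 0 T) := by
  have := isFiniteMeasure_restrict hUb
  exact continuousOn_integral_cylinder (f := fun t x => u t x ^ β) hUb.isCompact_closure
    (ae_mem_closure hU) (hs.continuousOn_rpow hβ)

lemma continuousOn_integral_surf (hs : IsSolution U P lam T φ u₀ u Du w) (hn : 1 ≤ n)
    (hU : IsOpen U) (hUb : Bornology.IsBounded U) (hC1 : HasC1Boundary U) {β : ℝ} (hβ : 0 ≤ β) :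
    ContinuousOn (fun t => ∫ x, u t x ^ β ∂(surf U)) (Icc 0 T) := by
  have := surf_lt_top hn hU hUb hC1
  exact continuousOn_integral_cylinder (f := fun t x => u t x ^ β) (isCompact_frontier hUb)
    ae_mem_frontier ((hs.continuousOn_rpow hβ).mono
      (prod_mono subset_rfl frontier_subset_closure))

lemma integrable_prod (hs : IsSolution U P lam T φ u₀ u Du w) {ε : ℝ} (hε : 0 < ε) :
    Integrable (fun q : ℝ × EuclideanSpace ℝ (Fin n) => w q.1 q.2)
      ((volume.restrict (Ioc ε T)).prod (volume.restrict U)) := by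
  rw [Measure.prod_restrict, ← Measure.volume_eq_prod]
  exact hs.integrable_timeDeriv ε hε

/-- For almost every `x`, the function `u(x, ·)^lam` is locally absolutely continuous on `(0,T]`
with derivative `w(x, ·)`. -/
lemma ae_timeDeriv (hs : IsSolution U P lam T φ u₀ u Du w) (hU : IsOpen U) (hlam : 0 < lam) :
    ∀ᵐ x ∂(volume.restrict U), ∀ s t : ℝ, 0 < s → s ≤ t → t ≤ T →
      IntervalIntegrable (fun τ => w τ x) volume s t ∧
        u t x ^ lam - u s x ^ lam = ∫ τ in s..t, w τ x := by
  obtain ⟨S, hSc, hSd⟩ := TopologicalSpace.exists_countable_dense (Ioc 0 T)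
  have h1 : ∀ᵐ x ∂(volume.restrict U), ∀ k : ℕ,
      Integrable (fun τ => w τ x) (volume.restrict (Ioc (1 / ((k : ℝ) + 1)) T)) :=
    ae_all_iff.2 fun k => (hs.integrable_prod (by positivity)).prod_left_ae
  have h2 : ∀ᵐ x ∂(volume.restrict U), ∀ t ∈ S,
      u T x ^ lam - u (t : ℝ) x ^ lam = ∫ τ in (t : ℝ)..T, w τ x :=
    (ae_ball_iff hSc).2 fun t _ => hs.timeDeriv t T t.2.1 t.2.2 le_rfl
  filter_upwards [h1, h2, ae_mem_closure hU] with x hx1 hx2 hxU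
  have hint : ∀ s t : ℝ, 0 < s → s ≤ t → t ≤ T →
      IntervalIntegrable (fun τ => w τ x) volume s t := by
    intro s t hs0 hst htT
    obtain ⟨k, hk⟩ := exists_nat_one_div_lt hs0
    rw [intervalIntegrable_iff_integrableOn_Ioc_of_le hst]
    exact IntegrableOn.mono_set (hx1 k) (Ioc_subset_Ioc hk.le htT)
  have hcu : ContinuousOn (fun t => u t x) (Icc 0 T) := continuousOn_slice_left hs.continuousOn hxU
  have hF : Continuous fun t : Ioc 0 T => u T x ^ lam - u (t : ℝ) x ^ lam := by
    exact ContinuousOn.comp_continuous (s := Icc 0 T) (f := fun t : Ioc 0 T => (t : ℝ))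
      (g := fun t => u T x ^ lam - u t x ^ lam)
      (continuousOn_const.sub (hcu.rpow_const fun _ _ => Or.inr hlam.le)) continuous_subtype_val
      fun t => Ioc_subset_Icc_self t.2
  have hG : Continuous fun t : Ioc 0 T => ∫ τ in (t : ℝ)..T, w τ x := by
    rw [continuous_iff_continuousAt]
    intro t
    obtain ⟨k, hk⟩ := exists_nat_one_div_lt t.2.1
    have hk0 : (0 : ℝ) < 1 / (k + 1) := by positivity
    have hc := intervalIntegral.continuousOn_primitive_interval'
      (hint _ _ hk0 (hk.le.trans t.2.2) le_rfl) (a := T) (by simp)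
    rw [uIcc_of_le (hk.le.trans t.2.2)] at hc
    have h3 := (hc t ⟨hk.le, t.2.2⟩).tendsto.comp (f := fun t : Ioc 0 T => (t : ℝ)) (x := 𝓝 t)
      (tendsto_nhdsWithin_iff.2 ⟨continuous_subtype_val.continuousAt, by
        filter_upwards [continuous_subtype_val.continuousAt (Ioi_mem_nhds hk)] with r hr
        exact ⟨le_of_lt hr, r.2.2⟩⟩)
    have h4 := h3.neg
    simp only [Function.comp_def] at h4
    simp only [← intervalIntegral.integral_symm] at h4
    exact h4
  have hFG := Continuous.ext_on hSd hF hG fun t ht => hx2 t ht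
  intro s t hs0 hst htT
  refine ⟨hint s t hs0 hst htT, ?_⟩
  have e1 := congrFun hFG ⟨s, hs0, hst.trans htT⟩
  have e2 := congrFun hFG ⟨t, hs0.trans_le hst, htT⟩
  simp only at e1 e2
  have e3 := intervalIntegral.integral_add_adjacent_intervals (hint s t hs0 hst htT)
    (hint t T (hs0.trans_le hst) htT le_rfl)
  linarith

lemma integrable_rpow_mul (hs : IsSolution U P lam T φ u₀ u Du w) (hU : IsOpen U)
    (hUb : Bornology.IsBounded U) {γ s t : ℝ} (hγ : 0 ≤ γ) (hs0 : 0 < s) (htT : t ≤ T) :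
    Integrable (fun q : ℝ × EuclideanSpace ℝ (Fin n) => u q.1 q.2 ^ γ * w q.1 q.2)
      ((volume.restrict (Ioc s t)).prod (volume.restrict U)) := by
  have := isFiniteMeasure_restrict hUb
  have hsub : Icc s t ×ˢ closure U ⊆ Icc 0 T ×ˢ closure U :=
    prod_mono (Icc_subset_Icc hs0.le htT) subset_rfl
  obtain ⟨M, hM0, hM⟩ := exists_bound_cylinder (f := fun t x => u t x ^ γ) hUb.isCompact_closure
    (hs.continuousOn_rpow hγ)
  have h1 := integrable_cylinder (f := fun t x => u t x ^ γ) hUb.isCompact_closure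
    (ae_mem_closure hU) ((hs.continuousOn_rpow hγ).mono hsub)
  have hw : Integrable (fun q : ℝ × EuclideanSpace ℝ (Fin n) => w q.1 q.2)
      ((volume.restrict (Ioc s t)).prod (volume.restrict U)) := by
    have h2 := hs.integrable_prod hs0
    rw [Measure.prod_restrict] at h2 ⊢
    exact IntegrableOn.mono_set h2 (prod_mono (Ioc_subset_Ioc_right htT) subset_rfl)
  refine hw.bdd_mul (c := M) h1.1 ?_
  have hmem : ∀ᵐ q ∂((volume.restrict (Ioc s t)).prod (volume.restrict U)),
      q.1 ∈ Ioc s t ∧ q.2 ∈ closure U :=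
    (Measure.quasiMeasurePreserving_fst.ae (ae_restrict_mem measurableSet_Ioc)).and
      (Measure.quasiMeasurePreserving_snd.ae (ae_mem_closure hU))
  filter_upwards [hmem] with q hq
  exact hM q.1 ⟨hs0.le.trans hq.1.1.le, hq.1.2.trans htT⟩ q.2 hq.2

/-- The time derivative of `∫ u^β`. -/
lemma integral_rpow_sub (hs : IsSolution U P lam T φ u₀ u Du w) (hU : IsOpen U)
    (hUb : Bornology.IsBounded U) (hlam : 0 < lam) {β s t : ℝ} (hβ : lam ≤ β) (hβ1 : 1 ≤ β)
    (hs0 : 0 < s) (hst : s ≤ t) (htT : t ≤ T) :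
    (∫ x in U, u t x ^ β) - ∫ x in U, u s x ^ β =
      β / lam * ∫ τ in Ioc s t, ∫ x in U, u τ x ^ (β - lam) * w τ x := by
  obtain ⟨L, hL⟩ := hs.lipschitz_time s hs0
  have hsub : Icc s t ⊆ Icc s T := Icc_subset_Icc_right htT
  have hsub0 : Icc s t ⊆ Icc 0 T := Icc_subset_Icc hs0.le htT
  rw [← integral_sub ((hs.isNonnegSobolev (hsub0 ⟨hst, le_rfl⟩)).integrableOn_rpow hUb (by linarith))
    ((hs.isNonnegSobolev (hsub0 ⟨le_rfl, hst⟩)).integrableOn_rpow hUb (by linarith)),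
    integral_integral_swap (hs.integrable_rpow_mul hU hUb (by linarith) hs0 htT),
    ← integral_const_mul]
  refine integral_congr_ae ?_
  filter_upwards [hs.ae_timeDeriv hU hlam, ae_mem_closure hU] with x hx hxU
  rw [← integral_const_mul, ← integral_rpow_eq_sub (z := fun t => u t x) (η := fun t => w t x)
    hst hlam hβ hβ1 (fun τ hτ => hs.nonneg τ (hsub0 hτ) x hxU)
    (fun r hr r' hr' => hL x hxU r (hsub hr) r' (hsub hr')) (hx s t hs0 hst htT).1
    (fun τ hτ => (hx s τ hs0 hτ.1 (hτ.2.trans htT)).2)]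
  refine integral_congr_ae (ae_of_all _ fun τ => ?_)
  simp only
  ring

end IsSolution

end solution

/-- A nonlinear Gronwall inequality: a solution of `y' ≤ b y^(1 + q)` at most doubles as long as
the integral of `b` is small in terms of `y 0`. -/
lemma le_two_mul_of_sub_le_integral {T q : ℝ} (hq : 0 < q) {y b : ℝ → ℝ}
    (hy : ContinuousOn y (Icc 0 T)) (hb : ContinuousOn b (Icc 0 T))
    (hy0 : ∀ t ∈ Icc 0 T, 0 < y t) (hb0 : ∀ t ∈ Icc 0 T, 0 ≤ b t)
    (h : ∀ t ∈ Icc 0 T, y t - y 0 ≤ ∫ τ in 0..t, b τ * y τ ^ (1 + q))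
    (hsmall : q * ∫ τ in 0..T, b τ ≤ (1 - 2 ^ (-q)) * y 0 ^ (-q)) :
    ∀ t ∈ Icc 0 T, y t ≤ 2 * y 0 := by
  intro t ht
  have hT : 0 ≤ T := ht.1.trans ht.2
  have h00 : (0 : ℝ) ∈ Icc 0 T := ⟨le_rfl, hT⟩
  have hy00 := hy0 0 h00
  set f : ℝ → ℝ := fun τ => b τ * y τ ^ (1 + q) with hf
  have hfc : ContinuousOn f (Icc 0 T) :=
    hb.mul (hy.rpow_const fun s hs => Or.inl (hy0 s hs).ne')
  have hf0 : ∀ s ∈ Icc 0 T, 0 ≤ f s := fun s hs =>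
    mul_nonneg (hb0 s hs) (Real.rpow_nonneg (hy0 s hs).le _)
  have hfi : ∀ s ∈ Icc 0 T, IntervalIntegrable f volume 0 s := fun s hs =>
    (hfc.mono (by rw [uIcc_of_le hs.1]; exact Icc_subset_Icc_right hs.2)).intervalIntegrable
  have hbi : ∀ s ∈ Icc 0 T, IntervalIntegrable b volume 0 s := fun s hs =>
    (hb.mono (by rw [uIcc_of_le hs.1]; exact Icc_subset_Icc_right hs.2)).intervalIntegrable
  set R : ℝ → ℝ := fun s => y 0 + ∫ τ in 0..s, f τ with hR
  -- `R` dominates `y` and solves the differential inequality, so that `Z` is monotone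
  set Z : ℝ → ℝ := fun s => R s ^ (-q) + q * ∫ τ in 0..s, b τ with hZ
  have hyR : ∀ s ∈ Icc 0 T, y s ≤ R s := fun s hs => by
    have := h s hs
    simp only [hR]; linarith
  have hR0 : ∀ s ∈ Icc 0 T, 0 < R s := fun s hs => (hy0 s hs).trans_le (hyR s hs)
  have hcont : ∀ g : ℝ → ℝ, IntervalIntegrable g volume 0 T →
      ContinuousOn (fun s => ∫ τ in 0..s, g τ) (Icc 0 T) := fun g hg => by
    have := intervalIntegral.continuousOn_primitive_interval' hg (a := 0) (by simp)
    rwa [uIcc_of_le hT] at this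
  have hRc : ContinuousOn R (Icc 0 T) := continuousOn_const.add (hcont f (hfi T ⟨hT, le_rfl⟩))
  have hZc : ContinuousOn Z (Icc 0 T) :=
    (hRc.rpow_const fun s hs => Or.inl (hR0 s hs).ne').add
      ((hcont b (hbi T ⟨hT, le_rfl⟩)).const_mul q)
  have hderiv : ∀ g : ℝ → ℝ, ContinuousOn g (Icc 0 T) → ∀ s ∈ Ioo 0 T,
      HasDerivAt (fun s => ∫ τ in 0..s, g τ) (g s) s := fun g hg s hs => by
    refine intervalIntegral.integral_hasDerivAt_right
      (hg.mono (by rw [uIcc_of_le hs.1.le]; exact Icc_subset_Icc_right hs.2.le)).intervalIntegrable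
      ?_ (hg.continuousAt (Icc_mem_nhds hs.1 hs.2))
    exact (hg.mono Ioo_subset_Icc_self).stronglyMeasurableAtFilter isOpen_Ioo s hs
  have hZd : ∀ s ∈ Ioo 0 T, HasDerivAt Z (f s * (-q) * R s ^ (-q - 1) + q * b s) s :=
    fun s hs => by
    have h1 : HasDerivAt R (f s) s := (hderiv f hfc s hs).const_add (y 0)
    exact (h1.rpow_const (Or.inl (hR0 s (Ioo_subset_Icc_self hs)).ne')).add
      ((hderiv b hb s hs).const_mul q)
  have hmono : MonotoneOn Z (Icc 0 T) := by
    refine monotoneOn_of_deriv_nonneg (convex_Icc 0 T) hZc ?_ ?_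
    · rw [interior_Icc]
      exact fun s hs => (hZd s hs).differentiableAt.differentiableWithinAt
    · rw [interior_Icc]
      intro s hs
      have hsI := Ioo_subset_Icc_self hs
      rw [(hZd s hs).deriv]
      have h1 : y s ^ (1 + q) * R s ^ (-q - 1) ≤ 1 := by
        have h2 : y s ^ (1 + q) ≤ R s ^ (1 + q) :=
          Real.rpow_le_rpow (hy0 s hsI).le (hyR s hsI) (by linarith)
        have h3 := mul_le_mul_of_nonneg_right h2 (Real.rpow_nonneg (hR0 s hsI).le (-q - 1))
        rwa [← Real.rpow_add (hR0 s hsI), show 1 + q + (-q - 1) = 0 by ring,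
          Real.rpow_zero] at h3
      have h4 := mul_le_mul_of_nonneg_left h1 (mul_nonneg hq.le (hb0 s hsI))
      simp only [hf]
      linarith
  have hZt : Z 0 ≤ Z t := hmono h00 ht ht.1
  have hbt : ∫ τ in 0..t, b τ ≤ ∫ τ in 0..T, b τ := by
    refine intervalIntegral.integral_mono_interval le_rfl ht.1 ht.2 ?_ (hbi T ⟨hT, le_rfl⟩)
    filter_upwards [ae_restrict_mem measurableSet_Ioc] with s hs
    exact hb0 s (Ioc_subset_Icc_self hs)
  have hbt' := mul_le_mul_of_nonneg_left hbt hq.le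
  have hRt : (2 * y 0) ^ (-q) ≤ R t ^ (-q) := by
    rw [Real.mul_rpow (by norm_num) hy00.le]
    simp only [hZ, hR, intervalIntegral.integral_same, add_zero, mul_zero] at hZt
    simp only [hR]
    linarith
  refine (hyR t ht).trans ?_
  by_contra hcon
  push Not at hcon
  have := Real.rpow_lt_rpow_of_neg (by positivity) hcon (by linarith : -q < 0)
  linarith

lemma nonpos_of_continuousOn_Icc {t : ℝ} (ht : 0 < t) {F : ℝ → ℝ} (hF : ContinuousOn F (Icc 0 t))
    (h : ∀ s ∈ Ioc 0 t, F s ≤ 0) : F 0 ≤ 0 := by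
  have h1 : Tendsto F (𝓝[>] 0) (𝓝 (F 0)) :=
    (hF 0 ⟨le_rfl, ht.le⟩).mono_left (nhdsWithin_le_of_mem (by
      exact mem_of_superset (Ioc_mem_nhdsGT ht) Ioc_subset_Icc_self))
  refine le_of_tendsto h1 ?_
  filter_upwards [Ioc_mem_nhdsGT ht] with s hs
  exact h s hs

/-! ### The moment bound -/

section

variable {n : ℕ} {U : Set (EuclideanSpace ℝ (Fin n))} {P : GenPoly} {lam T : ℝ}
  {φ φt : ℝ → EuclideanSpace ℝ (Fin n) → ℝ} {u₀ : EuclideanSpace ℝ (Fin n) → ℝ}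
  {u : ℝ → EuclideanSpace ℝ (Fin n) → ℝ}
  {Du : ℝ → EuclideanSpace ℝ (Fin n) → EuclideanSpace ℝ (Fin n)}
  {w : ℝ → EuclideanSpace ℝ (Fin n) → ℝ}

lemma IsSolution.initMass_eq (hs : IsSolution U P lam T φ u₀ u Du w) (hU : IsOpen U)
    (hUb : Bornology.IsBounded U) (hT : 0 ≤ T) {α : ℝ} (hα : 0 ≤ α) :
    initMass U α u₀ = ENNReal.ofReal (∫ x in U, u 0 x ^ α) := by
  have h := hs.isNonnegSobolev (t := 0) ⟨le_rfl, hT⟩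
  rw [initMass, ofReal_integral_eq_lintegral_ofReal (h.integrableOn_rpow hUb hα) (by
    filter_upwards [h.ae_nonneg hU] with x hx
    exact Real.rpow_nonneg hx _)]
  refine lintegral_congr_ae ?_
  filter_upwards [ae_mem_closure hU] with x hx
  rw [hs.initial x hx]

/-- The condition on `T`, in terms of real integrals. -/
lemma IsBoundaryData.integral_le_of_timeCondition (hφ : IsBoundaryData U T φ φt)
    (hs : IsSolution U P lam T φ u₀ u Du w) (hU : IsOpen U)
    (hUb : Bornology.IsBounded U) (hT : 0 < T) {α C₃ : ℝ} (hα : 0 ≤ α) (hC₃ : 0 < C₃)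
    (hE : 0 ≤ phiExp n P.a lam α) (hq : 0 ≤ mu1 n P.a lam α / α)
    (h : TimeCondition U P.a lam α C₃ T φ u₀) :
    ∫ t in 0..T, (1 + (negNorm U φ t).toReal ^ phiExp n P.a lam α) ≤
      (1 - (2 : ℝ) ^ (-(mu1 n P.a lam α / α))) / C₃ *
        (1 + ∫ x in U, u 0 x ^ α) ^ (-(mu1 n P.a lam α / α)) := by
  set E := phiExp n P.a lam α
  set q := mu1 n P.a lam α / α with hqd
  have hY0 := (hs.isNonnegSobolev (t := 0) ⟨le_rfl, hT.le⟩).integral_rpow_nonneg hU α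
  have h2 : (0 : ℝ) ≤ 1 - 2 ^ (-q) := by
    have := Real.rpow_le_one_of_one_le_of_nonpos (by norm_num : (1 : ℝ) ≤ 2) (by linarith : -q ≤ 0)
    linarith
  have hb : ContinuousOn (fun t => 1 + (negNorm U φ t).toReal ^ E) (Icc 0 T) :=
    continuousOn_const.add ((hφ.continuousOn_negNorm hUb).rpow_const fun _ _ => Or.inr hE)
  have hb0 : ∀ t, 0 ≤ 1 + (negNorm U φ t).toReal ^ E := fun t => by positivity
  have hbi : IntegrableOn (fun t => 1 + (negNorm U φ t).toReal ^ E) (Ioc 0 T) :=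
    (hb.integrableOn_compact isCompact_Icc).mono_set Ioc_subset_Icc_self
  rw [TimeCondition, hs.initMass_eq hU hUb hT.le hα, ← ENNReal.ofReal_one,
    ← ENNReal.ofReal_add zero_le_one hY0, ENNReal.ofReal_rpow_of_pos (by linarith),
    ← ENNReal.ofReal_mul (by positivity)] at h
  rw [intervalIntegral.integral_of_le hT.le]
  rw [← ENNReal.ofReal_le_ofReal_iff (by positivity),
    ofReal_integral_eq_lintegral_ofReal hbi (ae_of_all _ hb0)]
  refine le_trans (le_of_eq ?_) h
  refine setLIntegral_congr_fun measurableSet_Ioc fun t ht => ?_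
  have hlt := negNorm_lt_top hUb (hφ.continuousOn_slice (Ioc_subset_Icc_self ht))
  rw [ENNReal.ofReal_add zero_le_one (by positivity), ENNReal.ofReal_one,
    ← ENNReal.ofReal_rpow_of_nonneg ENNReal.toReal_nonneg hE, ENNReal.ofReal_toReal hlt.ne]

end

/-- Under the smallness condition on `T`, the moment `1 + ∫ u^α` at most doubles on `[0,T]`, and
the boundary integral of `u^α` is controlled. -/
theorem exists_moment_bound {n : ℕ} (hn : 2 ≤ n) {U : Set (EuclideanSpace ℝ (Fin n))}
    (hU : IsOpen U) (hUb : Bornology.IsBounded U) (hC1 : HasC1Boundary U) (P : GenPoly)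
    {lam α : ℝ} (hlam : 0 < lam) (ha : 1 - lam < P.a) (hα1 : n * mu0 P.a lam < α)
    (hα2 : lam + 1 < α) :
    ∃ C₃ : ℝ, 0 < C₃ ∧ ∃ C : ℝ, 0 < C ∧ ∀ T : ℝ, 0 < T → ∀ φ φt u₀ u Du w,
      IsBoundaryData U T φ φt → IsSolution U P lam T φ u₀ u Du w →
      TimeCondition U P.a lam α C₃ T φ u₀ → ∀ t ∈ Ioc 0 T,
        1 + ∫ x in U, u t x ^ α ≤ 2 * (1 + ∫ x in U, u 0 x ^ α) ∧
        ∫ τ in Ioc 0 t, ∫ x, u τ x ^ α ∂(surf U) ≤ C * (1 + ∫ x in U, u 0 x ^ α) := by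
  have ha1 := P.a_lt_one
  have hE1 := one_le_phiExp hn ha1 ha hα1
  have hμ := mu1_pos hn ha1 ha hα1
  have hα0 : 0 < α := by linarith
  obtain ⟨Cm, hCm, hM⟩ := exists_moment_inequality hn hU hUb hC1 P hlam ha hα1 hα2
  set q := mu1 n P.a lam α / α with hq
  have hq0 : 0 < q := by positivity
  set E := phiExp n P.a lam α with hE
  -- this makes the condition on `T` the smallness condition of the Gronwall inequality
  set C₃ := q * (Cm * α / lam) with hC₃
  have hC₃0 : 0 < C₃ := by positivity
  refine ⟨C₃, hC₃0, lam / α + Cm * 2 ^ (1 + q) / C₃, by positivity,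
    fun T hT φ φt u₀ u Du w hφ hs hTC => ?_⟩
  have hTC' := hφ.integral_le_of_timeCondition hs hU hUb hT hα0.le hC₃0 (by linarith) hq0.le hTC
  rw [← hq, ← hE] at hTC'
  set y : ℝ → ℝ := fun t => 1 + ∫ x in U, u t x ^ α with hy
  set b : ℝ → ℝ := fun t => 1 + (negNorm U φ t).toReal ^ E with hb
  set S : ℝ → ℝ := fun t => ∫ x, u t x ^ α ∂(surf U) with hS
  have hyc : ContinuousOn y (Icc 0 T) :=
    continuousOn_const.add (hs.continuousOn_integral hU hUb hα0.le)
  have hbc : ContinuousOn b (Icc 0 T) := continuousOn_const.add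
    ((hφ.continuousOn_negNorm hUb).rpow_const fun _ _ => Or.inr (by linarith))
  have hSc : ContinuousOn S (Icc 0 T) :=
    hs.continuousOn_integral_surf (by omega) hU hUb hC1 hα0.le
  have hy1 : ∀ t ∈ Icc 0 T, 1 ≤ y t := fun t ht => by
    have := (hs.isNonnegSobolev ht).integral_rpow_nonneg hU α
    simp only [hy]; linarith
  have hb0 : ∀ t, 0 ≤ b t := fun t => by simp only [hb]; positivity
  have hS0 : ∀ t ∈ Icc 0 T, 0 ≤ S t := fun t ht => by
    refine integral_nonneg_of_ae ?_
    filter_upwards [ae_mem_frontier] with x hx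
    exact Real.rpow_nonneg (hs.nonneg t ht x (frontier_subset_closure hx)) _
  have hyκ : ContinuousOn (fun t => y t ^ (1 + q)) (Icc 0 T) :=
    hyc.rpow_const fun s hs => Or.inr (by linarith)
  have hgc : ContinuousOn (fun t => b t * y t ^ (1 + q)) (Icc 0 T) := hbc.mul hyκ
  have hII : ∀ {g : ℝ → ℝ}, ContinuousOn g (Icc 0 T) → ∀ s t, 0 ≤ s → s ≤ t → t ≤ T →
      IntervalIntegrable g volume s t := fun hg s t hs0 hst htT =>
    (hg.mono (by rw [uIcc_of_le hst]; exact Icc_subset_Icc hs0 htT)).intervalIntegrable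
  -- integrate the moment inequality in time, away from the initial time
  have hstep : ∀ s t, 0 < s → s ≤ t → t ≤ T →
      lam / α * (y t - y s) + ∫ τ in s..t, (S τ - Cm * (b τ * y τ ^ (1 + q))) ≤ 0 := by
    intro s t hs0 hst htT
    have h1 := hs.integral_rpow_sub hU hUb hlam (by linarith) (by linarith : 1 ≤ α) hs0 hst htT
    have h2 : lam / α * (y t - y s) = ∫ τ in s..t, ∫ x in U, u τ x ^ (α - lam) * w τ x := by
      rw [intervalIntegral.integral_of_le hst]
      have : y t - y s = (∫ x in U, u t x ^ α) - ∫ x in U, u s x ^ α := by simp only [hy]; ring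
      rw [this, h1]
      field_simp
    have hi := (hs.integrable_rpow_mul hU hUb (by linarith : 0 ≤ α - lam) hs0 htT).integral_prod_left
    have hi' : IntervalIntegrable (fun τ => ∫ x in U, u τ x ^ (α - lam) * w τ x) volume s t := by
      rw [intervalIntegrable_iff_integrableOn_Ioc_of_le hst]; exact hi
    have hj := (hII hSc s t hs0.le hst htT).sub ((hII hgc s t hs0.le hst htT).const_mul Cm)
    rw [h2, ← intervalIntegral.integral_add hi' hj]
    rw [intervalIntegral.integral_of_le hst]
    refine integral_nonpos_of_ae ?_
    filter_upwards [ae_restrict_of_ae_restrict_of_subset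
      (Ioc_subset_Ioc hs0.le htT) hs.equation, ae_restrict_mem measurableSet_Ioc] with τ hτ hτI
    have hτT : τ ∈ Icc 0 T := ⟨hs0.le.trans hτI.1.le, hτI.2.trans htT⟩
    have hN := hs.isNonnegSobolev hτT
    have heq := hτ _ _ (hN.continuousOn_rpow (by linarith : 0 ≤ α - lam))
      (hN.weakGrad_rpow hU hUb (by linarith) (by linarith : 1 ≤ α - lam))
      (hN.memLp_rpow_smul hU hUb (by linarith) (α - lam))
    have h3 := hM _ _ hN (φ τ) (negNorm U φ τ).toReal _ (hφ.continuousOn_slice hτT)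
      ENNReal.toReal_nonneg (ae_neg_negNorm_le hUb (hφ.continuousOn_slice hτT)) heq
    have h4 : ∫ x in U, u τ x ^ (α - lam) * w τ x = ∫ x in U, w τ x * u τ x ^ (α - lam) := by
      refine integral_congr_ae (ae_of_all _ fun x => mul_comm _ _)
    simp only [Pi.zero_apply, h4]
    simp only [hS, hb, hy]
    linarith
  have hmain : ∀ t ∈ Ioc 0 T,
      lam / α * (y t - y 0) + ∫ τ in 0..t, (S τ - Cm * (b τ * y τ ^ (1 + q))) ≤ 0 := by
    intro t ht
    have hsub : Icc 0 t ⊆ Icc 0 T := Icc_subset_Icc_right ht.2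
    have hg : ContinuousOn (fun τ => S τ - Cm * (b τ * y τ ^ (1 + q))) (Icc 0 T) :=
      hSc.sub (hgc.const_mul Cm)
    refine nonpos_of_continuousOn_Icc ht.1 (F := fun s =>
      lam / α * (y t - y s) + ∫ τ in s..t, (S τ - Cm * (b τ * y τ ^ (1 + q)))) ?_
      fun s hs0 => hstep s t hs0.1 hs0.2 ht.2
    refine ((continuousOn_const.sub (hyc.mono hsub)).const_mul (lam / α)).add ?_
    have h5 := (intervalIntegral.continuousOn_primitive_interval'
      (hII hg 0 t le_rfl ht.1.le ht.2) (a := t) (by simp)).neg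
    rw [uIcc_of_le ht.1.le] at h5
    refine h5.congr fun s _ => ?_
    rw [intervalIntegral.integral_symm]
    rfl
  have hsplit : ∀ t ∈ Ioc 0 T, ∫ τ in 0..t, (S τ - Cm * (b τ * y τ ^ (1 + q))) =
      (∫ τ in 0..t, S τ) - Cm * ∫ τ in 0..t, b τ * y τ ^ (1 + q) := fun t ht => by
    rw [intervalIntegral.integral_sub (hII hSc 0 t le_rfl ht.1.le ht.2)
      ((hII hgc 0 t le_rfl ht.1.le ht.2).const_mul Cm), intervalIntegral.integral_const_mul]
  have hSi : ∀ t ∈ Ioc 0 T, 0 ≤ ∫ τ in 0..t, S τ := fun t ht =>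
    intervalIntegral.integral_nonneg ht.1.le fun τ hτ => hS0 τ ⟨hτ.1, hτ.2.trans ht.2⟩
  have hy0 : 0 < y 0 := by linarith [hy1 0 ⟨le_rfl, hT.le⟩]
  have hdouble : ∀ t ∈ Icc 0 T, y t ≤ 2 * y 0 := by
    refine le_two_mul_of_sub_le_integral hq0 (b := fun τ => Cm * α / lam * b τ) hyc
      (hbc.const_mul _) (fun t ht => by linarith [hy1 t ht])
      (fun t ht => mul_nonneg (by positivity) (hb0 t)) ?_ ?_
    · intro t ht
      rcases ht.1.eq_or_lt with h0 | h0
      · simp [← h0]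
      have h6 := hmain t ⟨h0, ht.2⟩
      rw [hsplit t ⟨h0, ht.2⟩] at h6
      have h7 := hSi t ⟨h0, ht.2⟩
      simp only [mul_assoc, intervalIntegral.integral_const_mul]
      have h8 : lam / α * (y t - y 0) ≤ Cm * ∫ τ in 0..t, b τ * y τ ^ (1 + q) := by linarith
      have h9 := mul_le_mul_of_nonneg_left h8 (by positivity : 0 ≤ α / lam)
      have e : α / lam * (lam / α * (y t - y 0)) = y t - y 0 := by field_simp
      rw [e] at h9
      refine h9.trans_eq ?_
      ring
    · rw [intervalIntegral.integral_const_mul, ← mul_assoc, ← hC₃]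
      have h10 := mul_le_mul_of_nonneg_left hTC' hC₃0.le
      refine h10.trans_eq ?_
      rw [← mul_assoc, mul_div_cancel₀ _ hC₃0.ne']
  intro t ht
  have htI := Ioc_subset_Icc_self ht
  refine ⟨hdouble t htI, ?_⟩
  have h6 := hmain t ht
  rw [hsplit t ht] at h6
  have h11 : ∫ τ in 0..t, b τ * y τ ^ (1 + q) ≤ ∫ τ in 0..t, b τ * (2 * y 0) ^ (1 + q) := by
    refine intervalIntegral.integral_mono_on ht.1.le (hII hgc 0 t le_rfl ht.1.le ht.2)
      ((hII hbc 0 t le_rfl ht.1.le ht.2).mul_const _) fun τ hτ => ?_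
    have hτT : τ ∈ Icc 0 T := ⟨hτ.1, hτ.2.trans ht.2⟩
    exact mul_le_mul_of_nonneg_left (Real.rpow_le_rpow (by linarith [hy1 τ hτT])
      (hdouble τ hτT) (by linarith)) (hb0 τ)
  rw [intervalIntegral.integral_mul_const] at h11
  have h12 : ∫ τ in 0..t, b τ ≤ ∫ τ in 0..T, b τ :=
    intervalIntegral.integral_mono_interval le_rfl ht.1.le ht.2
      (ae_of_all _ hb0) (hII hbc 0 T le_rfl hT.le le_rfl)
  have h13 : ∫ τ in 0..t, b τ ≤ 1 / C₃ * y 0 ^ (-q) := by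
    refine (h12.trans hTC').trans ?_
    have : (0 : ℝ) ≤ 2 ^ (-q) := by positivity
    gcongr
    linarith
  have h14 : (1 / C₃ * y 0 ^ (-q)) * (2 * y 0) ^ (1 + q) = 2 ^ (1 + q) / C₃ * y 0 := by
    rw [Real.mul_rpow (by norm_num) hy0.le]
    have : y 0 ^ (-q) * y 0 ^ (1 + q) = y 0 := by
      rw [← Real.rpow_add hy0]; norm_num
    linear_combination (2 ^ (1 + q) / C₃) * this
  have h15 : (∫ τ in 0..t, b τ) * (2 * y 0) ^ (1 + q) ≤ 2 ^ (1 + q) / C₃ * y 0 := by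
    rw [← h14]
    exact mul_le_mul_of_nonneg_right h13 (by positivity)
  have h16 := mul_le_mul_of_nonneg_left (h11.trans h15) hCm.le
  rw [← intervalIntegral.integral_of_le ht.1.le]
  have h17 : 0 ≤ lam / α * y t := mul_nonneg (by positivity) (by linarith [hy1 t htI])
  have h18 : Cm * (2 ^ (1 + q) / C₃ * y 0) = Cm * 2 ^ (1 + q) / C₃ * y 0 := by ring
  show ∫ τ in 0..t, S τ ≤ (lam / α + Cm * 2 ^ (1 + q) / C₃) * y 0
  linarith

/-! ### The energy functional and its discrete dissipation inequality -/

lemma abs_energy_sub_le {E : Type*} [NormedAddCommGroup E] [InnerProductSpace ℝ E] (P : GenPoly)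
    (ξ η : E) :
    |P.energy ‖ξ‖ - P.energy ‖η‖| ≤ P.root ‖ξ‖ * ‖ξ - η‖ + P.root ‖η‖ * ‖ξ - η‖ := by
  have h1 := P.energy_norm_tangent ξ η
  have h2 := P.energy_norm_tangent η ξ
  have h3 := neg_abs_le (P.K ‖ξ‖ * ⟪ξ, η - ξ⟫_ℝ)
  have h4 := neg_abs_le (P.K ‖η‖ * ⟪η, ξ - η⟫_ℝ)
  have h5 := P.abs_K_norm_mul_inner_le ξ (η - ξ)
  have h6 := P.abs_K_norm_mul_inner_le η (ξ - η)
  rw [norm_sub_rev η ξ] at h5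
  have h7 := mul_nonneg (P.root_nonneg (norm_nonneg ξ)) (norm_nonneg (ξ - η))
  have h8 := mul_nonneg (P.root_nonneg (norm_nonneg η)) (norm_nonneg (ξ - η))
  rw [abs_le]
  constructor <;> linarith

lemma toReal_eLpNorm_eq {X E : Type*} [MeasurableSpace X] {μ : Measure X}
    [NormedAddCommGroup E] {D : X → E} {p : ℝ} (hp : 0 < p) (hD : MemLp D (ENNReal.ofReal p) μ) :
    (eLpNorm D (ENNReal.ofReal p) μ).toReal = (∫ x, ‖D x‖ ^ p ∂μ) ^ (1 / p) := by
  rw [hD.eLpNorm_eq_integral_rpow_norm (by simpa using hp) ENNReal.ofReal_ne_top,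
    ENNReal.toReal_ofReal (by positivity), ENNReal.toReal_ofReal hp.le, one_div]

section energy

variable {X E : Type*} [MeasurableSpace X] {μ : Measure X} [NormedAddCommGroup E]
  [MeasurableSpace E] [BorelSpace E] (P : GenPoly) {D F : X → E}

lemma integrable_energy (hD : MemLp D (ENNReal.ofReal (2 - P.a)) μ) :
    Integrable (fun x => P.energy ‖D x‖) μ := by
  refine (integrable_root_mul_norm P hD hD).mono'
    (P.measurable_energy_norm.comp_aemeasurable hD.1.aemeasurable).aestronglyMeasurable
    (ae_of_all _ fun x => ?_)
  have h1 := P.half_le_energy (norm_nonneg (D x))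
  have h2 := P.energy_le (norm_nonneg (D x))
  have h3 := mul_nonneg (norm_nonneg (D x)) (P.root_nonneg (norm_nonneg (D x)))
  rw [Real.norm_of_nonneg (by linarith)]
  linarith

/-- Hölder's inequality for the flux. -/
lemma exists_integral_root_mul_norm_le : ∃ C : ℝ, 0 ≤ C ∧ ∀ D F : X → E,
    MemLp D (ENNReal.ofReal (2 - P.a)) μ → MemLp F (ENNReal.ofReal (2 - P.a)) μ →
    ∫ x, P.root ‖D x‖ * ‖F x‖ ∂μ ≤
      C * ((eLpNorm D (ENNReal.ofReal (2 - P.a)) μ).toReal ^ (1 - P.a) *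
        (eLpNorm F (ENNReal.ofReal (2 - P.a)) μ).toReal) := by
  obtain ⟨C, hC, hroot⟩ := P.exists_root_le
  have ha := P.a_lt_one
  refine ⟨C, hC.le, fun D F hD hF => ?_⟩
  set p := 2 - P.a with hp
  have hp1 : 1 < p := by linarith
  have hp0 : 0 < p := by linarith
  have h1 : 1 - P.a = p - 1 := by rw [hp]; ring
  have hDi := memLp_integrable_rpow hp0 hD
  have hFi := memLp_integrable_rpow hp0 hF
  have hH := integral_rpow_mul_rpow_le hDi hFi (ae_of_all _ fun x => by positivity)
    (ae_of_all _ fun x => by positivity) (s := (p - 1) / p) (t := 1 / p)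
    (div_nonneg (by linarith) hp0.le) (by positivity) (by field_simp; ring)
  have e : ∀ x, (‖D x‖ ^ p) ^ ((p - 1) / p) * (‖F x‖ ^ p) ^ (1 / p) =
      ‖D x‖ ^ (p - 1) * ‖F x‖ := fun x => by
    rw [← Real.rpow_mul (norm_nonneg _), ← Real.rpow_mul (norm_nonneg _),
      mul_div_cancel₀ _ hp0.ne', mul_one_div_cancel hp0.ne', Real.rpow_one]
  simp only [e] at hH
  rw [toReal_eLpNorm_eq hp0 hD, toReal_eLpNorm_eq hp0 hF, h1,
    ← Real.rpow_mul (integral_nonneg fun x => by positivity), one_div_mul_eq_div]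
  refine le_trans ?_ (mul_le_mul_of_nonneg_left hH hC.le)
  rw [← integral_const_mul]
  have hi : Integrable (fun x => ‖D x‖ ^ (p - 1) * ‖F x‖) μ := by
    refine (hDi.add hFi).mono' ((hD.1.norm.aemeasurable.pow_const _).aestronglyMeasurable.mul
      hF.1.norm) (ae_of_all _ fun x => ?_)
    rw [Real.norm_of_nonneg (by positivity)]
    exact rpow_sub_one_mul_le (norm_nonneg _) (norm_nonneg _) hp1
  refine integral_mono (integrable_root_mul_norm P hD hF) (hi.const_mul C) fun x => ?_
  have := mul_le_mul_of_nonneg_right (hroot ‖D x‖ (norm_nonneg _)) (norm_nonneg (F x))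
  rw [h1] at this
  simp only
  linarith

variable [InnerProductSpace ℝ E]

lemma integrable_flux [SecondCountableTopology E] (hD : MemLp D (ENNReal.ofReal (2 - P.a)) μ)
    (hF : MemLp F (ENNReal.ofReal (2 - P.a)) μ) :
    Integrable (fun x => P.K ‖D x‖ * ⟪D x, F x⟫_ℝ) μ := by
  refine (integrable_root_mul_norm P hD hF).mono'
    ((P.measurable_K_norm.comp_aemeasurable hD.1.aemeasurable).mul
      (hD.1.aemeasurable.inner hF.1.aemeasurable)).aestronglyMeasurable (ae_of_all _ fun x => ?_)
  exact P.abs_K_norm_mul_inner_le _ _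

/-- The energy functional is continuous along curves that are continuous in `L^{2-a}`. -/
lemma tendsto_integral_energy {ι : Type*} {l : Filter ι} {D : ι → X → E} {D₀ : X → E}
    (hD : ∀ᶠ i in l, MemLp (D i) (ENNReal.ofReal (2 - P.a)) μ)
    (hD₀ : MemLp D₀ (ENNReal.ofReal (2 - P.a)) μ)
    (h : Tendsto (fun i => eLpNorm (D i - D₀) (ENNReal.ofReal (2 - P.a)) μ) l (𝓝 0)) :
    Tendsto (fun i => ∫ x, P.energy ‖D i x‖ ∂μ) l (𝓝 (∫ x, P.energy ‖D₀ x‖ ∂μ)) := by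
  obtain ⟨C, hC, hH⟩ := exists_integral_root_mul_norm_le (μ := μ) (E := E) P
  have ha := P.a_lt_one
  set p := ENNReal.ofReal (2 - P.a) with hp
  have hp1 : 1 ≤ p := by
    rw [hp, ENNReal.one_le_ofReal]; linarith
  set N : ι → ℝ := fun i => (eLpNorm (D i - D₀) p μ).toReal with hN
  have hN0 : Tendsto N l (𝓝 0) := by
    have := (ENNReal.tendsto_toReal ENNReal.zero_ne_top).comp h
    rwa [ENNReal.toReal_zero] at this
  set M := (eLpNorm D₀ p μ).toReal with hM
  have hbound : ∀ᶠ i in l, |(∫ x, P.energy ‖D i x‖ ∂μ) - ∫ x, P.energy ‖D₀ x‖ ∂μ| ≤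
      C * ((M + N i) ^ (1 - P.a) * N i) + C * (M ^ (1 - P.a) * N i) := by
    filter_upwards [hD] with i hi
    have hsub := hi.sub hD₀
    have hMi : (eLpNorm (D i) p μ).toReal ≤ M + N i := by
      rw [← ENNReal.toReal_add hD₀.2.ne hsub.2.ne]
      refine ENNReal.toReal_mono (ENNReal.add_ne_top.2 ⟨hD₀.2.ne, hsub.2.ne⟩) ?_
      have := eLpNorm_add_le hD₀.1 hsub.1 hp1
      rwa [add_sub_cancel] at this
    rw [← integral_sub (integrable_energy P hi) (integrable_energy P hD₀)]
    refine (abs_integral_le_integral_abs).trans ?_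
    have i1 := integrable_root_mul_norm P hi hsub
    have i2 := integrable_root_mul_norm P hD₀ hsub
    refine (integral_mono ((integrable_energy P hi).sub (integrable_energy P hD₀)).abs
      (i1.add i2) fun x => abs_energy_sub_le P (D i x) (D₀ x)).trans ?_
    have h3 := integral_add i1 i2
    refine (le_of_eq h3).trans (add_le_add ?_ (hH D₀ _ hD₀ hsub))
    refine (hH _ _ hi hsub).trans (mul_le_mul_of_nonneg_left ?_ hC)
    refine mul_le_mul_of_nonneg_right ?_ ENNReal.toReal_nonneg
    exact Real.rpow_le_rpow ENNReal.toReal_nonneg hMi (by linarith)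
  have hlim : Tendsto (fun i => C * ((M + N i) ^ (1 - P.a) * N i) + C * (M ^ (1 - P.a) * N i)) l
      (𝓝 (C * ((M + 0) ^ (1 - P.a) * 0) + C * (M ^ (1 - P.a) * 0))) := by
    have h1 : Tendsto (fun i => (M + N i) ^ (1 - P.a)) l (𝓝 ((M + 0) ^ (1 - P.a))) :=
      (hN0.const_add M).rpow_const (Or.inr (by linarith))
    exact ((h1.mul hN0).const_mul C).add ((hN0.const_mul _).const_mul C)
  simp only [mul_zero, add_zero] at hlim
  rw [tendsto_iff_norm_sub_tendsto_zero]
  exact squeeze_zero' (Eventually.of_forall fun _ => norm_nonneg _) hbound hlim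

end energy

lemma IsNonnegSobolev.weakGrad_sub {n : ℕ} {U : Set (EuclideanSpace ℝ (Fin n))} {p : ℝ}
    {v v' : EuclideanSpace ℝ (Fin n) → ℝ}
    {D D' : EuclideanSpace ℝ (Fin n) → EuclideanSpace ℝ (Fin n)}
    (h : IsNonnegSobolev U p v D) (h' : IsNonnegSobolev U p v' D')
    (hUb : Bornology.IsBounded U) (hp : 1 ≤ p) :
    IsWeakGrad U (v - v') (D - D') := by
  intro ψ hψ hc ht e
  have hψ1 : ContDiff ℝ 1 ψ := hψ.of_le (by exact_mod_cast le_top)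
  have hfc : Continuous fun x => fderiv ℝ ψ x e :=
    (hψ1.continuous_fderiv (by norm_num)).clm_apply continuous_const
  have i1 : ∀ {v : EuclideanSpace ℝ (Fin n) → ℝ}, ContinuousOn v (closure U) →
      IntegrableOn (fun x => v x * fderiv ℝ ψ x e) U := fun hv =>
    ContinuousOn.integrableOn_of_closure hUb (hv.mul hfc.continuousOn)
  obtain ⟨M, hM⟩ := hc.exists_bound_of_continuous hψ.continuous
  have i2 : ∀ {D : EuclideanSpace ℝ (Fin n) → EuclideanSpace ℝ (Fin n)}, IntegrableOn D U →
      IntegrableOn (fun x => ⟪D x, e⟫_ℝ * ψ x) U := fun hD =>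
    Integrable.mul_bdd (c := M) (hD.inner_const e) hψ.continuous.aestronglyMeasurable
      (ae_of_all _ hM)
  have h1 := h.weakGrad ψ hψ hc ht e
  have h2 := h'.weakGrad ψ hψ hc ht e
  simp only [Pi.sub_apply, sub_mul, inner_sub_left]
  rw [integral_sub (i1 h.continuousOn) (i1 h'.continuousOn),
    integral_sub (i2 (h.integrableOn_grad hUb hp)) (i2 (h'.integrableOn_grad hUb hp)), h1, h2]
  ring

namespace IsSolution

variable {n : ℕ} {U : Set (EuclideanSpace ℝ (Fin n))} {P : GenPoly} {lam T : ℝ}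
  {φ φt : ℝ → EuclideanSpace ℝ (Fin n) → ℝ} {u₀ : EuclideanSpace ℝ (Fin n) → ℝ}
  {u : ℝ → EuclideanSpace ℝ (Fin n) → ℝ}
  {Du : ℝ → EuclideanSpace ℝ (Fin n) → EuclideanSpace ℝ (Fin n)}
  {w : ℝ → EuclideanSpace ℝ (Fin n) → ℝ}

lemma continuousOn_energy (hs : IsSolution U P lam T φ u₀ u Du w) :
    ContinuousOn (fun t => ∫ x in U, P.energy ‖Du t x‖) (Icc 0 T) := fun t ht =>
  tendsto_integral_energy P (eventually_nhdsWithin_of_forall fun s hs' => hs.memLp s hs')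
    (hs.memLp t ht) (hs.continuous_grad t ht)

/-- The discrete energy inequality: since the energy is convex, testing the equation at time `τ`
with `u(r) - u(τ)` compares the energies at the times `r` and `τ`. -/
lemma ae_diff_energy_le (hs : IsSolution U P lam T φ u₀ u Du w) (hUb : Bornology.IsBounded U) :
    ∀ᵐ τ ∂(volume.restrict (Ioc 0 T)), ∀ r ∈ Icc 0 T,
      (∫ x in U, w τ x * (u τ x - u r x)) +
        (∫ x, φ τ x * u τ x ^ lam * (u τ x - u r x) ∂(surf U)) ≤
      (∫ x in U, P.energy ‖Du r x‖) - ∫ x in U, P.energy ‖Du τ x‖ := by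
  have ha := P.a_lt_one
  filter_upwards [hs.equation, ae_restrict_mem measurableSet_Ioc] with τ hτ hτI r hr
  have hτT : τ ∈ Icc 0 T := Ioc_subset_Icc_self hτI
  have hN := hs.isNonnegSobolev hτT
  have hNr := hs.isNonnegSobolev hr
  have heq := hτ (u r - u τ) (Du r - Du τ) (hNr.continuousOn.sub hN.continuousOn)
    (hNr.weakGrad_sub hN hUb (by linarith)) (hNr.memLp.sub hN.memLp)
  simp only [Pi.sub_apply] at heq
  have e1 : ∫ x in U, w τ x * (u τ x - u r x) = -∫ x in U, w τ x * (u r x - u τ x) := by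
    rw [← integral_neg]
    exact integral_congr_ae (ae_of_all _ fun x => by ring)
  have e2 : ∫ x, φ τ x * u τ x ^ lam * (u τ x - u r x) ∂(surf U) =
      -∫ x, φ τ x * u τ x ^ lam * (u r x - u τ x) ∂(surf U) := by
    rw [← integral_neg]
    exact integral_congr_ae (ae_of_all _ fun x => by ring)
  have h1 : ∫ x in U, P.K ‖Du τ x‖ * ⟪Du τ x, Du r x - Du τ x⟫_ℝ ≤
      (∫ x in U, P.energy ‖Du r x‖) - ∫ x in U, P.energy ‖Du τ x‖ := by
    rw [← integral_sub (integrable_energy P hNr.memLp) (integrable_energy P hN.memLp)]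
    refine integral_mono (integrable_flux P hN.memLp (hNr.memLp.sub hN.memLp))
      ((integrable_energy P hNr.memLp).sub (integrable_energy P hN.memLp)) fun x => ?_
    have := P.energy_norm_tangent (Du τ x) (Du r x)
    simp only
    linarith
  linarith

end IsSolution

/-- Integrated backward difference quotients of a continuous function. -/
lemma tendsto_integral_backward_diff {T a b : ℝ} {J : ℝ → ℝ} (hJ : ContinuousOn J (Icc 0 T))
    (ha : 0 < a) (hab : a ≤ b) (hbT : b ≤ T) {h : ℕ → ℝ} (hh : Tendsto h atTop (𝓝[>] 0))
    (hpos : ∀ k, 0 < h k) (hha : ∀ k, h k ≤ a) :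
    (∀ k, IntegrableOn (fun τ => (J (τ - h k) - J τ) / h k) (Ioc a b)) ∧
    Tendsto (fun k => ∫ τ in Ioc a b, (J (τ - h k) - J τ) / h k) atTop (𝓝 (J a - J b)) := by
  have hT : 0 ≤ T := by linarith
  set G : ℝ → ℝ := IccExtend hT ((Icc 0 T).domRestrict J) with hG
  have hGc : Continuous G := (continuousOn_iff_continuous_domRestrict.1 hJ).Icc_extend'
  have hGJ : ∀ τ ∈ Icc 0 T, G τ = J τ := fun τ hτ => IccExtend_of_mem hT _ hτ
  have hrw : ∀ k, ∀ τ ∈ Ioc a b, (J (τ - h k) - J τ) / h k = (G (τ - h k) - G τ) / h k := by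
    intro k τ hτ
    rw [hGJ τ ⟨by linarith [hτ.1], by linarith [hτ.2]⟩,
      hGJ (τ - h k) ⟨by linarith [hτ.1, hha k], by linarith [hτ.2, hpos k]⟩]
  refine ⟨fun k => ?_, ?_⟩
  · refine IntegrableOn.congr_fun (f := fun τ => (G (τ - h k) - G τ) / h k) ?_
      (fun τ hτ => (hrw k τ hτ).symm) measurableSet_Ioc
    have hc : Continuous fun τ => (G (τ - h k) - G τ) / h k := by fun_prop
    exact (hc.continuousOn.integrableOn_compact isCompact_Icc).mono_set Ioc_subset_Icc_self
  have hder : ∀ s, HasDerivAt (fun s => ∫ τ in 0..s, G τ) (G s) s := fun s =>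
    intervalIntegral.integral_hasDerivAt_right (hGc.intervalIntegrable _ _)
      hGc.stronglyMeasurable.stronglyMeasurableAtFilter hGc.continuousAt
  have h2 : Tendsto (fun k => -h k) atTop (𝓝[≠] 0) := by
    refine tendsto_nhdsWithin_iff.2 ⟨?_, Eventually.of_forall fun k => ?_⟩
    · simpa using (tendsto_nhdsWithin_iff.1 hh).1.neg
    · simpa using (hpos k).ne'
  have hlim := ((hasDerivAt_iff_tendsto_slope_zero.1 (hder a)).comp h2).sub
    ((hasDerivAt_iff_tendsto_slope_zero.1 (hder b)).comp h2)
  rw [hGJ a ⟨ha.le, by linarith⟩, hGJ b ⟨by linarith, hbT⟩] at hlim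
  refine hlim.congr fun k => ?_
  rw [setIntegral_congr_fun measurableSet_Ioc (hrw k), ← intervalIntegral.integral_of_le hab,
    intervalIntegral.integral_div, intervalIntegral.integral_sub
    (f := fun τ => G (τ - h k)) (Continuous.intervalIntegrable (by fun_prop) _ _)
    (hGc.intervalIntegrable _ _), intervalIntegral.integral_comp_sub_right (fun τ => G τ)]
  have hi : ∀ s t : ℝ, IntervalIntegrable G volume s t := fun s t => hGc.intervalIntegrable s t
  have e1 := intervalIntegral.integral_interval_sub_left (hi 0 (b - h k)) (hi 0 (a - h k))
  have e2 := intervalIntegral.integral_interval_sub_left (hi 0 b) (hi 0 a)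
  simp only [Function.comp, smul_eq_mul, ← sub_eq_add_neg]
  rw [← e1, ← e2]
  have := (hpos k).ne'
  field_simp
  ring

/-! ### Passage to the limit in the difference quotients -/

namespace IsSolution

variable {n : ℕ} {U : Set (EuclideanSpace ℝ (Fin n))} {P : GenPoly} {lam T : ℝ}
  {φ φt : ℝ → EuclideanSpace ℝ (Fin n) → ℝ} {u₀ : EuclideanSpace ℝ (Fin n) → ℝ}
  {u : ℝ → EuclideanSpace ℝ (Fin n) → ℝ}
  {Du : ℝ → EuclideanSpace ℝ (Fin n) → EuclideanSpace ℝ (Fin n)}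
  {w : ℝ → EuclideanSpace ℝ (Fin n) → ℝ}

lemma continuousOn_diffQuot (hs : IsSolution U P lam T φ u₀ u Du w) {a b h : ℝ} (hh0 : 0 < h)
    (hha : h ≤ a) (hbT : b ≤ T) {K : Set (EuclideanSpace ℝ (Fin n))} (hK : K ⊆ closure U) :
    ContinuousOn (fun q : ℝ × EuclideanSpace ℝ (Fin n) => (u q.1 q.2 - u (q.1 - h) q.2) / h)
      (Icc a b ×ˢ K) := by
  have h1 : ContinuousOn (fun q : ℝ × EuclideanSpace ℝ (Fin n) => u q.1 q.2) (Icc a b ×ˢ K) :=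
    hs.continuousOn.mono (prod_mono (Icc_subset_Icc (by linarith) hbT) hK)
  have h2 : ContinuousOn (fun q : ℝ × EuclideanSpace ℝ (Fin n) => u (q.1 - h) q.2)
      (Icc a b ×ˢ K) :=
    hs.continuousOn.comp (f := fun q : ℝ × EuclideanSpace ℝ (Fin n) => (q.1 - h, q.2))
      (by fun_prop) fun q hq =>
        ⟨⟨by linarith [hq.1.1], by linarith [hq.1.2]⟩, hK hq.2⟩
  exact (h1.sub h2).div_const h

/-- The energy inequality on `[ε, t]`, with the time derivative of `u` as test function. -/
lemma energy_le_of_deriv (hs : IsSolution U P lam T φ u₀ u Du w) (hφ : IsBoundaryData U T φ φt)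
    (hn : 1 ≤ n) (hU : IsOpen U) (hUb : Bornology.IsBounded U) (hC1 : HasC1Boundary U)
    (hlam : 0 < lam) {ε t : ℝ} (hε : 0 < ε) (hεt : ε ≤ t) (htT : t ≤ T) :
    (∫ x in U, ∫ τ in Ioc ε t, w τ x * deriv (fun s => u s x) τ) +
      (∫ x, (∫ τ in Ioc ε t, φ τ x * u τ x ^ lam * deriv (fun s => u s x) τ) ∂(surf U)) +
      (∫ x in U, P.energy ‖Du t x‖) ≤ ∫ x in U, P.energy ‖Du ε x‖ := by
  have hUf := isFiniteMeasure_restrict hUb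
  have hSf := surf_lt_top hn hU hUb hC1
  set h : ℕ → ℝ := fun k => ε / 2 * (1 / ((k : ℝ) + 1)) with hh
  have hpos : ∀ k, 0 < h k := fun k => by simp only [hh]; positivity
  have hle : ∀ k, h k ≤ ε / 2 := fun k => by
    have : 1 / ((k : ℝ) + 1) ≤ 1 := by
      rw [div_le_one (by positivity)]; linarith [(Nat.cast_nonneg k : (0 : ℝ) ≤ k)]
    simp only [hh]
    nlinarith
  have hlim : Tendsto h atTop (𝓝[>] 0) := by
    refine tendsto_nhdsWithin_iff.2 ⟨?_, Eventually.of_forall hpos⟩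
    have := (tendsto_one_div_add_atTop_nhds_zero_nat (𝕜 := ℝ)).const_mul (ε / 2)
    rwa [mul_zero] at this
  obtain ⟨L, hL⟩ := hs.lipschitz_time (ε / 2) (by linarith)
  have hL' : ∀ x ∈ closure U, ∀ s ∈ Icc (ε / 2) t, ∀ r ∈ Icc (ε / 2) t,
      |u r x - u s x| ≤ L * |r - s| := fun x hx s hs' r hr =>
    hL x hx s (Icc_subset_Icc_right htT hs') r (Icc_subset_Icc_right htT hr)
  have hsub : Icc ε t ⊆ Icc 0 T := Icc_subset_Icc hε.le htT
  have hw := hs.integrable_rpow_mul hU hUb (γ := 0) le_rfl hε htT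
  simp only [Real.rpow_zero, one_mul] at hw
  have hφi : Integrable (fun q : ℝ × EuclideanSpace ℝ (Fin n) => φ q.1 q.2 * u q.1 q.2 ^ lam)
      ((volume.restrict (Ioc ε t)).prod (surf U)) :=
    integrable_cylinder (f := fun τ x => φ τ x * u τ x ^ lam) (isCompact_frontier hUb)
      ae_mem_frontier ((hφ.continuousOn.mono (prod_mono hsub subset_rfl)).mul
        ((hs.continuousOn_rpow hlam.le).mono (prod_mono hsub frontier_subset_closure)))
  have hU1 := tendsto_integral_diffQuot (μ := volume.restrict U) (c := ε / 2) (b := t) (L := L)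
    (u := u) (ψ := w) (by linarith : ε / 2 < ε) hlim (fun k => by linarith [hle k]) hw
    (fun k => (integrable_cylinder (f := fun τ x => (u τ x - u (τ - h k) x) / h k)
      hUb.isCompact_closure (ae_mem_closure hU)
      (hs.continuousOn_diffQuot (hpos k) (by linarith [hle k]) htT subset_rfl)).1) hpos (by
      filter_upwards [ae_mem_closure hU] with x hx
      exact hL' x hx)
  have hS1 := tendsto_integral_diffQuot (μ := surf U) (c := ε / 2) (b := t) (L := L)
    (u := u) (ψ := fun τ x => φ τ x * u τ x ^ lam) (by linarith : ε / 2 < ε) hlim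
    (fun k => by linarith [hle k]) hφi
    (fun k => (integrable_cylinder (f := fun τ x => (u τ x - u (τ - h k) x) / h k)
      (isCompact_frontier hUb) ae_mem_frontier
      (hs.continuousOn_diffQuot (hpos k) (by linarith [hle k]) htT
        frontier_subset_closure)).1) hpos (by
      filter_upwards [ae_mem_frontier] with x hx
      exact hL' x (frontier_subset_closure hx))
  have hJ := tendsto_integral_backward_diff hs.continuousOn_energy hε hεt htT hlim hpos
    (fun k => by linarith [hle k])
  have hlimle := le_of_tendsto_of_tendsto (hU1.2.add hS1.2) hJ.2 (Eventually.of_forall fun k => by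
    have i1 := (hU1.1 k).integral_prod_left
    have i2 := (hS1.1 k).integral_prod_left
    show _ + _ ≤ _
    refine (integral_add i1 i2).symm.le.trans (integral_mono_ae (i1.add i2) (hJ.1 k) ?_)
    filter_upwards [ae_restrict_of_ae_restrict_of_subset (Ioc_subset_Ioc hε.le htT)
      (hs.ae_diff_energy_le hUb), ae_restrict_mem measurableSet_Ioc] with τ hτ hτI
    have h1 := hτ (τ - h k) ⟨by linarith [hle k, hτI.1], by linarith [hpos k, hτI.2]⟩
    have e1 : ∫ x in U, w τ x * ((u τ x - u (τ - h k) x) / h k) =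
        (∫ x in U, w τ x * (u τ x - u (τ - h k) x)) / h k := by
      rw [← integral_div]
      exact integral_congr_ae (ae_of_all _ fun x => by ring)
    have e2 : ∫ x, φ τ x * u τ x ^ lam * ((u τ x - u (τ - h k) x) / h k) ∂(surf U) =
        (∫ x, φ τ x * u τ x ^ lam * (u τ x - u (τ - h k) x) ∂(surf U)) / h k := by
      rw [← integral_div]
      exact integral_congr_ae (ae_of_all _ fun x => by ring)
    show (∫ x in U, w τ x * ((u τ x - u (τ - h k) x) / h k)) +
      (∫ x, φ τ x * u τ x ^ lam * ((u τ x - u (τ - h k) x) / h k) ∂(surf U)) ≤ _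
    rw [e1, e2, ← add_div]
    exact div_le_div_of_nonneg_right h1 (hpos k).le)
  linarith

/-- The dissipation `u^(1-lam) w²` is integrable away from the initial time, and it is a multiple
of `w` times the time derivative of `u`. -/
lemma integral_mul_deriv (hs : IsSolution U P lam T φ u₀ u Du w) (hU : IsOpen U)
    (hUb : Bornology.IsBounded U) (hlam : 0 < lam) (hlam1 : lam ≤ 1) {ε t : ℝ} (hε : 0 < ε)
    (hεt : ε ≤ t) (htT : t ≤ T) :
    0 ≤ ∫ x in U, ∫ τ in Ioc ε t, w τ x * deriv (fun s => u s x) τ ∧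
    ∫⁻ τ in Ioc ε t, ∫⁻ x in U, ENNReal.ofReal (u τ x ^ (1 - lam) * |w τ x| ^ 2) =
      ENNReal.ofReal (lam * ∫ x in U, ∫ τ in Ioc ε t, w τ x * deriv (fun s => u s x) τ) := by
  have hUf := isFiniteMeasure_restrict hUb
  obtain ⟨L, hL⟩ := hs.lipschitz_time ε hε
  have hsubT : Icc ε t ⊆ Icc ε T := Icc_subset_Icc_right htT
  have hsub0 : Icc ε t ⊆ Icc 0 T := Icc_subset_Icc hε.le htT
  have hw := hs.integrable_rpow_mul hU hUb (γ := 0) le_rfl hε htT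
  simp only [Real.rpow_zero, one_mul] at hw
  have huw := hs.integrable_rpow_mul hU hUb (γ := 1 - lam) (by linarith) hε htT
  set f : ℝ × EuclideanSpace ℝ (Fin n) → ℝ := fun q => u q.1 q.2 ^ (1 - lam) * |w q.1 q.2| ^ 2
    with hf
  have hfm : AEStronglyMeasurable f ((volume.restrict (Ioc ε t)).prod (volume.restrict U)) := by
    refine (huw.1.mul hw.1).congr (ae_of_all _ fun q => ?_)
    simp only [hf, Pi.mul_apply, sq_abs]
    ring
  have hL0 : 0 ≤ max L 0 := le_max_right _ _
  have hae : ∀ᵐ x ∂(volume.restrict U), ∀ᵐ τ ∂(volume.restrict (Ioc ε t)),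
      0 ≤ f (τ, x) ∧ f (τ, x) = lam * (w τ x * deriv (fun s => u s x) τ) ∧
        f (τ, x) ≤ lam * max L 0 * ‖w τ x‖ := by
    filter_upwards [hs.ae_timeDeriv hU hlam, ae_mem_closure hU] with x hx hxU
    have hLx : ∀ s ∈ Icc ε t, ∀ r ∈ Icc ε t, |u r x - u s x| ≤ L * |r - s| :=
      fun s hs' r hr => hL x hxU s (hsubT hs') r (hsubT hr)
    have hd := ae_restrict_Ioc_of_Ioo (ae_hasDerivAt_rpow (z := fun t => u t x)
      (η := fun t => w t x) hlam hlam1 (fun τ hτ => hs.nonneg τ (hsub0 hτ) x hxU)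
      (hx ε t hε hεt htT).1 (fun τ hτ => (hx ε τ hε hτ.1 (hτ.2.trans htT)).2))
    have hIoo : ∀ᵐ τ ∂(volume.restrict (Ioc ε t)), τ ∈ Ioo ε t :=
      ae_restrict_Ioc_of_Ioo (ae_of_all _ fun τ hτ => hτ)
    filter_upwards [hd, hIoo] with τ hτ hτI
    have hτ0 := hs.nonneg τ (hsub0 (Ioo_subset_Icc_self hτI)) x hxU
    simp only [Real.rpow_one] at hτ
    have e1 : f (τ, x) = lam * (w τ x * deriv (fun s => u s x) τ) := by
      rw [hτ.deriv]
      simp only [hf, sq_abs]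
      field_simp
    refine ⟨mul_nonneg (Real.rpow_nonneg hτ0 _) (by positivity), e1, ?_⟩
    have h2 : ‖deriv (fun s => u s x) τ‖ ≤ max L 0 := by
      refine norm_deriv_le_of_lip' (f := fun s => u s x) hL0 ?_
      filter_upwards [Icc_mem_nhds hτI.1 hτI.2] with r hr
      have := hLx τ (Ioo_subset_Icc_self hτI) r hr
      exact this.trans (mul_le_mul_of_nonneg_right (le_max_left _ _) (abs_nonneg _))
    rw [e1, mul_assoc]
    refine mul_le_mul_of_nonneg_left ?_ hlam.le
    calc w τ x * deriv (fun s => u s x) τ ≤ ‖w τ x * deriv (fun s => u s x) τ‖ := le_abs_self _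
      _ = ‖deriv (fun s => u s x) τ‖ * ‖w τ x‖ := by rw [norm_mul, mul_comm]
      _ ≤ max L 0 * ‖w τ x‖ := mul_le_mul_of_nonneg_right h2 (norm_nonneg _)
  have hfi : ∀ᵐ x ∂(volume.restrict U), Integrable (fun τ => f (τ, x)) (volume.restrict (Ioc ε t)) := by
    have hmx : ∀ᵐ x ∂(volume.restrict U), AEStronglyMeasurable (fun τ => f (τ, x))
        (volume.restrict (Ioc ε t)) := hfm.prod_swap.prodMk_left
    filter_upwards [hae, hw.prod_left_ae, hmx] with x hx hwx hmx
    refine (hwx.norm.const_mul (lam * max L 0)).mono' hmx ?_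
    filter_upwards [hx] with τ hτ
    rw [Real.norm_of_nonneg hτ.1]
    exact hτ.2.2
  have hfI : Integrable f ((volume.restrict (Ioc ε t)).prod (volume.restrict U)) := by
    rw [integrable_prod_iff' hfm]
    refine ⟨hfi, ?_⟩
    refine (hw.norm.integral_prod_right.const_mul (lam * max L 0)).mono'
      hfm.norm.prod_swap.integral_prod_right' ?_
    filter_upwards [hae, hw.prod_left_ae, hfi] with x hx hwx hfx
    rw [Real.norm_of_nonneg (integral_nonneg fun τ => norm_nonneg _), ← integral_const_mul]
    refine integral_mono_ae hfx.norm (hwx.norm.const_mul _) ?_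
    filter_upwards [hx] with τ hτ
    rw [Real.norm_of_nonneg hτ.1]
    exact hτ.2.2
  have hf0 : ∀ τ ∈ Ioc ε t, ∀ x ∈ closure U, 0 ≤ f (τ, x) := fun τ hτ x hx =>
    mul_nonneg (Real.rpow_nonneg (hs.nonneg τ (hsub0 (Ioc_subset_Icc_self hτ)) x hx) _)
      (by positivity)
  have hf0' : 0 ≤ᵐ[(volume.restrict (Ioc ε t)).prod (volume.restrict U)] f := by
    have hmem : ∀ᵐ q ∂((volume.restrict (Ioc ε t)).prod (volume.restrict U)),
        q.1 ∈ Ioc ε t ∧ q.2 ∈ closure U :=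
      (Measure.quasiMeasurePreserving_fst.ae (ae_restrict_mem measurableSet_Ioc)).and
        (Measure.quasiMeasurePreserving_snd.ae (ae_mem_closure hU))
    filter_upwards [hmem] with q hq
    exact hf0 q.1 hq.1 q.2 hq.2
  refine ⟨?_, ?_⟩
  · refine integral_nonneg_of_ae ?_
    filter_upwards [hae] with x hx
    refine integral_nonneg_of_ae ?_
    filter_upwards [hx] with τ hτ
    have := hτ.2.1 ▸ hτ.1
    exact nonneg_of_mul_nonneg_right this hlam
  have h1 := lintegral_prod (fun q => ENNReal.ofReal (f q)) hfm.aemeasurable.ennreal_ofReal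
  rw [← ofReal_integral_eq_lintegral_ofReal hfI hf0'] at h1
  refine h1.symm.trans ?_
  rw [integral_prod_symm _ hfI, ← integral_const_mul]
  congr 1
  refine integral_congr_ae ?_
  filter_upwards [hae] with x hx
  rw [← integral_const_mul]
  refine integral_congr_ae ?_
  filter_upwards [hx] with τ hτ
  exact hτ.2.1

end IsSolution

/-! ### The energy inequality -/

lemma mul_rpow_le_rpow_add_rpow {x y r α : ℝ} (hx : 0 ≤ x) (hy : 0 ≤ y) (hr : 0 < r) (hα : r < α) :
    x * y ^ r ≤ x ^ (α / (α - r)) + y ^ α := by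
  have h1 : 0 < α - r := by linarith
  have hα0 : 0 < α := by linarith
  have hc : (α / (α - r)).HolderConjugate (α / r) := by
    rw [Real.holderConjugate_iff]
    refine ⟨by rw [one_lt_div h1]; linarith, ?_⟩
    field_simp
    ring
  have h := Real.young_inequality_of_nonneg hx (Real.rpow_nonneg hy r) hc
  rw [← Real.rpow_mul hy, mul_div_cancel₀ _ hr.ne'] at h
  refine h.trans (add_le_add ?_ ?_)
  · exact div_le_self (by positivity) hc.lt.le
  · exact div_le_self (by positivity) hc.symm.lt.le

namespace IsSolution

variable {n : ℕ} {U : Set (EuclideanSpace ℝ (Fin n))} {P : GenPoly} {lam T : ℝ}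
  {φ φt : ℝ → EuclideanSpace ℝ (Fin n) → ℝ} {u₀ : EuclideanSpace ℝ (Fin n) → ℝ}
  {u : ℝ → EuclideanSpace ℝ (Fin n) → ℝ}
  {Du : ℝ → EuclideanSpace ℝ (Fin n) → EuclideanSpace ℝ (Fin n)}
  {w : ℝ → EuclideanSpace ℝ (Fin n) → ℝ}

lemma continuousOn_boundary_energy (hs : IsSolution U P lam T φ u₀ u Du w)
    (hφ : IsBoundaryData U T φ φt) {β : ℝ} (hβ : 0 ≤ β) :
    ContinuousOn (fun q : ℝ × EuclideanSpace ℝ (Fin n) => φ q.1 q.2 * u q.1 q.2 ^ β)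
      (Icc 0 T ×ˢ frontier U) :=
  hφ.continuousOn.mul ((hs.continuousOn_rpow hβ).mono
    (prod_mono subset_rfl frontier_subset_closure))

/-- Lower bound for the boundary term of the energy inequality, by integration by parts in time. -/
lemma boundary_energy_le (hs : IsSolution U P lam T φ u₀ u Du w) (hφ : IsBoundaryData U T φ φt)
    (hn : 1 ≤ n) (hU : IsOpen U) (hUb : Bornology.IsBounded U) (hC1 : HasC1Boundary U)
    (hlam : 0 < lam) {α ε t : ℝ} (hα : lam + 1 < α) (hε : 0 < ε) (hεt : ε ≤ t) (htT : t ≤ T)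
    (hΦ : Integrable (fun q : ℝ × EuclideanSpace ℝ (Fin n) =>
      ‖φt q.1 q.2‖ ^ (α / (α - (lam + 1)))) ((volume.restrict (Ioc 0 t)).prod (surf U))) :
    (∫ x, φ t x * u t x ^ (lam + 1) ∂(surf U)) - (∫ x, φ ε x * u ε x ^ (lam + 1) ∂(surf U)) -
      ((∫ q, ‖φt q.1 q.2‖ ^ (α / (α - (lam + 1))) ∂((volume.restrict (Ioc 0 t)).prod (surf U))) +
        ∫ τ in Ioc 0 t, ∫ x, u τ x ^ α ∂(surf U)) ≤
    (lam + 1) *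
      ∫ x, (∫ τ in Ioc ε t, φ τ x * u τ x ^ lam * deriv (fun s => u s x) τ) ∂(surf U) := by
  have hSf := surf_lt_top hn hU hUb hC1
  have hl1 : 0 < lam + 1 := by linarith
  have hα0 : 0 < α := by linarith
  obtain ⟨L, hL⟩ := hs.lipschitz_time ε hε
  have hsubT : Icc ε t ⊆ Icc ε T := Icc_subset_Icc_right htT
  have hsub0 : Icc ε t ⊆ Icc 0 T := Icc_subset_Icc hε.le htT
  set qq := α / (α - (lam + 1)) with hqq
  have hqq1 : 1 ≤ qq := by
    rw [hqq, one_le_div (by linarith)]; linarith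
  set ν₀ := (volume.restrict (Ioc 0 t)).prod (surf U) with hν₀
  set ν := (volume.restrict (Ioc ε t)).prod (surf U) with hν
  have hνle : ν ≤ ν₀ :=
    Measure.prod_mono (Measure.restrict_mono (Ioc_subset_Ioc_left hε.le) le_rfl) le_rfl
  have hmem₀ : ∀ᵐ q ∂ν₀, q.1 ∈ Ioc 0 t ∧ q.2 ∈ frontier U :=
    (Measure.quasiMeasurePreserving_fst.ae (ae_restrict_mem measurableSet_Ioc)).and
      (Measure.quasiMeasurePreserving_snd.ae ae_mem_frontier)
  have hcyl : ∀ {β : ℝ}, 0 ≤ β → ContinuousOn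
      (fun q : ℝ × EuclideanSpace ℝ (Fin n) => u q.1 q.2 ^ β) (Icc 0 t ×ˢ frontier U) :=
    fun hβ => (hs.continuousOn_rpow hβ).mono
      (prod_mono (Icc_subset_Icc_right htT) frontier_subset_closure)
  have hu0 : ∀ τ ∈ Icc 0 t, ∀ x ∈ frontier U, 0 ≤ u τ x := fun τ hτ x hx =>
    hs.nonneg τ ⟨hτ.1, hτ.2.trans htT⟩ x (frontier_subset_closure hx)
  have huα : Integrable (fun q : ℝ × EuclideanSpace ℝ (Fin n) => u q.1 q.2 ^ α) ν₀ :=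
    integrable_cylinder (f := fun τ x => u τ x ^ α) (isCompact_frontier hUb) ae_mem_frontier
      (hcyl hα0.le)
  have hmeas : AEStronglyMeasurable (fun q : ℝ × EuclideanSpace ℝ (Fin n) => φt q.1 q.2) ν₀ := by
    refine hφ.aestronglyMeasurable.mono_ac ?_
    rw [hν₀]
    exact (Measure.absolutelyContinuous_of_le
      (Measure.restrict_mono (Ioc_subset_Ioc_right htT) le_rfl)).prod .rfl
  have hg : Integrable (fun q : ℝ × EuclideanSpace ℝ (Fin n) =>
      φt q.1 q.2 * u q.1 q.2 ^ (lam + 1)) ν₀ := by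
    refine (hΦ.add huα).mono' (hmeas.mul (integrable_cylinder (f := fun τ x => u τ x ^ (lam + 1))
      (isCompact_frontier hUb) ae_mem_frontier (hcyl hl1.le)).1) ?_
    filter_upwards [hmem₀] with q hq
    have hq0 := hu0 q.1 (Ioc_subset_Icc_self hq.1) q.2 hq.2
    rw [norm_mul, Real.norm_of_nonneg (Real.rpow_nonneg hq0 _)]
    exact mul_rpow_le_rpow_add_rpow (norm_nonneg _) hq0 hl1 hα
  have hgν := hg.mono_measure hνle
  have hId : ∀ᵐ x ∂(surf U),
      (lam + 1) * ∫ τ in Ioc ε t, φ τ x * u τ x ^ lam * deriv (fun s => u s x) τ =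
        φ t x * u t x ^ (lam + 1) - φ ε x * u ε x ^ (lam + 1) -
          ∫ τ in Ioc ε t, φt τ x * u τ x ^ (lam + 1) := by
    filter_upwards [hφ.deriv, ae_mem_frontier] with x hx hxf
    exact integral_mul_rpow_mul_deriv (z := fun s => u s x) (ψ := fun s => φ s x)
      (η := fun s => φt s x) hεt hlam.le
      (fun τ hτ => hu0 τ ⟨hε.le.trans hτ.1, hτ.2⟩ x hxf)
      (fun s hs' r hr => hL x (frontier_subset_closure hxf) s (hsubT hs') r (hsubT hr))
      (hx ε t hε hεt htT).1 (fun τ hτ => (hx ε τ hε hτ.1 (hτ.2.trans htT)).2)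
  have hslice : ∀ τ ∈ Icc 0 T, Integrable (fun x => φ τ x * u τ x ^ (lam + 1)) (surf U) :=
    fun τ hτ => integrable_slice (isCompact_frontier hUb) ae_mem_frontier
      (continuousOn_slice_right (f := fun τ x => φ τ x * u τ x ^ (lam + 1))
        (hs.continuousOn_boundary_energy hφ hl1.le) hτ)
  have i1 := hslice t (hsub0 ⟨hεt, le_rfl⟩)
  have i2 := hslice ε (hsub0 ⟨le_rfl, hεt⟩)
  have i12 := i1.sub i2
  rw [← integral_const_mul, integral_congr_ae hId,
    integral_sub (f := fun x => φ t x * u t x ^ (lam + 1) - φ ε x * u ε x ^ (lam + 1)) i12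
      hgν.integral_prod_right, integral_sub i1 i2]
  have h1 : ∫ x, (∫ τ in Ioc ε t, φt τ x * u τ x ^ (lam + 1)) ∂(surf U) =
      ∫ q, φt q.1 q.2 * u q.1 q.2 ^ (lam + 1) ∂ν := (integral_prod_symm _ hgν).symm
  have h2 : ∫ τ in Ioc 0 t, ∫ x, u τ x ^ α ∂(surf U) = ∫ q, u q.1 q.2 ^ α ∂ν₀ :=
    (integral_prod _ huα).symm
  have h3 : ∫ q, φt q.1 q.2 * u q.1 q.2 ^ (lam + 1) ∂ν ≤
      (∫ q, ‖φt q.1 q.2‖ ^ qq ∂ν₀) + ∫ q, u q.1 q.2 ^ α ∂ν₀ := by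
    rw [← integral_add hΦ huα]
    refine le_trans (integral_mono_ae hgν
      ((hΦ.add huα).mono_measure hνle) ?_) (integral_mono_measure hνle ?_ (hΦ.add huα))
    · filter_upwards [ae_mono hνle hmem₀] with q hq
      have hq0 := hu0 q.1 (Ioc_subset_Icc_self hq.1) q.2 hq.2
      exact (mul_le_mul_of_nonneg_right (Real.le_norm_self _) (Real.rpow_nonneg hq0 _)).trans
        (mul_rpow_le_rpow_add_rpow (norm_nonneg _) hq0 hl1 hα)
    · filter_upwards [hmem₀] with q hq
      have hq0 := hu0 q.1 (Ioc_subset_Icc_self hq.1) q.2 hq.2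
      exact add_nonneg (Real.rpow_nonneg (norm_nonneg _) _) (Real.rpow_nonneg hq0 _)
  rw [h1, h2]
  linarith

/-- The energy inequality on the whole interval `[0, t]`. The number `I` is an upper
bound for the integral of `(u^lam)_t u_t`, whose integrand is the dissipation divided by `lam`. -/
theorem energy_inequality (hs : IsSolution U P lam T φ u₀ u Du w) (hφ : IsBoundaryData U T φ φt)
    (hn : 1 ≤ n) (hU : IsOpen U) (hUb : Bornology.IsBounded U) (hC1 : HasC1Boundary U)
    (hlam : 0 < lam) (hlam1 : lam ≤ 1) {α t : ℝ} (hα : lam + 1 < α) (ht : t ∈ Ioc 0 T)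
    (hΦ : Integrable (fun q : ℝ × EuclideanSpace ℝ (Fin n) =>
      ‖φt q.1 q.2‖ ^ (α / (α - (lam + 1)))) ((volume.restrict (Ioc 0 t)).prod (surf U))) :
    ∃ I : ℝ, 0 ≤ I ∧
      ∫⁻ τ in Ioc 0 t, ∫⁻ x in U, ENNReal.ofReal (u τ x ^ (1 - lam) * |w τ x| ^ 2) ≤
        ENNReal.ofReal (lam * I) ∧
      I + (∫ x in U, P.energy ‖Du t x‖) +
          (∫ x, φ t x * u t x ^ (lam + 1) ∂(surf U)) / (lam + 1) ≤
        (∫ x in U, P.energy ‖Du 0 x‖) + (∫ x, φ 0 x * u 0 x ^ (lam + 1) ∂(surf U)) / (lam + 1) +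
        ((∫ q, ‖φt q.1 q.2‖ ^ (α / (α - (lam + 1))) ∂((volume.restrict (Ioc 0 t)).prod (surf U))) +
          ∫ τ in Ioc 0 t, ∫ x, u τ x ^ α ∂(surf U)) / (lam + 1) := by
  have hSf := surf_lt_top hn hU hUb hC1
  have hl1 : 0 < lam + 1 := by linarith
  set R := ((∫ q, ‖φt q.1 q.2‖ ^ (α / (α - (lam + 1)))
    ∂((volume.restrict (Ioc 0 t)).prod (surf U))) +
      ∫ τ in Ioc 0 t, ∫ x, u τ x ^ α ∂(surf U)) / (lam + 1) with hR
  set A : ℝ → ℝ := fun s => (∫ x in U, P.energy ‖Du s x‖) +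
    (∫ x, φ s x * u s x ^ (lam + 1) ∂(surf U)) / (lam + 1) with hA
  have hAc : ContinuousOn A (Icc 0 T) := hs.continuousOn_energy.add
    ((continuousOn_integral_cylinder (f := fun τ x => φ τ x * u τ x ^ (lam + 1))
      (isCompact_frontier hUb) ae_mem_frontier
      (hs.continuousOn_boundary_energy hφ hl1.le)).div_const _)
  set M : ℝ → ℝ := fun s => A s + R - A t with hM
  have hMc : ContinuousOn M (Icc 0 t) :=
    ((hAc.mono (Icc_subset_Icc_right ht.2)).add continuousOn_const).sub continuousOn_const
  have hstep : ∀ ε ∈ Ioc 0 t, 0 ≤ M ε ∧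
      ∫⁻ τ in Ioc ε t, ∫⁻ x in U, ENNReal.ofReal (u τ x ^ (1 - lam) * |w τ x| ^ 2) ≤
        ENNReal.ofReal (lam * M ε) := by
    intro ε hε
    have h1 := hs.energy_le_of_deriv hφ hn hU hUb hC1 hlam hε.1 hε.2 ht.2
    have h2 := hs.boundary_energy_le hφ hn hU hUb hC1 hlam hα hε.1 hε.2 ht.2 hΦ
    obtain ⟨h3, h4⟩ := hs.integral_mul_deriv hU hUb hlam hlam1 hε.1 hε.2 ht.2
    have h5 := div_le_div_of_nonneg_right h2 hl1.le
    rw [mul_div_cancel_left₀ _ hl1.ne', sub_div, sub_div, ← hR] at h5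
    have h6 : ∫ x in U, ∫ τ in Ioc ε t, w τ x * deriv (fun s => u s x) τ ≤ M ε := by
      simp only [hM, hA]
      linarith
    refine ⟨h3.trans h6, h4.le.trans (ENNReal.ofReal_le_ofReal ?_)⟩
    exact mul_le_mul_of_nonneg_left h6 hlam.le
  have hM0 : 0 ≤ M 0 := by
    have := nonpos_of_continuousOn_Icc ht.1 hMc.neg fun s hs' =>
      neg_nonpos.2 (hstep s hs').1
    simpa using this
  refine ⟨M 0, hM0, ?_, ?_⟩
  swap
  · simp only [hM, hA]
    linarith
  have hδ : ∀ δ ∈ Ioc 0 t,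
      ∫⁻ τ in Ioc δ t, ∫⁻ x in U, ENNReal.ofReal (u τ x ^ (1 - lam) * |w τ x| ^ 2) ≤
        ENNReal.ofReal (lam * M 0) := by
    intro δ hδ
    have h1 : Tendsto M (𝓝[>] 0) (𝓝 (M 0)) :=
      (hMc 0 ⟨le_rfl, ht.1.le⟩).mono_left (nhdsWithin_le_of_mem
        (mem_of_superset (Ioc_mem_nhdsGT ht.1) Ioc_subset_Icc_self))
    have h2 := (ENNReal.continuous_ofReal.tendsto _).comp (h1.const_mul lam)
    refine ge_of_tendsto h2 ?_
    filter_upwards [Ioc_mem_nhdsGT hδ.1] with s hs'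
    exact (lintegral_mono_set (Ioc_subset_Ioc_left hs'.2)).trans
      (hstep s ⟨hs'.1, hs'.2.trans hδ.2⟩).2
  have hUn : Ioc 0 t = ⋃ k : ℕ, Ioc (t * (1 / ((k : ℝ) + 1))) t := by
    ext τ
    simp only [mem_Ioc, mem_iUnion]
    constructor
    · rintro ⟨h1, h2⟩
      obtain ⟨k, hk⟩ := exists_nat_one_div_lt (div_pos h1 ht.1)
      refine ⟨k, ?_, h2⟩
      rwa [lt_div_iff₀ ht.1, mul_comm] at hk
    · rintro ⟨k, h1, h2⟩
      have : 0 < t * (1 / ((k : ℝ) + 1)) := mul_pos ht.1 (by positivity)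
      exact ⟨this.trans h1, h2⟩
  have hdir : Monotone fun k : ℕ => Ioc (t * (1 / ((k : ℝ) + 1))) t := by
    intro k l hkl
    refine Ioc_subset_Ioc_left (mul_le_mul_of_nonneg_left ?_ ht.1.le)
    exact one_div_le_one_div_of_le (by positivity) (by
      have : (k : ℝ) ≤ l := by exact_mod_cast hkl
      linarith)
  rw [hUn, setLIntegral_iUnion_of_directed _ hdir.directed_le]
  refine iSup_le fun k => hδ _ ⟨mul_pos ht.1 (by positivity), ?_⟩
  refine mul_le_of_le_one_right ht.1.le ?_
  rw [div_le_one (by positivity)]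
  linarith [(Nat.cast_nonneg k : (0 : ℝ) ≤ k)]

end IsSolution

/-! ### The gradient estimate -/

/-- The boundary contribution to the energy at a fixed time is controlled by a small multiple of
the gradient term, by `∫ v^α` and by a power of the negative part of the boundary coefficient. -/
theorem exists_boundary_energy_bound {n : ℕ} (hn : 1 ≤ n) {U : Set (EuclideanSpace ℝ (Fin n))}
    (hU : IsOpen U) (hUb : Bornology.IsBounded U) (hC1 : HasC1Boundary U) {a lam α ε : ℝ}
    (ha1 : a < 1) (hlam : 0 < lam) (ha : 1 - lam < a) (hα : lam + 1 + mu0 a lam < α)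
    (hε : 0 < ε) :
    ∃ C : ℝ, 0 ≤ C ∧ ∀ v D, IsNonnegSobolev U (2 - a) v D →
      ∀ (φ : EuclideanSpace ℝ (Fin n) → ℝ) (B : ℝ), ContinuousOn φ (frontier U) → 0 ≤ B →
        (∀ᵐ x ∂(surf U), -B ≤ φ x) →
        -∫ x, φ x * v x ^ (lam + 1) ∂(surf U) ≤
          ε * (∫ x in U, ‖D x‖ ^ (2 - a)) + C * (1 + B ^ mu3 a lam α + ∫ x in U, v x ^ α) := by
  have hμ0 := mu0_pos ha1 ha
  set r := lam + 1 + mu0 a lam with hr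
  have hα0 : 0 < α := by linarith
  have hl1 : 0 < lam + 1 := by linarith
  have hαr : 0 < α - r := by linarith
  have h1a : 0 < 1 - a := by linarith
  set p := 2 - a with hp
  have hp1 : 1 < p := by linarith
  set d := a - (1 - lam) with hd
  have hdp : d + p = lam + 1 := by rw [hd, hp]; ring
  have hpa : p - 1 = 1 - a := by rw [hp]; ring
  have hμ3 : mu3 a lam α = p / (p - 1) * (α / (α - r)) := by
    rw [mu3, hpa, ← hr, ← hp]; field_simp
  have hexp : α / (α - (lam + 1)) ≤ mu3 a lam α := by
    rw [hμ3, ← one_mul (α / (α - (lam + 1)))]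
    refine mul_le_mul ?_ ?_ (div_nonneg hα0.le (by linarith)) (by rw [hpa]; positivity)
    · rw [one_le_div (by linarith)]; linarith
    · exact div_le_div_of_nonneg_left hα0.le hαr (by linarith)
  obtain ⟨CT, hCT, hT⟩ := exists_trace_rpow hn hU hUb hC1 hp1.le
  obtain ⟨C₁, hC₁, hY⟩ := exists_young_trace (d := d) (β := d + p) hp1 le_rfl (by
    rw [hdp, hpa]
    have : 0 ≤ d / (1 - a) := div_nonneg (by linarith) h1a.le
    linarith) hε
  have hdμ : d + p + d / (p - 1) = r := by rw [hdp, hpa, hr, mu0]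
  rw [hdμ, sub_self] at hY
  simp only [Real.rpow_zero, one_mul, hdp, add_sub_cancel_right] at hY
  set c := (CT * (lam + 1)) ^ (p / (p - 1)) with hc
  have hc0 : 0 ≤ c := by positivity
  set m := volume.real U with hm
  have hm0 : 0 ≤ m := measureReal_nonneg
  refine ⟨CT * (m + 1) + C₁ * c * (m + 1), by positivity, fun v D h φ B hφ hB hφB => ?_⟩
  have hbd : ∀ᵐ x ∂(surf U), 0 ≤ v x := by
    filter_upwards [ae_mem_frontier] with x hx
    exact h.nonneg x (frontier_subset_closure hx)
  have hvl : ContinuousOn (fun x => v x ^ (lam + 1)) (frontier U) :=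
    (h.continuousOn_rpow hl1.le).mono frontier_subset_closure
  have hfin := isFiniteMeasure_restrict hUb
  have h1 : -∫ x, φ x * v x ^ (lam + 1) ∂(surf U) ≤ B * ∫ x, v x ^ (lam + 1) ∂(surf U) := by
    rw [← integral_const_mul, ← integral_neg]
    refine integral_mono_ae (ContinuousOn.integrable_surf hn hU hUb hC1 (hφ.mul hvl)).neg
      ((ContinuousOn.integrable_surf hn hU hUb hC1 hvl).const_mul B) ?_
    filter_upwards [hφB, hbd] with x h1 h2
    have := mul_le_mul_of_nonneg_right h1 (Real.rpow_nonneg h2 (lam + 1))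
    linarith
  have h2 := mul_le_mul_of_nonneg_left (hT v D h (lam + 1) (by linarith)) hB
  rw [add_sub_cancel_right] at h2
  have hvα := h.integrableOn_rpow hUb hα0.le
  have hYa := h.integral_rpow_nonneg hU α
  have hBm : 0 ≤ B ^ mu3 a lam α := Real.rpow_nonneg hB _
  have hconst : ∀ k : ℝ, ∫ x in U, (k + v x ^ α) = m * k + ∫ x in U, v x ^ α := fun k => by
    rw [integral_add (integrable_const k) hvα]
    simp [hm]
  have h3 : B * ∫ x in U, v x ^ (lam + 1) ≤
      m * (1 + B ^ mu3 a lam α) + ∫ x in U, v x ^ α := by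
    rw [← hconst, ← integral_const_mul]
    refine integral_mono_ae ((h.integrableOn_rpow hUb hl1.le).const_mul B)
      ((integrable_const _).add hvα) ?_
    filter_upwards [h.ae_nonneg hU] with x hx
    have g1 := mul_rpow_le_rpow_add_rpow hB hx hl1 (by linarith : lam + 1 < α)
    have g2 := rpow_le_one_add_rpow hB (div_nonneg hα0.le (by linarith)) hexp
    linarith
  have h4 : B * (CT * (lam + 1)) * (∫ x in U, v x ^ lam * ‖D x‖) ≤
      ε * (∫ x in U, ‖D x‖ ^ p) + C₁ * c * (m * B ^ mu3 a lam α + ∫ x in U, v x ^ α) := by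
    have i1 := (h.integrableOn_norm_rpow (by linarith)).const_mul ε
    have i2 : IntegrableOn (fun x => C₁ * c * (B ^ mu3 a lam α + v x ^ α)) U :=
      ((integrable_const (B ^ mu3 a lam α)).add hvα).const_mul (C₁ * c)
    rw [← hconst, ← integral_const_mul, ← integral_const_mul, ← integral_const_mul,
      ← integral_add i1 i2]
    refine integral_mono_ae ((h.integrableOn_rpow_mul hU hUb hlam.le
      (h.integrableOn_grad hUb hp1.le).norm).const_mul _) (i1.add i2) ?_
    filter_upwards [h.ae_nonneg hU] with x hx
    have g1 := hY (B * (CT * (lam + 1))) (v x) ‖D x‖ (by positivity) hx (norm_nonneg _)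
    have hBp : 0 ≤ B ^ (p / (p - 1)) := Real.rpow_nonneg hB _
    have g2 := mul_rpow_le_rpow_add_rpow hBp hx (by linarith : 0 < r) hα
    rw [← Real.rpow_mul hB, ← hμ3] at g2
    rw [Real.mul_rpow hB (by positivity), ← hc] at g1
    have g3 := mul_le_mul_of_nonneg_left g2 (mul_nonneg hC₁ hc0)
    refine g1.trans (add_le_add le_rfl ?_)
    refine le_trans (le_of_eq ?_) g3
    ring
  have h5 := mul_le_mul_of_nonneg_left h3 hCT
  have hCc : 0 ≤ C₁ * c := mul_nonneg hC₁ hc0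
  clear_value m c
  generalize B ^ mu3 a lam α = Q at *
  generalize (∫ x in U, v x ^ α) = Y at *
  have h6 : m * (1 + Q) + Y ≤ (m + 1) * (1 + Q + Y) := by nlinarith
  have h7 : m * Q + Y ≤ (m + 1) * (1 + Q + Y) := by nlinarith
  have h8 := mul_le_mul_of_nonneg_left h6 hCT
  have h9 := mul_le_mul_of_nonneg_left h7 hCc
  linarith

lemma IsNonnegSobolev.lintegral_enorm_rpow {n : ℕ} {U : Set (EuclideanSpace ℝ (Fin n))} {p : ℝ}
    {v : EuclideanSpace ℝ (Fin n) → ℝ}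
    {D : EuclideanSpace ℝ (Fin n) → EuclideanSpace ℝ (Fin n)} (h : IsNonnegSobolev U p v D)
    (hp : 0 < p) : ∫⁻ x in U, ‖D x‖ₑ ^ p = ENNReal.ofReal (∫ x in U, ‖D x‖ ^ p) := by
  rw [ofReal_integral_eq_lintegral_ofReal (h.integrableOn_norm_rpow hp)
    (ae_of_all _ fun x => by positivity)]
  refine lintegral_congr fun x => ?_
  rw [← ofReal_norm, ENNReal.ofReal_rpow_of_nonneg (norm_nonneg _) hp.le]

/-- Up to the volume of the domain, the total energy is comparable to the integral of the
`(2 - a)`-th power of the gradient. -/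
lemma IsNonnegSobolev.exists_energy_bounds (P : GenPoly) : ∃ C : ℝ, 0 < C ∧ ∀ {n : ℕ}
    {U : Set (EuclideanSpace ℝ (Fin n))}, Bornology.IsBounded U → ∀ v D,
    IsNonnegSobolev U (2 - P.a) v D →
      (∫ x in U, ‖D x‖ ^ (2 - P.a)) ≤ C * (∫ x in U, P.energy ‖D x‖) + C * volume.real U ∧
      (∫ x in U, P.energy ‖D x‖) ≤ C * ∫ x in U, ‖D x‖ ^ (2 - P.a) := by
  obtain ⟨CK, hCK, hKp⟩ := P.exists_rpow_le
  obtain ⟨CR, hCR, hRp⟩ := P.exists_root_le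
  have ha1 := P.a_lt_one
  refine ⟨2 * CK + CR, by positivity, fun {n U} hUb v D h => ?_⟩
  have hfin := isFiniteMeasure_restrict hUb
  have iE := integrable_energy P h.memLp
  have iD := h.integrableOn_norm_rpow (by linarith : 0 < 2 - P.a)
  have hX0 : 0 ≤ ∫ x in U, ‖D x‖ ^ (2 - P.a) := integral_nonneg fun x => by positivity
  have hE0 : ∀ ξ : EuclideanSpace ℝ (Fin n), 0 ≤ P.energy ‖ξ‖ := fun ξ => by
    have := P.half_le_energy (norm_nonneg ξ)
    have := mul_nonneg (norm_nonneg ξ) (P.root_nonneg (norm_nonneg ξ))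
    linarith
  constructor
  · have h1 : (∫ x in U, ‖D x‖ ^ (2 - P.a)) ≤ ∫ x in U, (2 * CK * P.energy ‖D x‖ + CK) := by
      refine integral_mono iD ((iE.const_mul _).add (integrable_const _)) fun x => ?_
      have g1 := hKp ‖D x‖ (norm_nonneg _)
      have g2 := mul_le_mul_of_nonneg_left (P.half_le_energy (norm_nonneg (D x))) hCK.le
      simp only
      linarith
    rw [integral_add (iE.const_mul _) (integrable_const _), integral_const_mul] at h1
    simp only [integral_const, MeasurableSet.univ, measureReal_restrict_apply, univ_inter,
      smul_eq_mul] at h1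
    have h2 : 0 ≤ ∫ x in U, P.energy ‖D x‖ := integral_nonneg fun x => hE0 (D x)
    have h3 : 0 ≤ volume.real U := measureReal_nonneg
    nlinarith [mul_nonneg hCR.le h2, mul_nonneg hCR.le h3, mul_nonneg hCK.le h3]
  · have h1 : (∫ x in U, P.energy ‖D x‖) ≤ ∫ x in U, CR * ‖D x‖ ^ (2 - P.a) := by
      refine integral_mono iE (iD.const_mul _) fun x => ?_
      have g1 := P.energy_le (norm_nonneg (D x))
      have g2 := mul_le_mul_of_nonneg_left (hRp ‖D x‖ (norm_nonneg _)) (norm_nonneg (D x))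
      have g3 : ‖D x‖ * ‖D x‖ ^ (1 - P.a) = ‖D x‖ ^ (2 - P.a) := by
        rw [mul_comm, ← Real.rpow_add_one' (norm_nonneg _) (by linarith)]
        congr 1; ring
      simp only
      rw [← g3]
      linarith
    rw [integral_const_mul] at h1
    nlinarith [mul_nonneg hCK.le hX0]

end Forchheimer


theorem theorem3p2 (n : ℕ) (hn : 2 ≤ n) (U : Set (EuclideanSpace ℝ (Fin n)))
    (hU_open : IsOpen U) (hU_bdd : Bornology.IsBounded U) (hU_C1 : Forchheimer.HasC1Boundary U)
    (P : Forchheimer.GenPoly) (lam : ℝ) (hlam_pos : 0 < lam) (hlam_le : lam ≤ 1)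
    (ha : 1 - lam < P.a) (α : ℝ)
    (hα : max (n * Forchheimer.mu0 P.a lam) (lam + 1 + Forchheimer.mu0 P.a lam) < α) :
    ∃ C₃ : ℝ, 0 < C₃ ∧ ∃ C : ℝ, 0 < C ∧
      ∀ (T : ℝ), 0 < T →
      ∀ (φ φt : ℝ → EuclideanSpace ℝ (Fin n) → ℝ) (u₀ : EuclideanSpace ℝ (Fin n) → ℝ)
        (u : ℝ → EuclideanSpace ℝ (Fin n) → ℝ)
        (Du : ℝ → EuclideanSpace ℝ (Fin n) → EuclideanSpace ℝ (Fin n))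
        (w : ℝ → EuclideanSpace ℝ (Fin n) → ℝ),
      Forchheimer.IsBoundaryData U T φ φt →
      Forchheimer.IsSolution U P lam T φ u₀ u Du w →
      Forchheimer.TimeCondition U P.a lam α C₃ T φ u₀ →
      ∀ t ∈ Set.Ioc 0 T,
        (∫⁻ τ in Set.Ioc 0 t, ∫⁻ x in U, ENNReal.ofReal (u τ x ^ (1 - lam) * |w τ x| ^ 2))
            + (∫⁻ x in U, ‖Du t x‖ₑ ^ (2 - P.a))
          ≤ ENNReal.ofReal C * Forchheimer.E0 U P.a lam α φ u₀ (Du 0)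
            + ENNReal.ofReal C * Forchheimer.calK U P.a lam α φ φt t := by
  open Forchheimer in
  have ha1 := P.a_lt_one
  have hμ0 := mu0_pos ha1 ha
  have hα1 : n * mu0 P.a lam < α := (le_max_left _ _).trans_lt hα
  have hα2 : lam + 1 + mu0 P.a lam < α := (le_max_right _ _).trans_lt hα
  have hα3 : lam + 1 < α := by linarith
  have hα0 : 0 < α := by linarith
  have hl1 : 0 < lam + 1 := by linarith
  have hn1 : 1 ≤ n := by omega
  have hSf := surf_lt_top hn1 hU_open hU_bdd hU_C1
  obtain ⟨C₃, hC₃, Cb, hCb, hmoment⟩ :=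
    exists_moment_bound hn hU_open hU_bdd hU_C1 P hlam_pos ha hα1 hα3
  obtain ⟨Ce, hCe, hE⟩ := IsNonnegSobolev.exists_energy_bounds P
  obtain ⟨Ca, hCa, hbdry⟩ := exists_boundary_energy_bound (ε := 1 / (2 * Ce)) hn1 hU_open hU_bdd
    hU_C1 ha1 hlam_pos ha hα2 (by positivity)
  set m := volume.real U with hm
  have hm0 : 0 ≤ m := measureReal_nonneg
  set C' := m + 3 * Ca + Cb + Ce + 1 with hC'
  have hC'0 : 0 < C' := by positivity
  refine ⟨C₃, hC₃, (1 + 2 * Ce) * C', by positivity,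
    fun T hT φ φt u₀ u Du w hφ hs hTC t ht => ?_⟩
  have htT := Ioc_subset_Icc_self ht
  have h0T : (0 : ℝ) ∈ Icc 0 T := ⟨le_rfl, hT.le⟩
  have hNt := hs.isNonnegSobolev htT
  have hN0 := hs.isNonnegSobolev h0T
  have hlt := negNorm_lt_top hU_bdd (hφ.continuousOn_slice htT)
  have hμ3 : 0 ≤ mu3 P.a lam α := by
    rw [mu3]
    have : 0 < α - (lam + 1 + mu0 P.a lam) := by linarith
    have : 0 < 1 - P.a := by linarith
    have : 0 < 2 - P.a := by linarith
    positivity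
  set B := (negNorm U φ t).toReal with hB
  have hB0 : 0 ≤ B := ENNReal.toReal_nonneg
  set ν := (volume.restrict (Ioc 0 t)).prod (surf U) with hν
  have hmeas : AEStronglyMeasurable (fun q : ℝ × EuclideanSpace ℝ (Fin n) => φt q.1 q.2) ν :=
    hφ.aestronglyMeasurable.mono_measure
      (Measure.prod_mono (Measure.restrict_mono (Ioc_subset_Ioc_right ht.2) le_rfl) le_rfl)
  have hqq : 0 ≤ α / (α - (lam + 1)) := div_nonneg hα0.le (by linarith)
  have hlint : ∫⁻ τ in Ioc 0 t, ∫⁻ x, ‖φt τ x‖ₑ ^ (α / (α - lam - 1)) ∂(surf U) =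
      ∫⁻ q, ENNReal.ofReal (‖φt q.1 q.2‖ ^ (α / (α - (lam + 1)))) ∂ν := by
    rw [hν, lintegral_prod _ (by
      exact (hmeas.norm.aemeasurable.pow_const _).ennreal_ofReal), sub_sub]
    refine lintegral_congr fun τ => lintegral_congr fun x => ?_
    rw [← ofReal_norm, ENNReal.ofReal_rpow_of_nonneg (norm_nonneg _) hqq]
  -- the estimate is trivial if the integral of the time derivative of the data is infinite
  rcases eq_or_ne (∫⁻ q, ENNReal.ofReal (‖φt q.1 q.2‖ ^ (α / (α - (lam + 1)))) ∂ν) ⊤ with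
    htop | hfin
  · have : calK U P.a lam α φ φt t = ⊤ := by rw [calK, hlint, htop, add_top]
    rw [this, ENNReal.mul_top (by simpa using by positivity), add_top]
    exact le_top
  have hΦ : Integrable (fun q : ℝ × EuclideanSpace ℝ (Fin n) =>
      ‖φt q.1 q.2‖ ^ (α / (α - (lam + 1)))) ν := by
    refine ⟨(hmeas.norm.aemeasurable.pow_const _).aestronglyMeasurable, ?_⟩
    rw [hasFiniteIntegral_iff_ofReal (ae_of_all _ fun q => by positivity)]
    exact hfin.lt_top
  obtain ⟨hYt, hSt⟩ := hmoment T hT φ φt u₀ u Du w hφ hs hTC t ht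
  obtain ⟨I, hI0, hIle, hEn⟩ := hs.energy_inequality hφ hn1 hU_open hU_bdd hU_C1 hlam_pos hlam_le
    hα3 ht hΦ
  have hE0 := (hE hU_bdd _ _ hN0).2
  have hEt := (hE hU_bdd _ _ hNt).1
  have hbt := hbdry _ _ hNt (φ t) B (hφ.continuousOn_slice htT) hB0
    (ae_neg_negNorm_le hU_bdd (hφ.continuousOn_slice htT))
  have hφ0 := hφ.continuousOn_slice h0T
  have hu0 : ContinuousOn (fun x => u 0 x ^ (lam + 1)) (frontier U) :=
    (hN0.continuousOn_rpow hl1.le).mono frontier_subset_closure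
  have iF : Integrable (fun x => u 0 x ^ (lam + 1) * max (φ 0 x) 0) (surf U) :=
    ContinuousOn.integrable_surf hn1 hU_open hU_bdd hU_C1
      (hu0.mul (hφ0.sup continuousOn_const))
  have hbd0 : ∀ᵐ x ∂(surf U), 0 ≤ u 0 x ^ (lam + 1) := by
    filter_upwards [ae_mem_frontier] with x hx
    exact Real.rpow_nonneg (hs.nonneg 0 h0T x (frontier_subset_closure hx)) _
  have hF0nn : 0 ≤ᵐ[surf U] fun x => u 0 x ^ (lam + 1) * max (φ 0 x) 0 := by
    filter_upwards [hbd0] with x hx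
    exact mul_nonneg hx (le_max_right _ _)
  have hF0 : ∫ x, φ 0 x * u 0 x ^ (lam + 1) ∂(surf U) ≤
      ∫ x, u 0 x ^ (lam + 1) * max (φ 0 x) 0 ∂(surf U) := by
    refine integral_mono_ae (ContinuousOn.integrable_surf hn1 hU_open hU_bdd hU_C1
      (hφ0.mul hu0)) iF ?_
    filter_upwards [hbd0] with x hx
    have := mul_le_mul_of_nonneg_left (le_max_left (φ 0 x) 0) hx
    linarith
  have hY0 := hN0.integral_rpow_nonneg hU_open α
  have hX0 : 0 ≤ ∫ x in U, ‖Du 0 x‖ ^ (2 - P.a) := integral_nonneg fun x => by positivity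
  have hXt : 0 ≤ ∫ x in U, ‖Du t x‖ ^ (2 - P.a) := integral_nonneg fun x => by positivity
  have hYt0 := hNt.integral_rpow_nonneg hU_open α
  have hFp := integral_nonneg_of_ae hF0nn
  have hQ0 : 0 ≤ B ^ mu3 P.a lam α := Real.rpow_nonneg hB0 _
  have hΦ0 : 0 ≤ ∫ q, ‖φt q.1 q.2‖ ^ (α / (α - (lam + 1))) ∂ν :=
    integral_nonneg fun q => by positivity
  have hp0 : 0 < 2 - P.a := by linarith
  have hE0eq : E0 U P.a lam α φ u₀ (Du 0) = ENNReal.ofReal ((∫ x in U, u 0 x ^ α) +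
      (∫ x in U, ‖Du 0 x‖ ^ (2 - P.a)) +
        ∫ x, u 0 x ^ (lam + 1) * max (φ 0 x) 0 ∂(surf U)) := by
    rw [E0, hs.initMass_eq hU_open hU_bdd hT.le hα0.le, hN0.lintegral_enorm_rpow hp0,
      ENNReal.ofReal_add (by positivity) hFp, ENNReal.ofReal_add hY0 hX0,
      ofReal_integral_eq_lintegral_ofReal iF hF0nn]
    congr 1
    refine lintegral_congr_ae ?_
    filter_upwards [ae_mem_frontier] with x hx
    rw [hs.initial x (frontier_subset_closure hx)]
  have hKeq : calK U P.a lam α φ φt t = ENNReal.ofReal (1 + B ^ mu3 P.a lam α +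
      ∫ q, ‖φt q.1 q.2‖ ^ (α / (α - (lam + 1))) ∂ν) := by
    rw [calK, hlint, ENNReal.ofReal_add (by positivity) hΦ0, ENNReal.ofReal_add zero_le_one hQ0,
      ENNReal.ofReal_one, ← ENNReal.ofReal_rpow_of_nonneg hB0 hμ3, hB,
      ENNReal.ofReal_toReal hlt.ne,
      ofReal_integral_eq_lintegral_ofReal hΦ (ae_of_all _ fun q => by positivity)]
  rw [hE0eq, hKeq, ← mul_add, ← ENNReal.ofReal_add (by positivity) (by positivity),
    ← ENNReal.ofReal_mul (by positivity), hNt.lintegral_enorm_rpow hp0]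
  refine (add_le_add hIle le_rfl).trans ?_
  rw [← ENNReal.ofReal_add (by positivity) hXt]
  refine ENNReal.ofReal_le_ofReal ?_
  clear hE0eq hKeq hlint hfin hΦ hIle
  generalize (∫ q, ‖φt q.1 q.2‖ ^ (α / (α - (lam + 1))) ∂ν) = Φ at *
  generalize (∫ x, u 0 x ^ (lam + 1) * max (φ 0 x) 0 ∂(surf U)) = F₁ at *
  generalize (∫ x, φ 0 x * u 0 x ^ (lam + 1) ∂(surf U)) = F₀ at *
  generalize (∫ x, φ t x * u t x ^ (lam + 1) ∂(surf U)) = Ft at *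
  generalize (∫ τ in Ioc 0 t, ∫ x, u τ x ^ α ∂(surf U)) = S at *
  generalize (∫ x in U, u t x ^ α) = Yt at *
  generalize (∫ x in U, u 0 x ^ α) = Y₀ at *
  generalize (∫ x in U, ‖Du t x‖ ^ (2 - P.a)) = Xt at *
  generalize (∫ x in U, ‖Du 0 x‖ ^ (2 - P.a)) = X₀ at *
  generalize (∫ x in U, P.energy ‖Du t x‖) = Et at *
  generalize (∫ x in U, P.energy ‖Du 0 x‖) = G₀ at *
  generalize B ^ mu3 P.a lam α = Q at *
  have hdiv : ∀ z b : ℝ, z ≤ b → 0 ≤ b → z / (lam + 1) ≤ b := fun z b hz hb => by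
    rw [div_le_iff₀ hl1]; nlinarith
  have d1 := hdiv _ _ hF0 hFp
  have d2 : (Φ + S) / (lam + 1) ≤ Φ + Cb * (1 + Y₀) :=
    hdiv _ _ (by linarith) (by positivity)
  have d3 := hdiv _ _ hbt (by positivity)
  have hCaY : Ca * (1 + Q + Yt) ≤ Ca * (2 + Q + 2 * Y₀) :=
    mul_le_mul_of_nonneg_left (by linarith) hCa
  -- half of the energy at the final time absorbs the gradient part of the boundary energy
  have hXE : 1 / (2 * Ce) * Xt ≤ Et / 2 + m / 2 := by
    rw [one_div_mul_eq_div, div_le_iff₀ (by positivity)]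
    linarith
  have hmain : I + 1 / (2 * Ce) * Xt ≤ C' * (Y₀ + X₀ + F₁ + (1 + Q + Φ)) := by
    have hCX : 1 / (2 * Ce) * Xt * 2 ≤ Et + m := by linarith
    rw [neg_div] at d3
    have : I + 1 / (2 * Ce) * Xt ≤
        m + Ce * X₀ + F₁ + Φ + Cb * (1 + Y₀) + Ca * (2 + Q + 2 * Y₀) := by linarith
    refine this.trans ?_
    rw [hC']
    have p1 := mul_nonneg hm0 (by positivity : 0 ≤ Y₀ + X₀ + F₁ + (Q + Φ))
    have p2 := mul_nonneg hCa (by positivity : 0 ≤ 3 * (X₀ + F₁ + Φ) + 2 * Q + Y₀ + 1)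
    have p3 := mul_nonneg hCb.le (by positivity : 0 ≤ X₀ + F₁ + (Q + Φ))
    have p4 := mul_nonneg hCe.le (by positivity : 0 ≤ Y₀ + F₁ + (1 + Q + Φ))
    linarith
  have hsplit : lam * I + Xt ≤ (1 + 2 * Ce) * (I + 1 / (2 * Ce) * Xt) := by
    have e : (1 + 2 * Ce) * (I + 1 / (2 * Ce) * Xt) =
        I + 2 * Ce * I + 1 / (2 * Ce) * Xt + Xt := by field_simp; ring
    have q1 : lam * I ≤ I := mul_le_of_le_one_left hI0 hlam_le
    have q2 : 0 ≤ 2 * Ce * I := by positivity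
    have q3 : 0 ≤ 1 / (2 * Ce) * Xt := by positivity
    linarith
  refine hsplit.trans ?_
  rw [mul_assoc]
  exact mul_le_mul_of_nonneg_left hmain (by positivity)
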